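/- Let $a,b$ be integers with $a\ge 2$ and $b\ge 2a-1$. Points are triples $p=(x_p,y_p,s_p)$ of reals ($s_p$ is the score); $p$ dominates $q$ if ($x_p\le x_q$ and $y_p<y_q$) or ($x_p<x_q$ and $y_p\le y_q$). A layer is a finite list of points none of which dominates another; sorted by $x$ in increasing order it is sorted by $y$ in decreasing order. For an integer $k\ge 1$, an augmented $(a,b)$-tree over a layer is a leaf-oriented tree whose leaves, from left to right, hold the points of the layer sorted by $x$. All leaves have the same depth; every inner node has at most $b$ children, and at least $a$ children, or at least $2$ if it is the root. With each child an inner node stores two representative keys, the $x$- and the $y$-coordinate of the rightmost point below that child. A node $v$ has a field $add(v)\in\mathbb R$ and a list $top(v)$ if and only if its height (leaves have height $0$) is at least $\log_b k$. The score of a point of the tree is the score stored at its leaf plus $add(v)$ for all nodes $v$ on the path from the leaf to the root. The list $top(v)$ holds, in decreasing order of score, $k$ points of highest score in the subtree of $v$ (all its points if there are fewer than $k$), with scores that include the $add$ fields of the nodes strictly below $v$ and on the path, but not $add(v)$ itself. The empty tree is allowed. Time is counted as the number of steps of a program in a fixed language in which one step is a variable access, the creation or projection of a two-component memory cell, an addition,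 subtraction or comparison of real numbers, a case distinction, or a function call; space is the number of memory cells occupied by the tree. Write $\log n$ for $\lfloor\log_2 n\rfloor+1$ if $n\ge 1$, and $\log 0=1$; the height threshold $\log_b k$ is the usual logarithm. **Theorem.** There are one program and one constant $C$, depending only on $a$ and $b$, such that the following holds for every $k\ge 1$, which is given to each operation as an input. Here $|T|$ is the number of points of $T$, all trees are augmented $(a,b)$-trees with parameter $k$ over layers, and points keep their scores under every operation. 1. *Construction.* From the list, sorted by $x$, of the $m$ points of a layer, a tree $T_1$ over these points is constructed in at most $C(m+1)\log k$ time, and $T_1$ occupies at most $C(m+1)$ space. 2. *Search.* Given $T$ and $p$, the search in the $x$-dimension returns the leftmost point $q$ of $T$ with $x_q\ge x_p$ (the last point if there is none), and the search in the $y$-dimension returns the leftmost point $q$ of $T$ with $y_q\le y_p$ (the last point if there is none), each with its current score (nothing, if $T$ is empty), in at most $C\log|T|$ time. 3. *Insert.* Given $T$ and a point $p$ that forms a layer together with the points of $T$, a tree over the points of $T$ and $p$ is computed in at most $C\,k\log|T|$ time. 4. *Delete.* Given $T$ and the coordinates of a point in $T$, a tree over the points of $T$ without one point with these coordinates is computed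 in at most $C\,k\log|T|$ time. 5. *Split.* Given $T$ and a real number $val$, and either dimension, a tree $T_2$ over the points of $T$ whose coordinate in this dimension is $\le val$ and a tree $T_3$ over those for which it is $>val$ are computed in at most $C\,k\log|T|$ time. 6. *ConCat.* Given $T_1$ and $T_4$ with $\max T_1\le\min T_4$ (in the $x$-order) whose points together form a layer, a tree $T_5$ over the points of $T_1$ followed by those of $T_4$ is computed in at most $C\,k\log\max(|T_1|,|T_4|)$ time. -/

import Mathlib

namespace AugAB

/-! ## Model of computation

A first-order, call-by-value language over real numbers and pairs.  A program is a finite list of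
function bodies.  Every evaluation step has cost one: looking up a variable, allocating or
projecting a pair, one addition, subtraction or comparison of real numbers, one case distinction,
one function call.  There is no operation that works on a whole data structure at unit cost. -/

/-- Run-time values: a real number, the empty value, or a heap cell with two components. -/
inductive Val : Type
  | num (r : ℝ)
  | nil
  | pair (u v : Val)

/-- The number of memory cells that a value occupies (without sharing). -/
def Val.size : Val → ℕ
  | .num _ => 1
  | .nil => 1
  | .pair u v => u.size + v.size + 1

/-- Expressions. Variables are de Bruijn indices into the environment. -/
inductive Expr : Type
  | var (i : ℕ)
  | lit (n : ℕ)
  | nil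
  | pair (e₁ e₂ : Expr)
  | fst (e : Expr)
  | snd (e : Expr)
  | add (e₁ e₂ : Expr)
  | sub (e₁ e₂ : Expr)
  | ifLt (e₁ e₂ yes no : Expr)
  | ifPair (e yes no : Expr)
  | letE (e body : Expr)
  | call (f : ℕ) (e : Expr)

/-- A program: function number `f` has the `f`-th expression as its body, and its argument is
variable `0` of that body. -/
abbrev Program : Type := List Expr

/-- `Eval P env e v t`: in the environment `env`, the expression `e` of the program `P` evaluates
to `v` in exactly `t` steps. -/
inductive Eval (P : Program) : List Val → Expr → Val → ℕ → Prop
  | var {env i v} : env[i]? = some v → Eval P env (.var i) v 1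
  | lit {env n} : Eval P env (.lit n) (.num (n : ℝ)) 1
  | nil {env} : Eval P env .nil .nil 1
  | pair {env e₁ e₂ v₁ v₂ t₁ t₂} : Eval P env e₁ v₁ t₁ → Eval P env e₂ v₂ t₂ →
      Eval P env (.pair e₁ e₂) (.pair v₁ v₂) (t₁ + t₂ + 1)
  | fst {env e v₁ v₂ t} : Eval P env e (.pair v₁ v₂) t → Eval P env (.fst e) v₁ (t + 1)
  | snd {env e v₁ v₂ t} : Eval P env e (.pair v₁ v₂) t → Eval P env (.snd e) v₂ (t + 1)
  | add {env e₁ e₂ r₁ r₂ t₁ t₂} : Eval P env e₁ (.num r₁) t₁ → Eval P env e₂ (.num r₂) t₂ →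
      Eval P env (.add e₁ e₂) (.num (r₁ + r₂)) (t₁ + t₂ + 1)
  | sub {env e₁ e₂ r₁ r₂ t₁ t₂} : Eval P env e₁ (.num r₁) t₁ → Eval P env e₂ (.num r₂) t₂ →
      Eval P env (.sub e₁ e₂) (.num (r₁ - r₂)) (t₁ + t₂ + 1)
  | ifLt_yes {env e₁ e₂ y n r₁ r₂ v t₁ t₂ t} : Eval P env e₁ (.num r₁) t₁ →
      Eval P env e₂ (.num r₂) t₂ → r₁ < r₂ → Eval P env y v t →
      Eval P env (.ifLt e₁ e₂ y n) v (t₁ + t₂ + t + 1)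
  | ifLt_no {env e₁ e₂ y n r₁ r₂ v t₁ t₂ t} : Eval P env e₁ (.num r₁) t₁ →
      Eval P env e₂ (.num r₂) t₂ → ¬ r₁ < r₂ → Eval P env n v t →
      Eval P env (.ifLt e₁ e₂ y n) v (t₁ + t₂ + t + 1)
  | ifPair_pair {env e y n v₁ v₂ v t₁ t} : Eval P env e (.pair v₁ v₂) t₁ → Eval P env y v t →
      Eval P env (.ifPair e y n) v (t₁ + t + 1)
  | ifPair_nil {env e y n v t₁ t} : Eval P env e .nil t₁ → Eval P env n v t →
      Eval P env (.ifPair e y n) v (t₁ + t + 1)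
  | ifPair_num {env e y n r v t₁ t} : Eval P env e (.num r) t₁ → Eval P env n v t →
      Eval P env (.ifPair e y n) v (t₁ + t + 1)
  | letE {env e body u v t₁ t} : Eval P env e u t₁ → Eval P (u :: env) body v t →
      Eval P env (.letE e body) v (t₁ + t + 1)
  | call {env f e body u v t₁ t} : P[f]? = some body → Eval P env e u t₁ →
      Eval P [u] body v t → Eval P env (.call f e) v (t₁ + t + 1)

/-- Result and running time are determined by the program, the environment and the expression. -/
theorem Eval.det {P : Program} {env : List Val} {e : Expr} {v : Val} {t : ℕ}
    (h : Eval P env e v t) : ∀ {v' : Val} {t' : ℕ}, Eval P env e v' t' → v = v' ∧ t = t' := by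
  induction h with
  | var h => intro v' t' h'; cases h'; simp_all
  | lit => intro v' t' h'; cases h'; simp
  | nil => intro v' t' h'; cases h'; simp
  | pair _ _ ih₁ ih₂ =>
    intro v' t' h'
    cases h' with
    | pair h₁ h₂ =>
      obtain ⟨rfl, rfl⟩ := ih₁ h₁
      obtain ⟨rfl, rfl⟩ := ih₂ h₂
      simp
  | fst _ ih =>
    intro v' t' h'
    cases h' with
    | fst h₁ => have := ih h₁; simp_all
  | snd _ ih =>
    intro v' t' h'
    cases h' with
    | snd h₁ => have := ih h₁; simp_all
  | add _ _ ih₁ ih₂ =>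
    intro v' t' h'
    cases h' with
    | add h₁ h₂ => have := ih₁ h₁; have := ih₂ h₂; simp_all
  | sub _ _ ih₁ ih₂ =>
    intro v' t' h'
    cases h' with
    | sub h₁ h₂ => have := ih₁ h₁; have := ih₂ h₂; simp_all
  | ifLt_yes _ _ hlt _ ih₁ ih₂ ih =>
    intro v' t' h'
    cases h' with
    | ifLt_yes h₁ h₂ _ h₃ =>
      have := ih₁ h₁; have := ih₂ h₂; have := ih h₃; simp_all
    | ifLt_no h₁ h₂ hn _ =>
      have := ih₁ h₁; have := ih₂ h₂; simp_all
      exact absurd hn (not_le.mpr hlt)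
  | ifLt_no _ _ hn _ ih₁ ih₂ ih =>
    intro v' t' h'
    cases h' with
    | ifLt_yes h₁ h₂ hlt _ =>
      have := ih₁ h₁; have := ih₂ h₂; simp_all
      exact absurd hn (not_le.mpr hlt)
    | ifLt_no h₁ h₂ _ h₃ =>
      have := ih₁ h₁; have := ih₂ h₂; have := ih h₃; simp_all
  | ifPair_pair _ _ ih₁ ih =>
    intro v' t' h'
    cases h' with
    | ifPair_pair h₁ h₂ => have := ih₁ h₁; have := ih h₂; simp_all
    | ifPair_nil h₁ _ => have := ih₁ h₁; simp_all
    | ifPair_num h₁ _ => have := ih₁ h₁; simp_all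
  | ifPair_nil _ _ ih₁ ih =>
    intro v' t' h'
    cases h' with
    | ifPair_pair h₁ _ => have := ih₁ h₁; simp_all
    | ifPair_nil h₁ h₂ => have := ih₁ h₁; have := ih h₂; simp_all
    | ifPair_num h₁ _ => have := ih₁ h₁; simp_all
  | ifPair_num _ _ ih₁ ih =>
    intro v' t' h'
    cases h' with
    | ifPair_pair h₁ _ => have := ih₁ h₁; simp_all
    | ifPair_nil h₁ _ => have := ih₁ h₁; simp_all
    | ifPair_num h₁ h₂ => have := ih₁ h₁; have := ih h₂; simp_all
  | letE _ _ ih₁ ih =>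
    intro v' t' h'
    cases h' with
    | letE h₁ h₂ =>
      obtain ⟨rfl, rfl⟩ := ih₁ h₁
      have := ih h₂; simp_all
  | call hf _ _ ih₁ ih =>
    intro v' t' h'
    cases h' with
    | call hf' h₁ h₂ =>
      obtain ⟨rfl, rfl⟩ := ih₁ h₁
      obtain rfl : _ = _ := Option.some.inj (hf.symm.trans hf')
      have := ih h₂; simp_all

/-- Calling function `f` of the program `P` on the argument `x` returns `y` after `t` steps. -/
def Runs (P : Program) (f : ℕ) (x y : Val) (t : ℕ) : Prop :=
  ∃ body, P[f]? = some body ∧ Eval P [x] body y t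

/-! ## Points of a layer of maxima -/

/-- A point of the plane together with its score. -/
structure Pt where
  x : ℝ
  y : ℝ
  s : ℝ

/-- `p` dominates `q` (smaller coordinates are better). -/
def Dominates (p q : Pt) : Prop :=
  (p.x ≤ q.x ∧ p.y < q.y) ∨ (p.x < q.x ∧ p.y ≤ q.y)

/-- No point of the list dominates another one, as in a layer of maxima. -/
def IsLayer (l : List Pt) : Prop :=
  l.Pairwise fun p q => ¬ Dominates p q ∧ ¬ Dominates q p

/-- The list is sorted by the first coordinate; for a layer the second one then decreases. -/
def SortedX (l : List Pt) : Prop := l.Pairwise fun p q => p.x ≤ q.x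

/-- Add `d` to the score of a point. -/
def Pt.shift (d : ℝ) (p : Pt) : Pt := ⟨p.x, p.y, p.s + d⟩

/-- `t` is a list of `k` points of highest score of `l` (all of `l` if it has fewer than `k`
points), in order of decreasing score. -/
def IsTop (k : ℕ) (l t : List Pt) : Prop :=
  t.length = min k l.length ∧ (t.Pairwise fun p q => q.s ≤ p.s) ∧
    ∃ r, (t ++ r).Perm l ∧ ∀ p ∈ t, ∀ q ∈ r, q.s ≤ p.s

/-! ## Augmented `(a,b)`-trees -/

/-- The augmentation of a node: the field `add` and the list `top`. -/
structure Aug where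
  add : ℝ
  top : List Pt

mutual
/-- Leaf-oriented trees; a node may carry an augmentation. -/
inductive Tree : Type
  | leaf (aug : Option Aug) (p : Pt)
  | node (aug : Option Aug) (cs : Kids)
/-- The children of a node, from left to right, each with its representative keys for the
first and the second coordinate. -/
inductive Kids : Type
  | nil
  | cons (xk yk : ℝ) (t : Tree) (cs : Kids)
end

/-- The value of the field `add` of a node (`0` where there is none). -/
def addOf : Option Aug → ℝ
  | none => 0
  | some g => g.add

mutual
/-- The points in the subtree of a node from left to right, with their scores: the score of a
point is the one at its leaf plus the `add` fields of all the nodes of the subtree above it. -/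
noncomputable def Tree.points : Tree → List Pt
  | .leaf aug p => [p.shift (addOf aug)]
  | .node aug cs => cs.points.map (Pt.shift (addOf aug))
noncomputable def Kids.points : Kids → List Pt
  | .nil => []
  | .cons _ _ t cs => t.points ++ cs.points
end

def Kids.length : Kids → ℕ
  | .nil => 0
  | .cons _ _ _ cs => cs.length + 1

/-- A node of height `h` has the fields `add` and `top` if and only if `h ≥ log_b k`, that is
`k ≤ b ^ h`.  The list `top` holds the `k` points of highest score below the node; `l` lists
these points with the scores that do not yet take the field `add` of this node into account. -/
def AugOK (b k h : ℕ) (l : List Pt) (aug : Option Aug) : Prop :=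
  (k ≤ b ^ h ∧ ∃ g, aug = some g ∧ IsTop k l g.top) ∨ (¬ k ≤ b ^ h ∧ aug = none)

mutual
/-- The tree has all its leaves at depth `h`, every inner node has at most `b` children, the top
node (if it is not a leaf) has at least `lo` children and every other inner node at least `a`,
the augmentations are right, and the representative keys of a child are the coordinates of the
rightmost point of the child. -/
def Tree.WF (a b k : ℕ) : ℕ → ℕ → Tree → Prop
  | _, h, .leaf aug p => h = 0 ∧ AugOK b k 0 [p] aug
  | lo, h, .node aug cs => ∃ h', h = h' + 1 ∧ lo ≤ cs.length ∧ cs.length ≤ b ∧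
      AugOK b k h cs.points aug ∧ cs.WF a b k h'
def Kids.WF (a b k : ℕ) : ℕ → Kids → Prop
  | _, .nil => True
  | h, .cons xk yk t cs => (∃ q, t.points.getLast? = some q ∧ xk = q.x ∧ yk = q.y) ∧
      t.WF a b k a h ∧ cs.WF a b k h
end

/-- Possibly empty trees. -/
inductive AugTree : Type
  | empty
  | root (t : Tree)

noncomputable def AugTree.points : AugTree → List Pt
  | .empty => []
  | .root t => t.points

/-- `T` is an augmented `(a,b)`-tree with parameter `k` over the points of a layer of maxima. The
root, if it is not a leaf, has at least two children. -/
def AugTree.IsAug (a b k : ℕ) (T : AugTree) : Prop :=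
  SortedX T.points ∧ IsLayer T.points ∧
    match T with
    | .empty => True
    | .root t => ∃ h, t.WF a b k 2 h

/-! ## Representation of points and trees in memory -/

def Pt.enc (p : Pt) : Val := .pair (.num p.x) (.pair (.num p.y) (.num p.s))

def encPts : List Pt → Val
  | [] => .nil
  | p :: l => .pair p.enc (encPts l)

def encOptPt : Option Pt → Val
  | none => .nil
  | some p => p.enc

def encAug : Option Aug → Val
  | none => .nil
  | some g => .pair (.num g.add) (encPts g.top)

mutual
def Tree.enc : Tree → Val
  | .leaf aug p => .pair (.num 0) (.pair (encAug aug) p.enc)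
  | .node aug cs => .pair (.num 1) (.pair (encAug aug) cs.enc)
def Kids.enc : Kids → Val
  | .nil => .nil
  | .cons xk yk t cs => .pair (.pair (.num xk) (.pair (.num yk) t.enc)) cs.enc
end

def AugTree.enc : AugTree → Val
  | .empty => .nil
  | .root t => t.enc

/-! ## Search -/

/-- The point at which the search for the first coordinate `z` ends: the first point
`(x_i, y_i, s_i)` with `x_{i-1} < z ≤ x_i`, and the last point if there is no such point. -/
noncomputable def locateX (l : List Pt) (z : ℝ) : Option Pt :=
  (l.find? fun q => decide (z ≤ q.x)).or l.getLast?

/-- The point at which the search for the second coordinate `z` ends: the first point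
`(x_i, y_i, s_i)` with `y_{i-1} > z ≥ y_i`, and the last point if there is no such point. -/
noncomputable def locateY (l : List Pt) (z : ℝ) : Option Pt :=
  (l.find? fun q => decide (q.y ≤ z)).or l.getLast?

/-- The logarithm of the running times: `⌊log₂ n⌋ + 1`, so that it is positive for `n ≤ 1`. -/
def lg (n : ℕ) : ℕ := Nat.log 2 n + 1

end AugAB

open AugAB

/-!
The running time is counted in function activations: outside of the calls it makes, an activation
takes at most as many steps as the program has expression nodes, so it suffices to bound the number
of activations (`Calls`, `wp_sound`). The bounds are then obtained by running the bodies
symbolically (`Calls.of_pre`).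

A tree that has been cut along a path, or one below a new node, is correct except along its left or
right spine, where nodes may have too few children and a meaningless list `top` (`Spine`). All
updates rest on one repair of such a tree (`fixesKids`, `calls_finish`). It descends along the
spine, fuses each spine node with its neighbour and divides the children anew if there are more than
`b` of them; this is where `2 * a - 1 ≤ b` is needed. On the way down the field `add` of every node
that is taken apart is pushed to its children, which costs `O(1)` for a child with an augmentation
and `O(k)` for one without, since the latter has fewer than `k` points. On the way up the lists
`top` are computed by merging those of the children, up to length `k`, in time `O(k)` per node. Only
at the lowest height with an augmentation they have to be computed from scratch, by a merge sort
along the tree: for `O(k)` points this costs `O(k)` for each of the levels below (`calls_mk`,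
`sum_mkMax_le`). As there are `O(log n)` levels, the repair takes time `O(k log n)` (`fixCost_le`).

*Split* cuts along a search path and repairs both parts (`calls_split`). *ConCat* lifts the lower
tree to the height of the higher one by nodes with a single child, fuses the two roots and repairs
the spine along which the lifted tree lies (`calls_concat`). *Insert* is a split followed by two
concatenations, *Delete* a split that drops one leaf, followed by a concatenation. Since a layer
sorted by `x` is sorted by `y` in the opposite order, the searches in both dimensions lead to the
border of an initial segment (`mono_of_layer`), so that the keys decide in which child they go on.

*Construction* builds the tree level by level. The lists `top` of the lowest augmented nodes cost
`O(m log k)` altogether, because they require a merge sort on at most `log k` levels. There are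
`O(m / k)` such nodes, or a single one, and their number at least halves from one height to the
next, so the nodes above cost `O(m)` only; the same count bounds the memory
(`levelCost_add_totalCost_le`, `calls_build`).
-/

namespace AugAB

/-! ### Counting function calls instead of steps -/

/-- The number of nodes of an expression. Evaluating an expression visits each of them at most
once, apart from the work done inside function calls. -/
def Expr.nodes : Expr → ℕ
  | .var _ => 1
  | .lit _ => 1
  | .nil => 1
  | .pair e₁ e₂ => e₁.nodes + e₂.nodes + 1
  | .fst e => e.nodes + 1
  | .snd e => e.nodes + 1
  | .add e₁ e₂ => e₁.nodes + e₂.nodes + 1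
  | .sub e₁ e₂ => e₁.nodes + e₂.nodes + 1
  | .ifLt e₁ e₂ y n => e₁.nodes + e₂.nodes + y.nodes + n.nodes + 1
  | .ifPair e y n => e.nodes + y.nodes + n.nodes + 1
  | .letE e body => e.nodes + body.nodes + 1
  | .call _ e => e.nodes + 1

/-- The total number of expression nodes of a program; it bounds the number of steps that a single
function activation takes outside the calls it makes. -/
def Program.nodes (P : Program) : ℕ := (P.map Expr.nodes).sum

/-- Function `f` maps `x` to `y` with at most `n` function activations (including its own). The
running time is expressed through the number of activations, each of which costs at most
`P.nodes` steps. -/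
def Calls (P : Program) (f : ℕ) (x y : Val) (n : ℕ) : Prop :=
  ∃ t, Runs P f x y t ∧ t ≤ P.nodes * n

theorem Calls.mono {P : Program} {f : ℕ} {x y : Val} {m n : ℕ} (h : Calls P f x y m)
    (hmn : m ≤ n) : Calls P f x y n := by
  obtain ⟨t, h₁, h₂⟩ := h
  exact ⟨t, h₁, h₂.trans (Nat.mul_le_mul_left _ hmn)⟩

/-- Some result `v` of a call on `u`, obtained with `n` activations, satisfies `Q v n`. -/
def Returns (R : Val → Val → ℕ → Prop) (u : Val) (Q : Val → ℕ → Prop) : Prop :=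
  ∃ v n, R u v n ∧ Q v n

theorem Returns.intro {R : Val → Val → ℕ → Prop} {u v : Val} {n : ℕ} {Q : Val → ℕ → Prop}
    (h : R u v n) (hQ : Q v n) : Returns R u Q := ⟨v, n, h, hQ⟩

/-- Keeps the simplifier out of the continuation, whose first argument is not yet known. -/
@[congr] theorem Returns.congr_arg {R : Val → Val → ℕ → Prop} {u u' : Val} {Q : Val → ℕ → Prop}
    (h : u = u') : Returns R u Q = Returns R u' Q := by rw [h]

/-- The postcondition of a function body: the value is `y`, with at most `n` activations. -/
def Within (y : Val) (n : ℕ) (v : Val) (c : ℕ) : Prop := v = y ∧ c ≤ n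

/-- The weakest precondition: `e` evaluates in `env`, and its value together with the number of
activations, counted from `c` on, satisfies `Q`. The relation `R f x y n` describes the calls. -/
def wp (R : ℕ → Val → Val → ℕ → Prop) : Expr → List Val → ℕ → (Val → ℕ → Prop) → Prop
  | .var i, env, c, Q => ∃ v, env[i]? = some v ∧ Q v c
  | .lit n, _, c, Q => Q (.num (n : ℝ)) c
  | .nil, _, c, Q => Q .nil c
  | .pair e₁ e₂, env, c, Q => wp R e₁ env c fun v₁ c => wp R e₂ env c fun v₂ c => Q (.pair v₁ v₂) c
  | .fst e, env, c, Q => wp R e env c fun v c => match v with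
    | .pair v₁ _ => Q v₁ c
    | _ => False
  | .snd e, env, c, Q => wp R e env c fun v c => match v with
    | .pair _ v₂ => Q v₂ c
    | _ => False
  | .add e₁ e₂, env, c, Q => wp R e₁ env c fun v₁ c => wp R e₂ env c fun v₂ c => match v₁, v₂ with
    | .num r₁, .num r₂ => Q (.num (r₁ + r₂)) c
    | _, _ => False
  | .sub e₁ e₂, env, c, Q => wp R e₁ env c fun v₁ c => wp R e₂ env c fun v₂ c => match v₁, v₂ with
    | .num r₁, .num r₂ => Q (.num (r₁ - r₂)) c
    | _, _ => False
  | .ifLt e₁ e₂ y n, env, c, Q => wp R e₁ env c fun v₁ c => wp R e₂ env c fun v₂ c =>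
    match v₁, v₂ with
    | .num r₁, .num r₂ => (r₁ < r₂ → wp R y env c Q) ∧ (¬ r₁ < r₂ → wp R n env c Q)
    | _, _ => False
  | .ifPair e y n, env, c, Q => wp R e env c fun v c => match v with
    | .pair _ _ => wp R y env c Q
    | _ => wp R n env c Q
  | .letE e body, env, c, Q => wp R e env c fun u c => wp R body (u :: env) c Q
  | .call f e, env, c, Q => wp R e env c fun u c => Returns (R f) u fun v n => Q v (c + n)

/-- The evaluation of an expression takes at most one step for each of its nodes, apart from the
steps of the function activations, which are counted in `n`. -/
theorem wp_sound {P : Program} (e : Expr) : ∀ {env : List Val} {c : ℕ} {Q : Val → ℕ → Prop},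
    wp (Calls P) e env c Q →
    ∃ v t n, Eval P env e v t ∧ t ≤ e.nodes + P.nodes * n ∧ Q v (c + n) := by
  induction e with
  | var i =>
    rintro env c Q ⟨v, h, hQ⟩
    exact ⟨v, 1, 0, .var h, by simp [Expr.nodes], hQ⟩
  | lit n => exact fun {env c Q} h => ⟨_, 1, 0, .lit, by simp [Expr.nodes], h⟩
  | nil => exact fun {env c Q} h => ⟨_, 1, 0, .nil, by simp [Expr.nodes], h⟩
  | pair e₁ e₂ ih₁ ih₂ =>
    intro env c Q h
    obtain ⟨v₁, t₁, n₁, h₁, l₁, h⟩ := ih₁ h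
    obtain ⟨v₂, t₂, n₂, h₂, l₂, h⟩ := ih₂ h
    exact ⟨_, _, n₁ + n₂, .pair h₁ h₂, by simp only [Expr.nodes, mul_add]; omega,
      by rwa [← add_assoc]⟩
  | fst e ih =>
    intro env c Q h
    obtain ⟨v, t, n, h₁, l, h⟩ := ih h
    match v, h₁, h with
    | .pair v₁ v₂, h₁, h => exact ⟨_, _, n, .fst h₁, by simp only [Expr.nodes]; omega, h⟩
  | snd e ih =>
    intro env c Q h
    obtain ⟨v, t, n, h₁, l, h⟩ := ih h
    match v, h₁, h with
    | .pair v₁ v₂, h₁, h => exact ⟨_, _, n, .snd h₁, by simp only [Expr.nodes]; omega, h⟩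
  | add e₁ e₂ ih₁ ih₂ =>
    intro env c Q h
    obtain ⟨v₁, t₁, n₁, h₁, l₁, h⟩ := ih₁ h
    obtain ⟨v₂, t₂, n₂, h₂, l₂, h⟩ := ih₂ h
    match v₁, v₂, h₁, h₂, h with
    | .num r₁, .num r₂, h₁, h₂, h =>
      exact ⟨_, _, n₁ + n₂, .add h₁ h₂, by simp only [Expr.nodes, mul_add]; omega,
        by rwa [← add_assoc]⟩
  | sub e₁ e₂ ih₁ ih₂ =>
    intro env c Q h
    obtain ⟨v₁, t₁, n₁, h₁, l₁, h⟩ := ih₁ h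
    obtain ⟨v₂, t₂, n₂, h₂, l₂, h⟩ := ih₂ h
    match v₁, v₂, h₁, h₂, h with
    | .num r₁, .num r₂, h₁, h₂, h =>
      exact ⟨_, _, n₁ + n₂, .sub h₁ h₂, by simp only [Expr.nodes, mul_add]; omega,
        by rwa [← add_assoc]⟩
  | ifLt e₁ e₂ y n ih₁ ih₂ ihy ihn =>
    intro env c Q h
    obtain ⟨v₁, t₁, n₁, h₁, l₁, h⟩ := ih₁ h
    obtain ⟨v₂, t₂, n₂, h₂, l₂, h⟩ := ih₂ h
    match v₁, v₂, h₁, h₂, h with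
    | .num r₁, .num r₂, h₁, h₂, h =>
      by_cases hr : r₁ < r₂
      · obtain ⟨v, t, n₃, h₃, l₃, h⟩ := ihy (h.1 hr)
        exact ⟨_, _, n₁ + n₂ + n₃, .ifLt_yes h₁ h₂ hr h₃,
          by simp only [Expr.nodes, mul_add]; omega, by rwa [← add_assoc, ← add_assoc]⟩
      · obtain ⟨v, t, n₃, h₃, l₃, h⟩ := ihn (h.2 hr)
        exact ⟨_, _, n₁ + n₂ + n₃, .ifLt_no h₁ h₂ hr h₃,
          by simp only [Expr.nodes, mul_add]; omega, by rwa [← add_assoc, ← add_assoc]⟩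
  | ifPair e y n ih ihy ihn =>
    intro env c Q h
    obtain ⟨v₁, t₁, n₁, h₁, l₁, h⟩ := ih h
    match v₁, h₁, h with
    | .pair _ _, h₁, h =>
      obtain ⟨v, t, n₃, h₃, l₃, h⟩ := ihy h
      exact ⟨_, _, n₁ + n₃, .ifPair_pair h₁ h₃, by simp only [Expr.nodes, mul_add]; omega,
        by rwa [← add_assoc]⟩
    | .nil, h₁, h =>
      obtain ⟨v, t, n₃, h₃, l₃, h⟩ := ihn h
      exact ⟨_, _, n₁ + n₃, .ifPair_nil h₁ h₃, by simp only [Expr.nodes, mul_add]; omega,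
        by rwa [← add_assoc]⟩
    | .num r, h₁, h =>
      obtain ⟨v, t, n₃, h₃, l₃, h⟩ := ihn h
      exact ⟨_, _, n₁ + n₃, .ifPair_num h₁ h₃, by simp only [Expr.nodes, mul_add]; omega,
        by rwa [← add_assoc]⟩
  | letE e body ih ihb =>
    intro env c Q h
    obtain ⟨v₁, t₁, n₁, h₁, l₁, h⟩ := ih h
    obtain ⟨v₂, t₂, n₂, h₂, l₂, h⟩ := ihb h
    exact ⟨_, _, n₁ + n₂, .letE h₁ h₂, by simp only [Expr.nodes, mul_add]; omega,
      by rwa [← add_assoc]⟩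
  | call f e ih =>
    intro env c Q h
    obtain ⟨v₁, t₁, n₁, h₁, l₁, v, n, ⟨t, ⟨body, hb, hr⟩, l⟩, h⟩ := ih h
    exact ⟨_, _, n₁ + n, .call hb h₁ hr, by simp only [Expr.nodes, mul_add]; omega,
      by rwa [← add_assoc]⟩

/-- The activation of `f` itself is the initial count `1`; its own steps are at most
`body.nodes ≤ P.nodes`. -/
theorem Calls.of_wp {P : Program} {f : ℕ} {body : Expr} {x y : Val} {n : ℕ}
    (hf : P[f]? = some body)
    (h : wp (Calls P) body [x] 1 (Within y n)) : Calls P f x y n := by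
  obtain ⟨v, t, m, h₁, l, rfl, hn⟩ := wp_sound body h
  refine ⟨t, ⟨body, hf, h₁⟩, ?_⟩
  have hb : body.nodes ≤ P.nodes :=
    List.single_le_sum (by simp) _ (List.mem_map_of_mem (List.mem_of_getElem? hf))
  calc t ≤ P.nodes + P.nodes * m := by omega
    _ = P.nodes * (1 + m) := by ring
    _ ≤ _ := Nat.mul_le_mul_left _ hn

/-! ### Expressions with named variables -/

/-- Expressions with named variables: an expression as a function of the number of variables in
scope, so that a variable can be given by the depth of its binder. -/
def Src : Type := ℕ → Expr

namespace Src

/-- The variable whose binder has depth `l`. -/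
def var (l : ℕ) : Src := fun d => .var (d - 1 - l)
def lit (n : ℕ) : Src := fun _ => .lit n
def nil : Src := fun _ => .nil
def pair (e₁ e₂ : Src) : Src := fun d => .pair (e₁ d) (e₂ d)
def fst (e : Src) : Src := fun d => .fst (e d)
def snd (e : Src) : Src := fun d => .snd (e d)
def add (e₁ e₂ : Src) : Src := fun d => .add (e₁ d) (e₂ d)
def sub (e₁ e₂ : Src) : Src := fun d => .sub (e₁ d) (e₂ d)
def ifLt (e₁ e₂ y n : Src) : Src := fun d => .ifLt (e₁ d) (e₂ d) (y d) (n d)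
def ifPair (e y n : Src) : Src := fun d => .ifPair (e d) (y d) (n d)
def call (f : ℕ) (e : Src) : Src := fun d => .call f (e d)
/-- The value of `e` is given a name in `body`. -/
def bind (e : Src) (body : Src → Src) : Src :=
  fun d => .letE (e d) (body (var d) (d + 1))

/-- The body of a function whose argument is passed to `body`. -/
def lam (body : Src → Src) : Expr := body (var 0) 1

/-- The precondition `wp` for an expression with named variables, in scope `d`. -/
def pre (R : ℕ → Val → Val → ℕ → Prop) (e : Src) (d : ℕ) (env : List Val) (c : ℕ)
    (Q : Val → ℕ → Prop) : Prop := wp R (e d) env c Q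

/-- `v` is present and satisfies `Q`. -/
def Found (v : Option Val) (c : ℕ) (Q : Val → ℕ → Prop) : Prop := ∃ u, v = some u ∧ Q u c

/-- The value is a pair whose components satisfy `Q`. -/
def OnPair (v : Val) (Q : Val → Val → Prop) : Prop := ∃ v₁ v₂, v = .pair v₁ v₂ ∧ Q v₁ v₂

/-- The value is a real number that satisfies `Q`. -/
def OnNum (v : Val) (Q : ℝ → Prop) : Prop := ∃ r, v = .num r ∧ Q r

/-- A case distinction on whether the value is a pair. -/
def CasePair : Val → Prop → Prop → Prop
  | .pair _ _, p, _ => p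
  | .nil, _, q => q
  | .num _, _, q => q

/-- A case distinction on `c`. -/
def Branch (c p q : Prop) : Prop := (c → p) ∧ (¬ c → q)

theorem Branch.intro {c p q : Prop} (h₁ : c → p) (h₂ : ¬ c → q) : Branch c p q := ⟨h₁, h₂⟩

/-! The following congruence rules keep the simplifier out of the parts of a precondition that
are not yet under evaluation. -/

@[congr] theorem pre_congr {R : ℕ → Val → Val → ℕ → Prop} {e : Src} {d : ℕ} {env : List Val}
    {c : ℕ} {Q : Val → ℕ → Prop} : pre R e d env c Q = pre R e d env c Q := rfl

@[congr] theorem found_congr {v v' : Option Val} {c : ℕ} {Q : Val → ℕ → Prop} (h : v = v') :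
    Found v c Q = Found v' c Q := by rw [h]

@[congr] theorem onPair_congr {v v' : Val} {Q : Val → Val → Prop} (h : v = v') :
    OnPair v Q = OnPair v' Q := by rw [h]

@[congr] theorem onNum_congr {v v' : Val} {Q : ℝ → Prop} (h : v = v') :
    OnNum v Q = OnNum v' Q := by rw [h]

@[congr] theorem casePair_congr {v v' : Val} {p q : Prop} (h : v = v') :
    CasePair v p q = CasePair v' p q := by rw [h]

@[congr] theorem branch_congr {c c' p q : Prop} (h : c = c') : Branch c p q = Branch c' p q := by
  rw [h]

section
variable {R : ℕ → Val → Val → ℕ → Prop} {d c : ℕ} {env : List Val} {Q : Val → ℕ → Prop}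
  {e e₁ e₂ e₃ e₄ : Src}

@[simp] theorem found_some {v : Val} : Found (some v) c Q = Q v c := by simp [Found]
@[simp] theorem onPair_pair {v₁ v₂ : Val} {Q : Val → Val → Prop} :
    OnPair (.pair v₁ v₂) Q = Q v₁ v₂ := by simp [OnPair]
@[simp] theorem onNum_num {r : ℝ} {Q : ℝ → Prop} : OnNum (.num r) Q = Q r := by simp [OnNum]
@[simp] theorem casePair_pair {v₁ v₂ : Val} {p q : Prop} : CasePair (.pair v₁ v₂) p q = p := rfl
@[simp] theorem casePair_nil {p q : Prop} : CasePair .nil p q = q := rfl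
@[simp] theorem casePair_num {r : ℝ} {p q : Prop} : CasePair (.num r) p q = q := rfl
@[simp] theorem branch_true {p q : Prop} : Branch True p q = p := by simp [Branch]
@[simp] theorem branch_false {p q : Prop} : Branch False p q = q := by simp [Branch]

@[simp] theorem pre_var {l : ℕ} : pre R (var l) d env c Q = Found env[d - 1 - l]? c Q := rfl
@[simp] theorem pre_lit {n : ℕ} : pre R (lit n) d env c Q = Q (.num (n : ℝ)) c := rfl
@[simp] theorem pre_nil : pre R nil d env c Q = Q .nil c := rfl
@[simp] theorem pre_pair : pre R (pair e₁ e₂) d env c Q =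
    pre R e₁ d env c fun v₁ c => pre R e₂ d env c fun v₂ c => Q (.pair v₁ v₂) c := rfl
@[simp] theorem pre_fst : pre R (fst e) d env c Q =
    pre R e d env c fun v c => OnPair v fun v₁ _ => Q v₁ c := by
  simp only [pre, fst, wp]; congr; funext v c; cases v <;> simp [OnPair]
@[simp] theorem pre_snd : pre R (snd e) d env c Q =
    pre R e d env c fun v c => OnPair v fun _ v₂ => Q v₂ c := by
  simp only [pre, snd, wp]; congr; funext v c; cases v <;> simp [OnPair]
@[simp] theorem pre_add : pre R (add e₁ e₂) d env c Q =
    pre R e₁ d env c fun v₁ c => pre R e₂ d env c fun v₂ c =>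
      OnNum v₁ fun r₁ => OnNum v₂ fun r₂ => Q (.num (r₁ + r₂)) c := by
  simp only [pre, add, wp]; congr; funext v c; congr; funext v' c
  cases v <;> cases v' <;> simp [OnNum]
@[simp] theorem pre_sub : pre R (sub e₁ e₂) d env c Q =
    pre R e₁ d env c fun v₁ c => pre R e₂ d env c fun v₂ c =>
      OnNum v₁ fun r₁ => OnNum v₂ fun r₂ => Q (.num (r₁ - r₂)) c := by
  simp only [pre, sub, wp]; congr; funext v c; congr; funext v' c
  cases v <;> cases v' <;> simp [OnNum]
@[simp] theorem pre_ifLt : pre R (ifLt e₁ e₂ e₃ e₄) d env c Q =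
    pre R e₁ d env c fun v₁ c => pre R e₂ d env c fun v₂ c =>
      OnNum v₁ fun r₁ => OnNum v₂ fun r₂ =>
        Branch (r₁ < r₂) (pre R e₃ d env c Q) (pre R e₄ d env c Q) := by
  simp only [pre, ifLt, wp]; congr; funext v c; congr; funext v' c
  cases v <;> cases v' <;> simp [OnNum, Branch]
@[simp] theorem pre_ifPair : pre R (ifPair e e₁ e₂) d env c Q =
    pre R e d env c fun v c => CasePair v (pre R e₁ d env c Q) (pre R e₂ d env c Q) := by
  simp only [pre, ifPair, wp]; congr; funext v c; cases v <;> simp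
@[simp] theorem pre_call {f : ℕ} : pre R (call f e) d env c Q =
    pre R e d env c fun u c => Returns (R f) u fun v n => Q v (c + n) := rfl
@[simp] theorem pre_bind {body : Src → Src} : pre R (bind e body) d env c Q =
    pre R e d env c fun u c => pre R (body (var d)) (d + 1) (u :: env) c Q := rfl

end

end Src

/-- The rule by which all functions of the program are verified. The simplifier, with the equations
above, runs the body symbolically up to the next call or undecided comparison. -/
theorem Calls.of_pre {P : Program} {f : ℕ} {body : Src → Src} {x y : Val} {n : ℕ}
    (hf : P[f]? = some (Src.lam body))
    (h : Src.pre (Calls P) (body (Src.var 0)) 1 [x] 1 (Within y n)) : Calls P f x y n :=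
  .of_wp hf h

local infixr:67 " ,, " => Src.pair

/-! ### The program -/

/-! Functions of several arguments take nested pairs. Below, `k` is the parameter of the trees, `d`
a direction (a pair for the right end, `nil` for the left end), and a list of children is given by
its representation in memory, a list of cells that consist of the two keys and the tree. A flag is
`nil` for a node without augmentation and a pair for a node with one. The namespace `Fn` holds the
numbers of the functions. -/
namespace Fn
def shiftPts := 0
def merge := 1
def top := 2
def topKids := 3
def bump := 4
def bumpKids := 5
def opn := 6
def lastKey := 7
def cell := 8
def mk := 9
def app := 10
def revApp := 11
def orient := 12
def len := 13
def take := 14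
def drop := 15
def fuse := 16
def fix := 17
def finish := 18
def test := 19
def search := 20
def searchKids := 21
def cut := 22
def cutKids := 23
def mulB := 24
def pow := 25
def wrap := 26
def join := 27
def concat := 28
def split := 29
def leaf := 30
def searchX := 31
def searchY := 32
def splitX := 33
def splitY := 34
def insert := 35
def delete := 36
def leaves := 37
def group := 38
def buildUp := 39
def build := 40
def fixKids := 41
def rawNode := 42
def chunk := 43
def flag := 44
def cutAt := 45
def spineNode := 46
def root := 47
end Fn

namespace Src

/-- A pair that serves as the truth value `true`, as the direction `true`, and as an augmentation
with `add = 0` and an empty list `top`. -/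
abbrev yes : Src := lit 0 ,, nil
/-- The entry of a tree that is `0` for a leaf and `1` for an inner node. -/
abbrev tag (t : Src) : Src := t.fst
/-- The augmentation of a tree. -/
abbrev aug (t : Src) : Src := t.snd.fst
/-- The point of a leaf, or the children of an inner node. -/
abbrev content (t : Src) : Src := t.snd.snd
/-- The tree in a cell of a list of children. -/
abbrev tree (c : Src) : Src := c.snd.snd
/-- The point `p` with `d` added to its score. -/
abbrev shiftPt (d p : Src) : Src := p.fst ,, p.snd.fst ,, add p.snd.snd d
end Src

open Src

/-- `(d, l)`: adds `d` to the scores of the points of `l`. -/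
def shiftPtsBody : Expr := lam fun x =>
  ifPair x.snd (shiftPt x.fst x.snd.fst ,, call Fn.shiftPts (x.fst ,, x.snd.snd)) nil

/-- `(n, l₁, l₂)`: the first `n` points of the merger of two lists sorted by decreasing score. -/
def mergeBody : Expr := lam fun x =>
  bind x.snd.fst fun l₁ => bind x.snd.snd fun l₂ => bind (sub x.fst (lit 1)) fun n =>
  ifLt x.fst (lit 1) nil <|
  ifPair l₁
    (ifPair l₂
      (ifLt l₁.fst.snd.snd l₂.fst.snd.snd
        (l₂.fst ,, call Fn.merge (n ,, l₁ ,, l₂.snd))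
        (l₁.fst ,, call Fn.merge (n ,, l₁.snd ,, l₂)))
      (l₁.fst ,, call Fn.merge (n ,, l₁.snd ,, l₂)))
    (ifPair l₂ (l₂.fst ,, call Fn.merge (n ,, l₁ ,, l₂.snd)) nil)

/-- `(k, t)`: the `k` points of highest score of the tree `t`, from its list `top` if it has one. -/
def topBody : Expr := lam fun x =>
  bind x.snd fun t =>
  ifPair t.aug (call Fn.shiftPts t.aug) <|
  ifLt t.tag (lit 1) (t.content ,, nil) (call Fn.topKids (x.fst ,, t.content))

/-- `(k, cs)`: the `k` points of highest score of the trees of the list `cs`. -/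
def topKidsBody : Expr := lam fun x =>
  ifPair x.snd
    (call Fn.merge (x.fst ,, call Fn.top (x.fst ,, x.snd.fst.tree) ,,
      call Fn.topKids (x.fst ,, x.snd.snd)))
    nil

/-- `(d, t)`: adds `d` to the scores of all points of `t`. Trees that are too low to have an
augmentation at the root have fewer than `k` leaves, which are updated one by one. -/
def bumpBody : Expr := lam fun x =>
  bind x.snd fun t =>
  ifPair t.aug (t.tag ,, (add t.aug.fst x.fst ,, t.aug.snd) ,, t.content) <|
  ifLt t.tag (lit 1) (t.tag ,, nil ,, shiftPt x.fst t.content)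
    (t.tag ,, nil ,, call Fn.bumpKids (x.fst ,, t.content))

/-- `(d, cs)`: adds `d` to the scores of all points of the trees of the list `cs`. -/
def bumpKidsBody : Expr := lam fun x =>
  bind x.snd fun cs =>
  ifPair cs
    ((cs.fst.fst ,, cs.fst.snd.fst ,, call Fn.bump (x.fst ,, cs.fst.tree)) ,,
      call Fn.bumpKids (x.fst ,, cs.snd))
    nil

/-- `t`: the children of the inner node `t`, into which its field `add` is pushed down. -/
def opnBody : Expr := lam fun t =>
  ifPair t.aug (call Fn.bumpKids (t.aug.fst ,, t.content)) t.content

/-- `cs`: the keys of the last child. -/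
def lastKeyBody : Expr := lam fun cs =>
  ifPair cs.snd (call Fn.lastKey cs.snd) (cs.fst.fst ,, cs.fst.snd.fst)

/-- `t`: the tree `t` together with its keys. -/
def cellBody : Expr := lam fun t =>
  ifLt t.tag (lit 1) (t.content.fst ,, t.content.snd.fst ,, t) <|
  bind (call Fn.lastKey t.content) fun q => q.fst ,, q.snd ,, t

/-- `(k, flag, cs)`: the node over the children `cs`, with a newly computed list `top`. -/
def mkBody : Expr := lam fun x =>
  bind x.snd.snd fun cs =>
  ifPair x.snd.fst (lit 1 ,, (lit 0 ,, call Fn.topKids (x.fst ,, cs)) ,, cs) (lit 1 ,, nil ,, cs)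

/-- A node over given children with an empty list `top` in its augmentation, if it has one. -/
def rawNodeBody : Expr := lam fun x =>
  ifPair x.fst (lit 1 ,, yes ,, x.snd) (lit 1 ,, nil ,, x.snd)

/-- The same, but nothing if there are no children. -/
def spineNodeBody : Expr := lam fun x => ifPair x.snd (call Fn.rawNode x) nil

/-- The number of children in the first of the nodes into which `n > b` children are divided:
the smaller one of `n - a` and `b`. -/
def chunkBody (a b : ℕ) : Expr := lam fun n =>
  ifLt (lit b) (sub n (lit a)) (lit b) (sub n (lit a))

/-- Whether the nodes of a height `h` have an augmentation, computed from `k` and `b ^ h`. -/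
def flagBody : Expr := lam fun x => ifLt x.snd x.fst nil yes

/-- `(l, m)`: the concatenation of two lists. -/
def appBody : Expr := lam fun x =>
  ifPair x.fst (x.fst.fst ,, call Fn.app (x.fst.snd ,, x.snd)) x.snd

/-- `(l, m)`: the reversal of `l` followed by `m`. -/
def revAppBody : Expr := lam fun x =>
  ifPair x.fst (call Fn.revApp (x.fst.snd ,, x.fst.fst ,, x.snd)) x.snd

/-- `(d, l)`: the list `l`, reversed if `d` is a pair. -/
def orientBody : Expr := lam fun x =>
  ifPair x.fst (call Fn.revApp (x.snd ,, nil)) x.snd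

/-- `l`: the length of the list `l`. -/
def lenBody : Expr := lam fun l =>
  ifPair l (add (call Fn.len l.snd) (lit 1)) (lit 0)

/-- `(n, l)`: the first `n` elements of `l`. -/
def takeBody : Expr := lam fun x =>
  ifLt x.fst (lit 1) nil (x.snd.fst ,, call Fn.take (sub x.fst (lit 1) ,, x.snd.snd))

/-- `(n, l)`: the list `l` without its first `n` elements. -/
def dropBody : Expr := lam fun x =>
  ifLt x.fst (lit 1) x.snd (call Fn.drop (sub x.fst (lit 1) ,, x.snd.snd))

/-- `(k, d, u, w)`: the children of two adjacent nodes `u` and `w`, where `u` is next to the end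
`d`, are put together into one node, or divided among two nodes if there are more than `b`. The
first of the resulting nodes lies on the spine and has an empty list `top`, the second one (`nil` if
it is absent) is correct. -/
def fuseBody (b : ℕ) : Expr := lam fun x =>
  bind x.snd.fst fun d => bind x.snd.snd.fst fun u => bind x.snd.snd.snd fun w =>
  bind (call Fn.app (call Fn.orient (d ,, call Fn.opn u) ,, call Fn.orient (d ,, call Fn.opn w)))
    fun all =>
  bind (call Fn.len all) fun n =>
  ifLt (lit b) n
    (bind (call Fn.chunk n) fun f =>
      bind (call Fn.orient (d ,, call Fn.take (f ,, all))) fun cs =>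
      call Fn.rawNode (u.aug ,, cs) ,,
        call Fn.mk (x.fst ,, u.aug ,, call Fn.orient (d ,, call Fn.drop (f ,, all))))
    (bind (call Fn.orient (d ,, all)) fun cs => call Fn.rawNode (u.aug ,, cs) ,, nil)

/-- `(k, d, cs)`: repairs a list of children, of which the first one is a spine node: it is fused
with its neighbour, the repair continues with its children, and if it then has fewer than `a`
children, it is fused again. -/
def fixKidsBody (a : ℕ) : Expr := lam fun x =>
  bind x.fst fun k => bind x.snd.fst fun d => bind x.snd.snd fun cs =>
  ifLt cs.fst.tree.tag (lit 1) cs <|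
    bind (call Fn.fuse (k ,, d ,, cs.fst.tree ,, cs.snd.fst.tree)) fun F =>
    bind (call Fn.fix (k ,, d ,, F.fst)) fun u =>
    ifPair F.snd
      (ifLt (call Fn.len u.content) (lit a)
        (bind (call Fn.fuse (k ,, d ,, u ,, F.snd)).fst fun v =>
          call Fn.cell (call Fn.mk (k ,, v.aug ,, call Fn.opn v)) ,, cs.snd.snd)
        (call Fn.cell u ,, call Fn.cell F.snd ,, cs.snd.snd))
      (call Fn.cell u ,, cs.snd.snd)

/-- `(k, d, t)`: the spine node `t`, with repaired children and with a newly computed list `top`. -/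
def fixBody : Expr := lam fun x =>
  bind x.fst fun k => bind x.snd.fst fun d => bind x.snd.snd fun t =>
  bind (call Fn.orient (d ,, call Fn.opn t)) fun cs =>
  call Fn.mk (k ,, t.aug ,, call Fn.orient (d ,, call Fn.fixKids (k ,, d ,, cs)))

/-- `(k, d, t)`: removes the nodes with a single child at the top of `t` and repairs the spine; if
the root is left with a single child, it is removed, too. -/
def finishBody : Expr := lam fun x =>
  bind x.snd.snd fun t =>
  ifPair t
    (ifLt t.tag (lit 1) t <|
      ifPair t.content.snd
        (bind (call Fn.fix x) fun r =>
          ifPair r.content.snd r (call Fn.opn r).fst.tree)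
        (call Fn.finish (x.fst ,, x.snd.fst ,, (call Fn.opn t).fst.tree)))
    nil

/-- `((m, z), cell)`: whether the query `m` with the value `z` leads to the right of a child with
the given keys. The queries are `x ≤ z` for `m = 0`, `z < y` for `m = 1`, and `x < z` otherwise. -/
def testBody : Expr := lam fun x =>
  bind x.fst.fst fun m => bind x.fst.snd fun z => bind x.snd fun c =>
  ifLt m (lit 1) (ifLt z c.fst nil yes) <|
  ifLt m (lit 2) (ifLt z c.snd.fst yes nil) (ifLt c.fst z yes nil)

/-- `(q, t)`: the first point of `t` that does not satisfy the query `q`, or the last one. -/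
def searchBody : Expr := lam fun x =>
  bind x.snd fun t =>
  bind (ifLt t.tag (lit 1) t.content (call Fn.searchKids (x.fst ,, t.content))) fun p =>
  ifPair t.aug (shiftPt t.aug.fst p) p

/-- `(q, cs)`: the same for the trees of a list of children. -/
def searchKidsBody : Expr := lam fun x =>
  bind x.fst fun q => bind x.snd fun cs =>
  ifPair cs.snd
    (ifPair (call Fn.test (q ,, cs.fst)) (call Fn.searchKids (q ,, cs.snd))
      (call Fn.search (q ,, cs.fst.tree)))
    (call Fn.search (q ,, cs.fst.tree))

/-- `(q, t)`: cuts `t` along a search path into a tree of the points that satisfy the query and one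
of the remaining points, either of which may be `nil`. The nodes on the path have empty lists `top`
and possibly too few children. The query `3` moreover removes the point at which the search ends. -/
def cutBody : Expr := lam fun x =>
  bind x.fst fun q => bind x.snd fun t =>
  ifLt t.tag (lit 1)
    (ifPair (call Fn.test (q ,, t.content)) (t ,, nil) (ifLt (lit 2) q.fst (nil ,, nil) (nil ,, t)))
    (bind (call Fn.cutKids (q ,, call Fn.opn t)) fun r =>
      call Fn.spineNode (t.aug ,, r.fst) ,, call Fn.spineNode (t.aug ,, r.snd))

/-- `(q, cs)`: cuts the first child and passes the others to the right part. -/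
def cutAtBody : Expr := lam fun x =>
  bind x.snd fun cs =>
  bind (call Fn.cut (x.fst ,, cs.fst.tree)) fun r =>
  ifPair r.fst (call Fn.cell r.fst ,, nil) nil ,,
    ifPair r.snd (call Fn.cell r.snd ,, cs.snd) cs.snd

/-- `(q, cs)`: finds the child in which the search path goes on and cuts it. -/
def cutKidsBody : Expr := lam fun x =>
  bind x.fst fun q => bind x.snd fun cs =>
  ifPair cs.snd
    (ifPair (call Fn.test (q ,, cs.fst))
      (bind (call Fn.cutKids (q ,, cs.snd)) fun r => (cs.fst ,, r.fst) ,, r.snd)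
      (call Fn.cutAt x))
    (call Fn.cutAt x)

/-- The sum of `n` copies of the argument. -/
def mulBody : ℕ → Expr
  | 0 => .lit 0
  | n + 1 => .add (mulBody n) (.var 0)

/-- `t`: the number `b ^ h` for a tree of height `h`. -/
def powBody : Expr := lam fun t =>
  ifLt t.tag (lit 1) (lit 1) (call Fn.mulB (call Fn.pow t.content.fst.tree))

/-- `(k, p, p', t)`: puts nodes with a single child above the tree `t` of height `log_b p`, up to
the height `log_b p'`. -/
def wrapBody : Expr := lam fun x =>
  bind x.fst fun k => bind x.snd.fst fun p => bind x.snd.snd.fst fun p' =>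
  bind x.snd.snd.snd fun t =>
  ifLt p p'
    (bind (call Fn.mulB p) fun p => bind (call Fn.cell t ,, nil) fun cs =>
      call Fn.wrap (k ,, p ,, p' ,,
        call Fn.rawNode (call Fn.flag (k ,, p) ,, cs)))
    t

/-- `(k, p, d, u, w)`: a new root over two adjacent trees of height `log_b p`, repaired. -/
def rootBody : Expr := lam fun x =>
  bind x.fst fun k => bind x.snd.snd.fst fun d => bind x.snd.snd.snd fun F =>
  bind (call Fn.orient (d ,, call Fn.cell F.fst ,, call Fn.cell F.snd ,, nil)) fun cs =>
  call Fn.finish (k ,, d ,, call Fn.rawNode (call Fn.flag (k ,, call Fn.mulB x.snd.fst) ,, cs))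

/-- `(k, p, d, u, w)`: the concatenation of two trees of the same height `log_b p`. -/
def joinBody : Expr := lam fun x =>
  bind x.fst fun k => bind x.snd.fst fun p => bind x.snd.snd.fst fun d =>
  bind x.snd.snd.snd fun uw =>
  ifLt uw.fst.tag (lit 1) (call Fn.root x) <|
  bind (call Fn.fuse (k ,, d ,, uw)) fun F =>
  ifPair F.snd (call Fn.root (k ,, p ,, d ,, F)) (call Fn.finish (k ,, d ,, F.fst))

/-- `(k, t₁, t₂)`: the concatenation of two trees. -/
def concatBody : Expr := lam fun x =>
  bind x.fst fun k => bind x.snd.fst fun t₁ => bind x.snd.snd fun t₂ =>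
  ifPair t₁
    (ifPair t₂
      (bind (call Fn.pow t₁) fun p₁ => bind (call Fn.pow t₂) fun p₂ =>
        ifLt p₁ p₂
          (call Fn.join (k ,, p₂ ,, nil ,, call Fn.wrap (k ,, p₁ ,, p₂ ,, t₁) ,, t₂))
          (call Fn.join (k ,, p₁ ,, yes ,, call Fn.wrap (k ,, p₂ ,, p₁ ,, t₂) ,, t₁)))
      t₁)
    t₂

/-- `(q, k, t)`: the trees of the points of `t` that satisfy the query `q` and of those that do not.
-/
def splitBody : Expr := lam fun x =>
  bind x.fst fun q => bind x.snd.fst fun k => bind x.snd.snd fun t =>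
  ifPair t
    (bind (call Fn.cut (q ,, t)) fun r =>
      call Fn.finish (k ,, yes ,, r.fst) ,, call Fn.finish (k ,, nil ,, r.snd))
    (nil ,, nil)

/-- `(k, p)`: a leaf with the point `p`. -/
def leafBody : Expr := lam fun x =>
  ifLt (lit 1) x.fst (lit 0 ,, nil ,, x.snd) (lit 0 ,, (lit 0 ,, x.snd ,, nil) ,, x.snd)

def searchXBody : Expr := lam fun x =>
  ifPair x.snd.fst (call Fn.search ((lit 2 ,, x.snd.snd.fst) ,, x.snd.fst)) nil

def searchYBody : Expr := lam fun x =>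
  ifPair x.snd.fst (call Fn.search ((lit 1 ,, x.snd.snd.snd.fst) ,, x.snd.fst)) nil

def splitXBody : Expr := lam fun x =>
  call Fn.split ((lit 0 ,, x.snd.snd) ,, x.fst ,, x.snd.fst)

def splitYBody : Expr := lam fun x =>
  bind (call Fn.split ((lit 1 ,, x.snd.snd) ,, x.fst ,, x.snd.fst)) fun r => r.snd ,, r.fst

def insertBody : Expr := lam fun x =>
  bind x.fst fun k => bind x.snd.snd fun p =>
  bind (call Fn.split ((lit 0 ,, p.fst) ,, k ,, x.snd.fst)) fun r =>
  call Fn.concat (k ,, call Fn.concat (k ,, r.fst ,, call Fn.leaf (k ,, p)) ,, r.snd)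

def deleteBody : Expr := lam fun x =>
  bind (call Fn.split ((lit 3 ,, x.snd.snd.fst) ,, x.fst ,, x.snd.fst)) fun r =>
  call Fn.concat (x.fst ,, r.fst ,, r.snd)

/-- `(k, l)`: the list of leaves with the points of `l`. -/
def leavesBody : Expr := lam fun x =>
  ifPair x.snd
    (call Fn.cell (call Fn.leaf (x.fst ,, x.snd.fst)) ,, call Fn.leaves (x.fst ,, x.snd.snd)) nil

/-- `(k, flag, n, cs)`: divides `n` trees of the same height among nodes. -/
def groupBody (b : ℕ) : Expr := lam fun x =>
  bind x.fst fun k => bind x.snd.fst fun g => bind x.snd.snd.fst fun n =>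
  bind x.snd.snd.snd fun cs =>
  ifLt (lit b) n
    (bind (call Fn.chunk n) fun f =>
      call Fn.cell (call Fn.mk (k ,, g ,, call Fn.take (f ,, cs))) ,,
        call Fn.group (k ,, g ,, sub n f ,, call Fn.drop (f ,, cs)))
    (call Fn.cell (call Fn.mk (k ,, g ,, cs)) ,, nil)

/-- `(k, p, cs)`: the tree over a list of trees of height `log_b p`. -/
def buildUpBody : Expr := lam fun x =>
  bind x.fst fun k => bind x.snd.snd fun cs =>
  ifPair cs.snd
    (bind (call Fn.mulB x.snd.fst) fun p =>
      call Fn.buildUp (k ,, p ,,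
        call Fn.group (k ,, call Fn.flag (k ,, p) ,, call Fn.len cs ,, cs)))
    cs.fst.tree

def buildBody : Expr := lam fun x =>
  ifPair x.snd (call Fn.buildUp (x.fst ,, lit 1 ,, call Fn.leaves x)) nil

/-- The program for augmented `(a,b)`-trees. -/
def prog (a b : ℕ) : Program :=
  [shiftPtsBody, mergeBody, topBody, topKidsBody, bumpBody, bumpKidsBody, opnBody, lastKeyBody,
   cellBody, mkBody, appBody, revAppBody, orientBody, lenBody, takeBody, dropBody, fuseBody b,
   fixBody, finishBody, testBody, searchBody, searchKidsBody, cutBody, cutKidsBody, mulBody b,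
   powBody, wrapBody, joinBody, concatBody, splitBody, leafBody, searchXBody, searchYBody,
   splitXBody, splitYBody, insertBody, deleteBody, leavesBody, groupBody b, buildUpBody,
   buildBody, fixKidsBody a, rawNodeBody, chunkBody a b, flagBody, cutAtBody,
   spineNodeBody, rootBody]

/-- Calls of the functions of the program `prog a b`. -/
abbrev Call (a b : ℕ) : ℕ → Val → Val → ℕ → Prop := Calls (prog a b)

end AugAB

namespace AugAB

variable {a b : ℕ}

attribute [simp] encPts Pt.enc Tree.enc

@[simp] theorem encAug_none : encAug none = .nil := rfl
@[simp] theorem encAug_some (g : Aug) :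
    encAug (some g) = .pair (.num g.add) (encPts g.top) := rfl

@[simp] theorem natCast_not_neg (n : ℕ) : ¬ (n : ℝ) < 0 := (Nat.cast_nonneg n).not_gt

/-! ### Lists of points -/

theorem calls_shiftPts (d : ℝ) : ∀ l : List Pt, Call a b Fn.shiftPts (.pair (.num d) (encPts l))
    (encPts (l.map (Pt.shift d))) (l.length + 1)
  | [] => .of_pre rfl (by simp [Within])
  | p :: l => .of_pre rfl (by
      simp
      refine .intro (calls_shiftPts d l) ?_
      simp [Pt.shift, Within]; omega)

/-- Merging two lists of points by decreasing score; at most `n` points are kept. -/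
noncomputable def mergeTop : ℕ → List Pt → List Pt → List Pt
  | 0, _, _ => []
  | _ + 1, [], [] => []
  | n + 1, [], q :: m => q :: mergeTop n [] m
  | n + 1, p :: l, [] => p :: mergeTop n l []
  | n + 1, p :: l, q :: m => open Classical in
    if p.s < q.s then q :: mergeTop n (p :: l) m else p :: mergeTop n l (q :: m)

theorem calls_merge : ∀ (n : ℕ) (l m : List Pt),
    Call a b Fn.merge (.pair (.num n) (.pair (encPts l) (encPts m))) (encPts (mergeTop n l m))
      ((mergeTop n l m).length + 1)
  | 0, l, m => .of_pre rfl (by simp [mergeTop, Within])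
  | n + 1, [], [] => .of_pre rfl (by simp [mergeTop, Within])
  | n + 1, [], q :: m => .of_pre rfl (by
      simp [mergeTop]
      refine .intro (calls_merge n [] m) ?_
      simp [Within]; omega)
  | n + 1, p :: l, [] => .of_pre rfl (by
      simp [mergeTop]
      refine .intro (calls_merge n l []) ?_
      simp [Within]; omega)
  | n + 1, p :: l, q :: m => .of_pre rfl (by
      simp [mergeTop, -not_lt]
      refine .intro (fun h => ?_) (fun h => ?_)
      · refine .intro (calls_merge n (p :: l) m) ?_
        simp [Within, h]; omega
      · refine .intro (calls_merge n l (q :: m)) ?_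
        simp [Within, if_neg h]; omega)

/-! ### Trees with children given as lists -/

/-- The rightmost point of a tree; the representative keys are its coordinates. -/
noncomputable def Tree.key (t : Tree) : Pt := t.points.getLast?.getD ⟨0, 0, 0⟩

/-- The children `ts` with their representative keys. -/
noncomputable def kidsOf : List Tree → Kids
  | [] => .nil
  | t :: ts => .cons t.key.x t.key.y t (kidsOf ts)

/-- The node with augmentation `g` and children `ts`. -/
noncomputable def nd (g : Option Aug) (ts : List Tree) : Tree := .node g (kidsOf ts)

/-- The points of the trees of a list, from left to right. -/
noncomputable def ptsOf (ts : List Tree) : List Pt := ts.flatMap Tree.points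

/-- A tree in memory, preceded by its representative keys. -/
noncomputable def encCell (t : Tree) : Val := .pair (.num t.key.x) (.pair (.num t.key.y) t.enc)

/-- A list of trees in memory, each of them with its keys; this is how children are stored. -/
noncomputable def encTs : List Tree → Val
  | [] => .nil
  | t :: ts => .pair (encCell t) (encTs ts)

attribute [simp] encTs encCell

@[simp] theorem ptsOf_nil : ptsOf [] = [] := rfl
@[simp] theorem ptsOf_cons (t : Tree) (ts : List Tree) :
    ptsOf (t :: ts) = t.points ++ ptsOf ts := by simp [ptsOf]
@[simp] theorem ptsOf_append (ts us : List Tree) : ptsOf (ts ++ us) = ptsOf ts ++ ptsOf us := by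
  simp [ptsOf]

theorem kidsOf_enc : ∀ ts : List Tree, (kidsOf ts).enc = encTs ts
  | [] => rfl
  | t :: ts => by simp [kidsOf, Kids.enc, kidsOf_enc ts]

theorem kidsOf_points : ∀ ts : List Tree, (kidsOf ts).points = ptsOf ts
  | [] => rfl
  | t :: ts => by simp [kidsOf, Kids.points, kidsOf_points ts]

theorem kidsOf_length : ∀ ts : List Tree, (kidsOf ts).length = ts.length
  | [] => rfl
  | t :: ts => by simp [kidsOf, Kids.length, kidsOf_length ts]

theorem nd_enc (g : Option Aug) (ts : List Tree) :
    (nd g ts).enc = .pair (.num 1) (.pair (encAug g) (encTs ts)) := by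
  simp [nd, kidsOf_enc]

@[simp] theorem nd_points (g : Option Aug) (ts : List Tree) :
    (nd g ts).points = (ptsOf ts).map (Pt.shift (addOf g)) := by
  simp [nd, Tree.points, kidsOf_points]

@[simp] theorem leaf_points (g : Option Aug) (p : Pt) :
    (Tree.leaf g p).points = [p.shift (addOf g)] := by simp [Tree.points]

@[simp] theorem Pt.shift_zero (p : Pt) : p.shift 0 = p := by simp [Pt.shift]
@[simp] theorem Pt.shift_zero' : Pt.shift 0 = id := by funext p; simp
@[simp] theorem Pt.shift_shift (p : Pt) (d e : ℝ) : (p.shift d).shift e = p.shift (d + e) := by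
  simp [Pt.shift, add_assoc]
@[simp] theorem Pt.shift_x (p : Pt) (d : ℝ) : (p.shift d).x = p.x := rfl
@[simp] theorem Pt.shift_y (p : Pt) (d : ℝ) : (p.shift d).y = p.y := rfl

/-- `g` is present if and only if a node of height `h` has an augmentation. -/
def Flag (b k h : ℕ) (g : Option Aug) : Prop := g.isSome = true ↔ k ≤ b ^ h

theorem augOK_iff {b k h : ℕ} {l : List Pt} {g : Option Aug} :
    AugOK b k h l g ↔ Flag b k h g ∧ ∀ x, g = some x → IsTop k l x.top := by
  unfold AugOK Flag
  cases g <;> simp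

/-- `Tree.WF` for trees of height `h`, as a recursion on the height. -/
def W (a b k : ℕ) : ℕ → ℕ → Tree → Prop
  | _, 0, t => ∃ g p, t = .leaf g p ∧ AugOK b k 0 [p] g
  | lo, h + 1, t => ∃ g ts, t = nd g ts ∧ lo ≤ ts.length ∧ ts.length ≤ b ∧
      AugOK b k (h + 1) (ptsOf ts) g ∧ ∀ s ∈ ts, W a b k a h s

/-- A tree of height `h` whose nodes have between one and `b` children, and augmentations exactly
where they should be, with arbitrary contents. -/
def Shape (b k : ℕ) : ℕ → Tree → Prop
  | 0, t => ∃ g p, t = .leaf g p ∧ Flag b k 0 g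
  | h + 1, t => ∃ g ts, t = nd g ts ∧ 1 ≤ ts.length ∧ ts.length ≤ b ∧
      Flag b k (h + 1) g ∧ ∀ s ∈ ts, Shape b k h s

/-- Lists are reversed for the direction `true`, so that the rightmost element comes first. -/
def orient {α : Type*} (d : Bool) (l : List α) : List α := if d then l.reverse else l

/-- A tree of height `h` that is correct except along its right (`d = true`) or left spine: the
nodes of the spine have between one and `b` children, and their lists `top` are arbitrary. -/
def Spine (a b k : ℕ) (d : Bool) : ℕ → Tree → Prop
  | 0, t => W a b k 1 0 t
  | h + 1, t => ∃ g u ts, t = nd g (orient d (u :: ts)) ∧ ts.length + 1 ≤ b ∧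
      Flag b k (h + 1) g ∧ Spine a b k d h u ∧ ∀ s ∈ ts, W a b k a h s

section orient
variable {α β : Type*} (d : Bool)
@[simp] theorem orient_orient (l : List α) : orient d (orient d l) = l := by
  cases d <;> simp [orient]
@[simp] theorem length_orient (l : List α) : (orient d l).length = l.length := by
  cases d <;> simp [orient]
@[simp] theorem mem_orient {x : α} {l : List α} : x ∈ orient d l ↔ x ∈ l := by
  cases d <;> simp [orient]
@[simp] theorem map_orient (f : α → β) (l : List α) : (orient d l).map f = orient d (l.map f) := by
  cases d <;> simp [orient]
end orient

theorem W.mono {a b k lo lo' h : ℕ} {t : Tree} (hl : lo' ≤ lo) (ht : W a b k lo h t) :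
    W a b k lo' h t := by
  cases h with
  | zero => exact ht
  | succ h =>
    obtain ⟨g, ts, rfl, h₁, h₂⟩ := ht
    exact ⟨g, ts, rfl, hl.trans h₁, h₂⟩

theorem W.shape {a b k : ℕ} (ha : 1 ≤ a) : ∀ {h lo : ℕ} {t : Tree}, 1 ≤ lo → W a b k lo h t →
    Shape b k h t
  | 0, _, _, _, ⟨g, p, e, h⟩ => ⟨g, p, e, (augOK_iff.1 h).1⟩
  | _ + 1, _, _, hl, ⟨g, ts, e, h₁, h₂, h₃, h₄⟩ =>
    ⟨g, ts, e, hl.trans h₁, h₂, (augOK_iff.1 h₃).1, fun s hs => W.shape ha ha (h₄ s hs)⟩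

theorem Spine.shape {a b k : ℕ} {d : Bool} (ha : 1 ≤ a) : ∀ {h : ℕ} {t : Tree},
    Spine a b k d h t → Shape b k h t
  | 0, _, h => W.shape ha le_rfl h
  | _ + 1, _, ⟨g, u, ts, e, h₁, h₂, h₃, h₄⟩ => by
    refine ⟨g, _, e, by simp, by simpa using h₁, h₂, fun s hs => ?_⟩
    rcases List.mem_cons.1 ((mem_orient d).1 hs) with rfl | hs
    · exact Spine.shape ha h₃
    · exact W.shape ha ha (h₄ s hs)

theorem W.spine {a b k : ℕ} {d : Bool} (ha : 1 ≤ a) : ∀ {h lo : ℕ} {t : Tree}, 1 ≤ lo →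
    W a b k lo h t → Spine a b k d h t
  | 0, _, _, _, h => h
  | h + 1, lo, _, hl, ⟨g, ts, e, h₁, h₂, h₃, h₄⟩ => by
    obtain ⟨u, us, hu⟩ : ∃ u us, orient d ts = u :: us :=
      List.exists_cons_of_length_pos (by simp; omega)
    have hm : ∀ s, s ∈ ts ↔ s ∈ u :: us := fun s => by rw [← hu, mem_orient]
    have hlen : ts.length = us.length + 1 := by simpa using congrArg List.length hu
    refine ⟨g, u, us, by rw [← hu, orient_orient, e], by omega, (augOK_iff.1 h₃).1,
      W.spine ha ha (h₄ u ((hm u).2 (by simp))), fun s hs => h₄ s ((hm s).2 (by simp [hs]))⟩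

theorem Shape.points_ne_nil {b k : ℕ} : ∀ {h : ℕ} {t : Tree}, Shape b k h t → t.points ≠ []
  | 0, _, ⟨g, p, e, _⟩ => by simp [e]
  | h + 1, _, ⟨g, ts, e, h₁, _, _, h₄⟩ => by
    obtain ⟨u, us, rfl⟩ := List.exists_cons_of_length_pos h₁
    simp [e, Shape.points_ne_nil (h₄ u (by simp))]

theorem Shape.length_points_le {b k : ℕ} : ∀ {h : ℕ} {t : Tree}, Shape b k h t →
    t.points.length ≤ b ^ h
  | 0, _, ⟨g, p, e, _⟩ => by simp [e]
  | h + 1, _, ⟨g, ts, e, _, h₂, _, h₄⟩ => by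
    have : (ptsOf ts).length ≤ ts.length * b ^ h := by
      simpa [ptsOf, List.length_flatMap] using List.sum_le_card_nsmul
        (ts.map fun t => t.points.length) (b ^ h) (by
          simp only [List.mem_map]; rintro _ ⟨s, hs, rfl⟩
          exact Shape.length_points_le (h₄ s hs))
    simp only [e, nd_points, List.length_map]
    exact this.trans (by rw [pow_succ']; gcongr)

theorem W.pow_le_length {a b k : ℕ} (ha : 2 ≤ a) : ∀ {h lo : ℕ} {t : Tree}, 2 ≤ lo →
    W a b k lo h t → 2 ^ h ≤ t.points.length
  | 0, _, _, _, ⟨g, p, e, _⟩ => by simp [e]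
  | h + 1, lo, _, hl, ⟨g, ts, e, h₁, _, _, h₄⟩ => by
    have : ts.length * 2 ^ h ≤ (ptsOf ts).length := by
      simpa [ptsOf, List.length_flatMap] using List.card_nsmul_le_sum
        (ts.map fun t => t.points.length) (2 ^ h) (by
          simp only [List.mem_map]; rintro _ ⟨s, hs, rfl⟩
          exact W.pow_le_length ha ha (h₄ s hs))
    simp only [e, nd_points, List.length_map]
    refine le_trans ?_ this
    rw [pow_succ']; gcongr; omega

theorem W.height_lt {a b k h : ℕ} (ha : 2 ≤ a) {t : Tree} (ht : W a b k 2 h t) :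
    h + 1 ≤ lg t.points.length := by
  have h₁ := W.pow_le_length ha le_rfl ht
  unfold lg
  have := Nat.le_log_of_pow_le (by norm_num) h₁
  omega

/-! ### Lists of children -/

theorem calls_app : ∀ ts us : List Tree, Call a b Fn.app (.pair (encTs ts) (encTs us))
    (encTs (ts ++ us)) (ts.length + 1)
  | [], us => .of_pre rfl (by simp [Within])
  | t :: ts, us => .of_pre rfl (by
      simp
      refine .intro (calls_app ts us) ?_
      simp [Within]; omega)

theorem calls_revApp : ∀ ts us : List Tree, Call a b Fn.revApp (.pair (encTs ts) (encTs us))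
    (encTs (ts.reverse ++ us)) (ts.length + 1)
  | [], us => .of_pre rfl (by simp [Within])
  | t :: ts, us => .of_pre rfl (by
      simp
      refine .intro (calls_revApp ts (t :: us)) ?_
      simp [Within]; omega)

/-- Directions in memory. -/
def encDir : Bool → Val
  | true => .pair (.num 0) .nil
  | false => .nil

@[simp] theorem encDir_true : encDir true = .pair (.num 0) .nil := rfl
@[simp] theorem encDir_false : encDir false = .nil := rfl

theorem calls_orient (d : Bool) (ts : List Tree) : Call a b Fn.orient (.pair (encDir d) (encTs ts))
    (encTs (orient d ts)) (ts.length + 2) :=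
  .of_pre rfl (by
    cases d
    · simp [Within, orient]
    · simp [orient]
      refine .intro (calls_revApp ts []) ?_
      simp [Within]; omega)

theorem calls_len : ∀ ts : List Tree, Call a b Fn.len (encTs ts) (.num ts.length) (ts.length + 1)
  | [] => .of_pre rfl (by simp [Within])
  | t :: ts => .of_pre rfl (by
      simp
      refine .intro (calls_len ts) ?_
      simp [Within]; omega)

theorem calls_take : ∀ (n : ℕ) (ts : List Tree), n ≤ ts.length →
    Call a b Fn.take (.pair (.num n) (encTs ts)) (encTs (ts.take n)) (n + 1)
  | 0, ts, _ => .of_pre rfl (by simp [Within])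
  | n + 1, t :: ts, h => .of_pre rfl (by
      simp
      refine .intro (calls_take n ts (by simpa using h)) ?_
      simp [Within]; omega)

theorem calls_drop : ∀ (n : ℕ) (ts : List Tree), n ≤ ts.length →
    Call a b Fn.drop (.pair (.num n) (encTs ts)) (encTs (ts.drop n)) (n + 1)
  | 0, ts, _ => .of_pre rfl (by simp [Within])
  | n + 1, t :: ts, h => .of_pre rfl (by
      simp
      refine .intro (calls_drop n ts (by simpa using h)) ?_
      simp [Within]; omega)

theorem calls_lastKey : ∀ (ts : List Tree) (t : Tree), Call a b Fn.lastKey (encTs (t :: ts))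
    (.pair (.num ((t :: ts).getLast (by simp)).key.x) (.num ((t :: ts).getLast (by simp)).key.y))
    (ts.length + 1)
  | [], t => .of_pre rfl (by simp [Within])
  | u :: ts, t => .of_pre rfl (by
      simp
      refine .intro (calls_lastKey ts u) ?_
      simp [Within]; omega)

theorem nd_key (g : Option Aug) (ts : List Tree) (hn : ts ≠ []) (h : ∀ t ∈ ts, t.points ≠ []) :
    (nd g ts).key.x = (ts.getLast hn).key.x ∧ (nd g ts).key.y = (ts.getLast hn).key.y := by
  have hp := h _ (List.getLast_mem hn)
  have : (ptsOf ts).getLast? = (ts.getLast hn).points.getLast? := by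
    conv_lhs => rw [← List.dropLast_append_getLast hn]
    rw [ptsOf_append, List.getLast?_append]
    simp [List.getLast?_eq_getLast_of_ne_nil hp]
  simp [Tree.key, List.getLast?_map, this, List.getLast?_eq_getLast_of_ne_nil hp]

theorem calls_cell {k h : ℕ} {t : Tree} (ht : Shape b k h t) :
    Call a b Fn.cell t.enc (encCell t) (b + 1) :=
  .of_pre rfl (by
    cases h with
    | zero =>
      obtain ⟨g, p, rfl, -⟩ := ht
      simp [Within, Tree.key]
    | succ h =>
      obtain ⟨g, ts, rfl, h₁, h₂, -, h₄⟩ := ht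
      obtain ⟨u, us, rfl⟩ := List.exists_cons_of_length_pos h₁
      have := nd_key g (u :: us) (by simp) fun t ht => (h₄ t ht).points_ne_nil
      simp [nd_enc]
      refine .intro (calls_lastKey us u) ?_
      simp only [List.length_cons] at h₂
      simp [Within, this]; omega)

theorem calls_mulB (r : ℝ) : Call a b Fn.mulB (.num r) (.num (b * r)) 1 := by
  refine .of_wp (body := mulBody b) rfl ?_
  suffices ∀ (n c : ℕ) (Q : Val → ℕ → Prop), Q (.num (n * r)) c →
      wp (Call a b) (mulBody n) [.num r] c Q from this b 1 _ ⟨rfl, le_rfl⟩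
  intro n
  induction n with
  | zero => intro c Q h; simpa [mulBody, wp] using h
  | succ n ih =>
    intro c Q h
    refine ih _ _ ?_
    simpa [wp, add_mul] using h

/-! ### Points of highest score -/

/-- A list of points by decreasing score. -/
def ByScore (l : List Pt) : Prop := l.Pairwise fun p q => q.s ≤ p.s

/-- The lists of `k` points of highest score are the prefixes of the sorted arrangements. In this
form the lists `top` of several children can be merged, although points with equal scores make them
non-unique. -/
theorem isTop_iff {k : ℕ} {l t : List Pt} :
    IsTop k l t ↔ ∃ s : List Pt, s.Perm l ∧ ByScore s ∧ t = s.take k := by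
  classical
  constructor
  · rintro ⟨hlen, hs, r, hp, hr⟩
    refine ⟨t ++ r.insertionSort fun p q => q.s ≤ p.s,
      ((List.perm_insertionSort _ r).append_left t).trans hp, ?_, ?_⟩
    · refine List.pairwise_append.2 ⟨hs, ?_, fun p hp q hq => hr p hp q ?_⟩
      · have : Std.Total fun p q : Pt => q.s ≤ p.s := ⟨fun p q => le_total _ _⟩
        have : IsTrans Pt fun p q : Pt => q.s ≤ p.s := ⟨fun p q r h h' => le_trans h' h⟩
        exact List.pairwise_insertionSort _ r
      · exact (List.perm_insertionSort _ r).mem_iff.1 hq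
    · have := hp.length_eq
      rw [List.length_append] at this
      rcases le_or_gt k l.length with h | h
      · rw [List.take_left' (by omega)]
      · have : r = [] := List.length_eq_zero_iff.1 (by omega)
        subst this
        rw [List.take_of_length_le] <;> simp; omega
  · rintro ⟨s, hp, hs, rfl⟩
    refine ⟨by simp [hp.length_eq], hs.sublist (List.take_sublist _ _), s.drop k, by simpa, ?_⟩
    have := hs
    rw [ByScore, ← List.take_append_drop k s, List.pairwise_append] at this
    exact this.2.2

theorem mergeTop_length_le : ∀ (n : ℕ) (l m : List Pt),
    (mergeTop n l m).length ≤ min n (l.length + m.length)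
  | 0, l, m => by simp [mergeTop]
  | n + 1, [], [] => by simp [mergeTop]
  | n + 1, [], q :: m => by
    have := mergeTop_length_le n [] m
    simp [mergeTop] at *; omega
  | n + 1, p :: l, [] => by
    have := mergeTop_length_le n l []
    simp [mergeTop] at *; omega
  | n + 1, p :: l, q :: m => by
    have h₁ := mergeTop_length_le n l (q :: m)
    have h₂ := mergeTop_length_le n (p :: l) m
    simp only [mergeTop]
    split_ifs <;> simp at * <;> omega

theorem mergeTop_perm : ∀ (n : ℕ) (l m : List Pt), l.length + m.length ≤ n →
    (mergeTop n l m).Perm (l ++ m)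
  | 0, l, m, h => by
    obtain ⟨rfl, rfl⟩ : l = [] ∧ m = [] := by
      constructor <;> apply List.length_eq_zero_iff.1 <;> omega
    simp [mergeTop]
  | n + 1, [], [], h => by simp [mergeTop]
  | n + 1, [], q :: m, h => by
    simpa [mergeTop] using mergeTop_perm n [] m (by simp at *; omega)
  | n + 1, p :: l, [], h => by
    simpa [mergeTop] using mergeTop_perm n l [] (by simp at *; omega)
  | n + 1, p :: l, q :: m, h => by
    simp only [mergeTop]
    split_ifs
    · exact ((mergeTop_perm n (p :: l) m (by simp at *; omega)).cons q).trans
        List.perm_middle.symm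
    · simpa using (mergeTop_perm n l (q :: m) (by simp at *; omega))

theorem mergeTop_byScore : ∀ (n : ℕ) (l m : List Pt), l.length + m.length ≤ n →
    ByScore l → ByScore m → ByScore (mergeTop n l m)
  | 0, l, m, _, _, _ => by simp [mergeTop, ByScore]
  | n + 1, [], [], _, _, _ => by simp [mergeTop, ByScore]
  | n + 1, [], q :: m, h, hl, hm => by
    have hn : ([] : List Pt).length + m.length ≤ n := by simp at *; omega
    have hm' := List.pairwise_cons.1 hm
    refine List.pairwise_cons.2 ⟨fun x hx => ?_, mergeTop_byScore n [] m hn hl hm'.2⟩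
    exact hm'.1 x (by simpa using (mergeTop_perm n [] m hn).mem_iff.1 hx)
  | n + 1, p :: l, [], h, hl, hm => by
    have hn : l.length + ([] : List Pt).length ≤ n := by simp at *; omega
    have hl' := List.pairwise_cons.1 hl
    refine List.pairwise_cons.2 ⟨fun x hx => ?_, mergeTop_byScore n l [] hn hl'.2 hm⟩
    exact hl'.1 x (by simpa using (mergeTop_perm n l [] hn).mem_iff.1 hx)
  | n + 1, p :: l, q :: m, h, hl, hm => by
    have hl' := List.pairwise_cons.1 hl
    have hm' := List.pairwise_cons.1 hm
    simp only [mergeTop]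
    split_ifs with hpq
    · have hn : (p :: l).length + m.length ≤ n := by simp at *; omega
      refine List.pairwise_cons.2 ⟨fun x hx => ?_, mergeTop_byScore n (p :: l) m hn hl hm'.2⟩
      have := (mergeTop_perm n (p :: l) m hn).mem_iff.1 hx
      simp only [List.cons_append, List.mem_cons, List.mem_append] at this
      rcases this with rfl | hx | hx
      · exact hpq.le
      · exact (hl'.1 x hx).trans hpq.le
      · exact hm'.1 x hx
    · have hn : l.length + (q :: m).length ≤ n := by simp at *; omega
      refine List.pairwise_cons.2 ⟨fun x hx => ?_, mergeTop_byScore n l (q :: m) hn hl'.2 hm⟩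
      have := (mergeTop_perm n l (q :: m) hn).mem_iff.1 hx
      simp only [List.mem_cons, List.mem_append] at this
      rcases this with hx | rfl | hx
      · exact hl'.1 x hx
      · exact not_lt.1 hpq
      · exact (hm'.1 x hx).trans (not_lt.1 hpq)

theorem take_mergeTop : ∀ (n N : ℕ) (l m : List Pt), n ≤ N →
    (mergeTop N l m).take n = mergeTop n l m
  | 0, N, l, m, _ => by simp [mergeTop]
  | n + 1, N + 1, [], [], h => by simp [mergeTop]
  | n + 1, N + 1, [], q :: m, h => by
    simp [mergeTop, take_mergeTop n N [] m (by omega)]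
  | n + 1, N + 1, p :: l, [], h => by
    simp [mergeTop, take_mergeTop n N l [] (by omega)]
  | n + 1, N + 1, p :: l, q :: m, h => by
    simp only [mergeTop]
    split_ifs
    · simp [take_mergeTop n N (p :: l) m (by omega)]
    · simp [take_mergeTop n N l (q :: m) (by omega)]

/-- The first `n` points of a merger depend only on the first `n` points of either list. -/
theorem mergeTop_take : ∀ (n i j : ℕ) (l m : List Pt), n ≤ i → n ≤ j →
    mergeTop n (l.take i) (m.take j) = mergeTop n l m
  | 0, i, j, l, m, _, _ => by simp [mergeTop]
  | n + 1, i + 1, j + 1, [], [], _, _ => by simp [mergeTop]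
  | n + 1, i + 1, j + 1, [], q :: m, hi, hj => by
    have := mergeTop_take n (i + 1) j [] m (by omega) (by omega)
    simp only [List.take_nil] at this
    simp [mergeTop, this]
  | n + 1, i + 1, j + 1, p :: l, [], hi, hj => by
    have := mergeTop_take n i (j + 1) l [] (by omega) (by omega)
    simp only [List.take_nil] at this
    simp [mergeTop, this]
  | n + 1, i + 1, j + 1, p :: l, q :: m, hi, hj => by
    have h₁ := mergeTop_take n (i + 1) j (p :: l) m (by omega) (by omega)
    have h₂ := mergeTop_take n i (j + 1) l (q :: m) (by omega) (by omega)
    simp only [List.take_succ_cons] at h₁ h₂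
    simp only [mergeTop, List.take_succ_cons, h₁, h₂]

theorem isTop_merge {k : ℕ} {l m t u : List Pt} (ht : IsTop k l t) (hu : IsTop k m u) :
    IsTop k (l ++ m) (mergeTop k t u) := by
  obtain ⟨s, hp, hs, rfl⟩ := isTop_iff.1 ht
  obtain ⟨s', hp', hs', rfl⟩ := isTop_iff.1 hu
  rw [mergeTop_take _ _ _ _ _ le_rfl le_rfl,
    ← take_mergeTop k (k + (s.length + s'.length)) _ _ (by omega)]
  exact isTop_iff.2 ⟨_, (mergeTop_perm _ _ _ (by omega)).trans (hp.append hp'),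
    mergeTop_byScore _ _ _ (by omega) hs hs', rfl⟩

theorem isTop_shift {k : ℕ} {l t : List Pt} (d : ℝ) (ht : IsTop k l t) :
    IsTop k (l.map (Pt.shift d)) (t.map (Pt.shift d)) := by
  obtain ⟨s, hp, hs, rfl⟩ := isTop_iff.1 ht
  refine isTop_iff.2 ⟨_, hp.map _, ?_, List.map_take ..⟩
  exact List.pairwise_map.2 (hs.imp fun h => by simpa [Pt.shift] using h)

theorem isTop_nil {k : ℕ} : IsTop k [] [] := isTop_iff.2 ⟨[], by simp [ByScore]⟩

theorem isTop_singleton {k : ℕ} (hk : 1 ≤ k) (p : Pt) : IsTop k [p] [p] :=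
  isTop_iff.2 ⟨[p], by simp, by simp [ByScore], by
    rw [List.take_of_length_le]; simpa⟩

/-! ### Computing the lists `top` -/

theorem calls_topKids {k : ℕ} (c : Tree → ℕ) : ∀ ts : List Tree,
    (∀ t ∈ ts, ∃ l, Call a b Fn.top (.pair (.num k) t.enc) (encPts l) (c t) ∧
      IsTop k t.points l) →
    ∃ l, Call a b Fn.topKids (.pair (.num k) (encTs ts)) (encPts l)
      ((ts.map c).sum + ts.length * (min k (ptsOf ts).length + 2) + 1) ∧ IsTop k (ptsOf ts) l
  | [], _ => ⟨[], .of_pre rfl (by simp [Within]), isTop_nil⟩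
  | t :: ts, H => by
    obtain ⟨l, hl, tl⟩ := H t (by simp)
    obtain ⟨m, hm, tm⟩ := calls_topKids c ts fun t ht => H t (by simp [ht])
    refine ⟨mergeTop k l m, .of_pre rfl ?_, by simpa using isTop_merge tl tm⟩
    simp
    refine .intro hl ?_
    refine .intro hm ?_
    refine .intro (calls_merge k l m) ?_
    refine ⟨rfl, ?_⟩
    have h₁ := mergeTop_length_le k l m
    have h₂ := tl.1
    have h₃ := tm.1
    have h₄ : ts.length * (min k (ptsOf ts).length + 2) ≤
        ts.length * (min k (t.points.length + (ptsOf ts).length) + 2) := by gcongr; omega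
    simp only [add_mul, one_mul]
    omega

/-- Bound for the number of calls in which the node of height `h + 1` over children with `n`
points gets its augmentation. Children that have lists `top` are merged in time `O(k)`; only for
the nodes of the lowest height with an augmentation all the points below have to be sorted. -/
def mkCost (b k h n : ℕ) : ℕ :=
  if k ≤ b ^ (h + 1) then if k ≤ b ^ h then 8 * (b * k) else 5 * b * (h + 2) * n else 1

theorem sum_map_mul_length (c : ℕ) : ∀ ts : List Tree,
    (ts.map fun t => c * t.points.length).sum = c * (ptsOf ts).length
  | [] => by simp
  | t :: ts => by simp [sum_map_mul_length c ts, mul_add]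

/-- Below the heights with augmentations the list is obtained by merge sort along the tree, hence
the factor `h + 1`. -/
theorem calls_top {k : ℕ} (hk : 1 ≤ k) (ha : 1 ≤ a) (hb : 2 ≤ b) : ∀ {h lo : ℕ} {t : Tree}, 1 ≤ lo →
    W a b k lo h t → ∃ l, Call a b Fn.top (.pair (.num k) t.enc) (encPts l)
      (if k ≤ b ^ h then k + 2 else 5 * b * (h + 1) * t.points.length) ∧ IsTop k t.points l := by
  have aug : ∀ (v : Val) (m : List Pt) (x : Aug) (tag : ℝ), IsTop k m x.top →
      Call a b Fn.top (.pair (.num k) (.pair (.num tag) (.pair (encAug (some x)) v)))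
        (encPts (x.top.map (Pt.shift x.add))) (k + 2) ∧
      IsTop k (m.map (Pt.shift x.add)) (x.top.map (Pt.shift x.add)) := fun v m x tag hx => by
    refine ⟨.of_pre rfl ?_, isTop_shift _ hx⟩
    simp
    refine .intro (calls_shiftPts x.add x.top) ⟨rfl, ?_⟩
    have := hx.1
    omega
  intro h
  induction h with
  | zero =>
    rintro lo t - ⟨g, p, rfl, hg⟩
    obtain ⟨hf, hg⟩ := augOK_iff.1 hg
    cases g with
    | some x =>
      have : k ≤ b ^ 0 := hf.1 rfl
      refine ⟨_, by simpa only [Tree.enc, if_pos this] using (aug p.enc [p] x 0 (hg x rfl)).1, ?_⟩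
      simpa [addOf] using (aug p.enc [p] x 0 (hg x rfl)).2
    | none =>
      have : ¬ k ≤ b ^ 0 := fun h => by simpa using hf.2 h
      refine ⟨[p], .of_pre rfl ?_, by simpa [addOf] using isTop_singleton hk p⟩
      rw [if_neg this]
      simp [Within]; omega
  | succ h ih =>
    rintro lo t hlo ⟨g, ts, rfl, h₁, h₂, hg, h₄⟩
    obtain ⟨hf, hg⟩ := augOK_iff.1 hg
    cases g with
    | some x =>
      have : k ≤ b ^ (h + 1) := hf.1 rfl
      refine ⟨_, by simpa only [nd_enc, if_pos this] using (aug _ _ x 1 (hg x rfl)).1, ?_⟩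
      simpa [addOf] using (aug (encTs ts) (ptsOf ts) x 1 (hg x rfl)).2
    | none =>
      have hk' : ¬ k ≤ b ^ (h + 1) := fun h => by simpa using hf.2 h
      have hk'' : ¬ k ≤ b ^ h := fun h' =>
        hk' (h'.trans (Nat.pow_le_pow_right (by omega) (by omega)))
      obtain ⟨l, hl, tl⟩ := calls_topKids (a := a) (b := b) (k := k)
        (fun t => 5 * b * (h + 1) * t.points.length) ts
        fun t ht => by simpa only [if_neg hk''] using ih ha (h₄ t ht)
      refine ⟨l, .of_pre rfl ?_, by simpa [addOf] using tl⟩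
      simp [nd_enc]
      refine .intro hl ⟨rfl, ?_⟩
      rw [sum_map_mul_length, if_neg hk']
      have hn : 1 ≤ (ptsOf ts).length := by
        obtain ⟨u, us, rfl⟩ := List.exists_cons_of_length_pos (hlo.trans h₁)
        have := List.length_pos_iff.2 ((W.shape ha ha (h₄ u (by simp))).points_ne_nil)
        simp; omega
      have h₅ : ts.length * (min k (ptsOf ts).length + 2) ≤ b * ((ptsOf ts).length + 2) := by
        gcongr; omega
      have h₆ : b ≤ b * (ptsOf ts).length := Nat.le_mul_of_pos_right _ hn
      nlinarith

/-- Building a node of height `h + 1`, with its augmentation. -/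
theorem calls_mk {k h lo : ℕ} (hk : 1 ≤ k) (ha : 1 ≤ a) (hb : 2 ≤ b) {g : Option Aug}
    {ts : List Tree} (hlo : lo ≤ ts.length) (hpos : 1 ≤ ts.length) (hlen : ts.length ≤ b)
    (hg : Flag b k (h + 1) g) (H : ∀ t ∈ ts, W a b k a h t) :
    ∃ g', Call a b Fn.mk (.pair (.num k) (.pair (encAug g) (encTs ts))) (nd g' ts).enc
        (mkCost b k h (ptsOf ts).length + 1) ∧
      W a b k lo (h + 1) (nd g' ts) ∧ addOf g' = 0 := by
  cases g with
  | none =>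
    have hk' : ¬ k ≤ b ^ (h + 1) := fun h => by simpa using hg.2 h
    refine ⟨none, .of_pre rfl ?_, ⟨none, ts, rfl, hlo, hlen, ?_, H⟩, rfl⟩
    · simp [Within, nd_enc]
    · exact augOK_iff.2 ⟨hg, by simp⟩
  | some x =>
    have hk' : k ≤ b ^ (h + 1) := hg.1 rfl
    obtain ⟨l, hl, tl⟩ := calls_topKids (a := a) (b := b) (k := k) _ ts
      fun t ht => calls_top hk ha hb ha (H t ht)
    refine ⟨some ⟨0, l⟩, .of_pre rfl ?_, ⟨_, ts, rfl, hlo, hlen, ?_, H⟩, rfl⟩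
    · simp [nd_enc]
      refine .intro hl ⟨by simp, ?_⟩
      rw [mkCost, if_pos hk']
      split_ifs with hkh
      · simp only [List.map_const', List.sum_replicate, smul_eq_mul]
        have h₁ : ts.length * (k + 2) ≤ b * (k + 2) := by gcongr
        have h₂ : ts.length * (min k (ptsOf ts).length + 2) ≤ b * (k + 2) := by
          gcongr; omega
        have : b ≤ b * k := Nat.le_mul_of_pos_right _ hk
        nlinarith
      · rw [sum_map_mul_length]
        have hn : 1 ≤ (ptsOf ts).length := by
          obtain ⟨u, us, rfl⟩ := List.exists_cons_of_length_pos hpos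
          have := List.length_pos_iff.2 ((W.shape ha ha (H u (by simp))).points_ne_nil)
          simp; omega
        have h₅ : ts.length * (min k (ptsOf ts).length + 2) ≤ b * ((ptsOf ts).length + 2) := by
          gcongr; omega
        have h₆ : b ≤ b * (ptsOf ts).length := Nat.le_mul_of_pos_right _ hn
        nlinarith
    · exact augOK_iff.2 ⟨⟨fun _ => hk', fun _ => rfl⟩, by rintro _ ⟨⟩; exact tl⟩

/-! ### Pushing down the field `add` -/

mutual
/-- Adds `d` to the scores of all points of a tree, in the field `add` of its root if there is
one. -/
noncomputable def Tree.bump (d : ℝ) : Tree → Tree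
  | .leaf none p => .leaf none (p.shift d)
  | .leaf (some g) p => .leaf (some ⟨g.add + d, g.top⟩) p
  | .node none cs => .node none (cs.bump d)
  | .node (some g) cs => .node (some ⟨g.add + d, g.top⟩) cs
/-- Adds `d` to the scores of all points of the children. -/
noncomputable def Kids.bump (d : ℝ) : Kids → Kids
  | .nil => .nil
  | .cons xk yk t cs => .cons xk yk (t.bump d) (cs.bump d)
end

mutual
theorem Tree.points_bump (d : ℝ) : ∀ t : Tree, (t.bump d).points = t.points.map (Pt.shift d)
  | .leaf none p => by simp [Tree.bump, addOf]
  | .leaf (some g) p => by simp [Tree.bump, addOf]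
  | .node none cs => by simp [Tree.bump, Tree.points, addOf, Kids.points_bump d cs]
  | .node (some g) cs => by simp [Tree.bump, Tree.points, addOf]
theorem Kids.points_bump (d : ℝ) : ∀ cs : Kids, (cs.bump d).points = cs.points.map (Pt.shift d)
  | .nil => by simp [Kids.bump, Kids.points]
  | .cons xk yk t cs => by
    simp [Kids.bump, Kids.points, Tree.points_bump d t, Kids.points_bump d cs]
end

attribute [simp] Tree.points_bump

@[simp] theorem Tree.key_bump (d : ℝ) (t : Tree) :
    (t.bump d).key.x = t.key.x ∧ (t.bump d).key.y = t.key.y := by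
  simp only [Tree.key, Tree.points_bump, List.getLast?_map]
  cases t.points.getLast? <;> simp

theorem kidsOf_bump (d : ℝ) : ∀ ts : List Tree,
    (kidsOf ts).bump d = kidsOf (ts.map (Tree.bump d))
  | [] => rfl
  | t :: ts => by simp [kidsOf, Kids.bump, kidsOf_bump d ts]

theorem nd_bump_none (d : ℝ) (ts : List Tree) :
    (nd none ts).bump d = nd none (ts.map (Tree.bump d)) := by
  simp [nd, Tree.bump, kidsOf_bump]

theorem nd_bump_some (d : ℝ) (g : Aug) (ts : List Tree) :
    (nd (some g) ts).bump d = nd (some ⟨g.add + d, g.top⟩) ts := by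
  simp [nd, Tree.bump]

theorem Flag.some_iff {k h : ℕ} {g g' : Aug} (hg : Flag b k h (some g)) : Flag b k h (some g') :=
  hg

theorem AugOK.bump {k h : ℕ} {l : List Pt} {g : Aug} (d : ℝ) (hg : AugOK b k h l (some g)) :
    AugOK b k h l (some ⟨g.add + d, g.top⟩) := by
  obtain ⟨h₁, h₂⟩ := augOK_iff.1 hg
  exact augOK_iff.2 ⟨h₁.some_iff, by rintro _ ⟨⟩; exact h₂ g rfl⟩

theorem AugOK.none_iff {k h : ℕ} {l m : List Pt} (hg : AugOK b k h l none) :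
    AugOK b k h m none :=
  augOK_iff.2 ⟨(augOK_iff.1 hg).1, by simp⟩

theorem W.bump {k : ℕ} (d : ℝ) : ∀ {h lo : ℕ} {t : Tree}, W a b k lo h t →
    W a b k lo h (t.bump d)
  | 0, _, _, ⟨none, p, rfl, h⟩ => ⟨none, p.shift d, by simp [Tree.bump], h.none_iff⟩
  | 0, _, _, ⟨some g, p, rfl, h⟩ => ⟨_, p, by simp only [Tree.bump], h.bump d⟩
  | _ + 1, _, _, ⟨none, ts, rfl, h₁, h₂, h₃, h₄⟩ =>
    ⟨none, _, nd_bump_none d ts, by simpa, by simpa, h₃.none_iff, fun s hs => by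
      obtain ⟨s, hs', rfl⟩ := List.mem_map.1 hs
      exact (h₄ s hs').bump d⟩
  | _ + 1, _, _, ⟨some g, ts, rfl, h₁, h₂, h₃, h₄⟩ =>
    ⟨_, ts, nd_bump_some d g ts, h₁, h₂, h₃.bump d, h₄⟩

theorem Spine.bump {k : ℕ} {dir : Bool} (d : ℝ) : ∀ {h : ℕ} {t : Tree}, Spine a b k dir h t →
    Spine a b k dir h (t.bump d)
  | 0, _, h => W.bump d h
  | _ + 1, _, ⟨none, u, ts, rfl, h₁, h₂, h₃, h₄⟩ =>
    ⟨none, u.bump d, ts.map (Tree.bump d), by simp [nd_bump_none], by simpa, h₂,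
      h₃.bump d, fun s hs => by
        obtain ⟨s, hs', rfl⟩ := List.mem_map.1 hs
        exact (h₄ s hs').bump d⟩
  | _ + 1, _, ⟨some g, u, ts, rfl, h₁, h₂, h₃, h₄⟩ =>
    ⟨_, u, ts, nd_bump_some d g _, h₁, h₂.some_iff, h₃, h₄⟩

theorem calls_bumpKids (d : ℝ) (c : ℕ) : ∀ ts : List Tree,
    (∀ t ∈ ts, Call a b Fn.bump (.pair (.num d) t.enc) (t.bump d).enc c) →
    Call a b Fn.bumpKids (.pair (.num d) (encTs ts)) (encTs (ts.map (Tree.bump d)))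
      (ts.length * (c + 1) + 1)
  | [], _ => .of_pre rfl (by simp [Within])
  | t :: ts, H => .of_pre rfl (by
      simp
      refine .intro (H t (by simp)) ?_
      refine .intro (calls_bumpKids d c ts fun t ht => H t (by simp [ht])) ?_
      simp only [Within, add_mul, true_and]; omega)

theorem calls_bump {k : ℕ} (hb : 2 ≤ b) (d : ℝ) : ∀ {h : ℕ} {t : Tree}, Shape b k h t →
    Call a b Fn.bump (.pair (.num d) t.enc) (t.bump d).enc (if k ≤ b ^ h then 1 else 5 * b ^ h - 4)
  | 0, _, ⟨g, p, rfl, hf⟩ => .of_pre rfl (by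
      cases g <;> simp [Tree.bump, Within, Pt.shift])
  | h + 1, _, ⟨some g, ts, rfl, h₁, h₂, hf, h₄⟩ => .of_pre rfl (by
      have : k ≤ b ^ (h + 1) := hf.1 rfl
      simp [nd_bump_some, Within, this, nd_enc])
  | h + 1, _, ⟨none, ts, rfl, h₁, h₂, hf, h₄⟩ => .of_pre rfl (by
      have hk' : ¬ k ≤ b ^ (h + 1) := fun h => by simpa using hf.2 h
      have hk'' : ¬ k ≤ b ^ h := fun h' =>
        hk' (h'.trans (Nat.pow_le_pow_right (by omega) (by omega)))
      simp [nd_bump_none, nd_enc]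
      refine .intro (calls_bumpKids d (5 * b ^ h - 4) ts fun t ht => by
        simpa only [if_neg hk''] using calls_bump hb d (h₄ t ht)) ⟨rfl, ?_⟩
      rw [if_neg hk']
      have h₅ : ts.length * (5 * b ^ h - 4 + 1) ≤ b * (5 * b ^ h - 4 + 1) := by gcongr
      have h₆ : 1 ≤ b ^ h := Nat.one_le_pow _ _ (by omega)
      have h₇ : b * (5 * b ^ h - 4 + 1) + 3 * b = 5 * b ^ (h + 1) := by
        rw [pow_succ', show 5 * b ^ h - 4 + 1 = 5 * b ^ h - 3 by omega]
        zify [show 3 ≤ 5 * b ^ h by omega]; ring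
      omega)

/-- Pushing the field `add` of an augmentation down to a child. -/
noncomputable def lower (g : Option Aug) (t : Tree) : Tree :=
  match g with
  | none => t
  | some g => t.bump g.add

/-- The children of a node after its field `add` has been pushed down to them. -/
noncomputable def opened (g : Option Aug) (ts : List Tree) : List Tree := ts.map (lower g)

@[simp] theorem lower_points (g : Option Aug) (t : Tree) :
    (lower g t).points = t.points.map (Pt.shift (addOf g)) := by
  cases g <;> simp [lower, addOf]

theorem W.lower {k lo h : ℕ} {t : Tree} (g : Option Aug) (ht : W a b k lo h t) :
    W a b k lo h (lower g t) := by
  cases g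
  · exact ht
  · exact ht.bump _

theorem Spine.lower {k h : ℕ} {d : Bool} {t : Tree} (g : Option Aug) (ht : Spine a b k d h t) :
    Spine a b k d h (lower g t) := by
  cases g
  · exact ht
  · exact ht.bump _

@[simp] theorem opened_nil (g : Option Aug) : opened g [] = [] := rfl
@[simp] theorem opened_cons (g : Option Aug) (t : Tree) (ts : List Tree) :
    opened g (t :: ts) = lower g t :: opened g ts := rfl

@[simp] theorem opened_none (ts : List Tree) : opened none ts = ts := List.map_id' ts

@[simp] theorem ptsOf_opened (g : Option Aug) (ts : List Tree) :
    ptsOf (opened g ts) = (ptsOf ts).map (Pt.shift (addOf g)) := by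
  induction ts with
  | nil => simp
  | cons t ts ih => simp [ih]

@[simp] theorem length_opened (g : Option Aug) (ts : List Tree) :
    (opened g ts).length = ts.length := by simp [opened]

@[simp] theorem opened_orient (g : Option Aug) (d : Bool) (ts : List Tree) :
    opened g (orient d ts) = orient d (opened g ts) := by simp [opened]

theorem W.opened {k lo h : ℕ} {ts : List Tree} (g : Option Aug) (H : ∀ t ∈ ts, W a b k lo h t) :
    ∀ t ∈ opened g ts, W a b k lo h t := by
  intro t ht
  obtain ⟨t, ht', rfl⟩ := List.mem_map.1 ht
  exact (H t ht').lower g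

theorem calls_opn {k h : ℕ} (hk : 1 ≤ k) (hb : 2 ≤ b) {g : Option Aug} {ts : List Tree}
    (hlen : ts.length ≤ b) (H : ∀ t ∈ ts, Shape b k h t) :
    Call a b Fn.opn (nd g ts).enc (encTs (opened g ts)) (8 * (b * k)) :=
  .of_pre rfl (by
    have hbk : b ≤ b * k := Nat.le_mul_of_pos_right _ hk
    cases g with
    | none => simp [Within, nd_enc]; nlinarith
    | some g =>
      simp [nd_enc]
      refine .intro (calls_bumpKids g.add (5 * k) ts fun t ht =>
        (calls_bump hb g.add (H t ht)).mono ?_) ⟨rfl, ?_⟩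
      · split_ifs <;> omega
      · have : ts.length * (5 * k + 1) ≤ b * (5 * k + 1) := by gcongr
        nlinarith)

/-! ### Repairing a spine -/

/-- The augmentation of the same kind as `g` with vanishing `add` and empty `top`. -/
def raw (g : Option Aug) : Option Aug := g.map fun _ => ⟨0, []⟩

@[simp] theorem addOf_raw (g : Option Aug) : addOf (raw g) = 0 := by cases g <;> rfl

theorem Flag.raw {k h : ℕ} {g : Option Aug} (hg : Flag b k h g) : Flag b k h (raw g) := by
  cases g <;> exact hg

theorem W.flag {k lo h : ℕ} {g : Option Aug} {ts : List Tree} (H : W a b k lo (h + 1) (nd g ts)) :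
    Flag b k (h + 1) g := by
  obtain ⟨g', ts', e, -, -, hg, -⟩ := H
  obtain rfl : g = g' := (Tree.node.inj e).1
  exact (augOK_iff.1 hg).1

/-- Bound for `mkCost` in a tree with at most `b` children per node. -/
def mkMax (b k h : ℕ) : ℕ := mkCost b k h (b ^ (h + 1))

theorem mkCost_le_mkMax {k h n : ℕ} (hn : n ≤ b ^ (h + 1)) : mkCost b k h n ≤ mkMax b k h := by
  unfold mkMax mkCost
  split_ifs <;> first | exact le_rfl | gcongr

/-- Concatenation in the order given by the direction. -/
def cat {α : Type*} (d : Bool) (l m : List α) : List α := if d then m ++ l else l ++ m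

theorem ptsOf_orient_append (d : Bool) (ts us : List Tree) :
    ptsOf (orient d (ts ++ us)) = cat d (ptsOf (orient d ts)) (ptsOf (orient d us)) := by
  cases d <;> simp [orient, cat]

theorem length_ptsOf_le {k h : ℕ} {ts : List Tree} (hlen : ts.length ≤ b)
    (H : ∀ t ∈ ts, Shape b k h t) : (ptsOf ts).length ≤ b ^ (h + 1) := by
  have : (ptsOf ts).length ≤ ts.length * b ^ h := by
    simpa [ptsOf, List.length_flatMap] using List.sum_le_card_nsmul
      (ts.map fun t => t.points.length) (b ^ h) (by
        simp only [List.mem_map]; rintro _ ⟨s, hs, rfl⟩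
        exact (H s hs).length_points_le)
  exact this.trans (by rw [pow_succ']; gcongr)

/-- The estimate of `calls_mk` without reference to the number of points. -/
theorem calls_mk' {k h lo : ℕ} (hk : 1 ≤ k) (ha : 1 ≤ a) (hb : 2 ≤ b) {g : Option Aug}
    {ts : List Tree} (hlo : lo ≤ ts.length) (hpos : 1 ≤ ts.length) (hlen : ts.length ≤ b)
    (hg : Flag b k (h + 1) g) (H : ∀ t ∈ ts, W a b k a h t) :
    ∃ g', Call a b Fn.mk (.pair (.num k) (.pair (encAug g) (encTs ts))) (nd g' ts).enc
        (mkMax b k h + 1) ∧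
      W a b k lo (h + 1) (nd g' ts) ∧ addOf g' = 0 := by
  obtain ⟨g', h₁, h₂, h₃⟩ := calls_mk hk ha hb hlo hpos hlen hg H
  exact ⟨g', h₁.mono (Nat.add_le_add_right
    (mkCost_le_mkMax (length_ptsOf_le hlen fun t ht => (H t ht).shape ha ha)) _), h₂, h₃⟩

theorem calls_rawNode (g : Option Aug) (ts : List Tree) :
    Call a b Fn.rawNode (.pair (encAug g) (encTs ts)) (nd (raw g) ts).enc 1 :=
  .of_pre rfl (by cases g <;> simp [raw, nd_enc, Within])

theorem calls_chunk {n : ℕ} (hn : a ≤ n) :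
    Call a b Fn.chunk (.num n) (.num (min (n - a) b : ℕ)) 1 :=
  .of_pre rfl (by
    simp [← Nat.cast_sub hn]
    refine .intro (fun h => ?_) (fun h => ?_)
    · simp [Within, h.le]
    · simp [Within, not_lt.1 h])

/-- The children of two adjacent nodes, from the side of the spine on. -/
noncomputable def joined (gu gw : Option Aug) (us ws : List Tree) : List Tree :=
  opened gu us ++ opened gw ws

theorem calls_fuse_le {k h : ℕ} (hk : 1 ≤ k) (hb : 2 ≤ b) (d : Bool) {gu gw : Option Aug}
    {us ws : List Tree} (hu : ∀ t ∈ us, Shape b k h t) (hw : ∀ t ∈ ws, Shape b k h t)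
    (hlen : us.length + ws.length ≤ b) :
    Call a b Fn.fuse (.pair (.num k) (.pair (encDir d)
        (.pair (nd gu (orient d us)).enc (nd gw (orient d ws)).enc)))
      (.pair (nd (raw gu) (orient d (joined gu gw us ws))).enc .nil) (60 * (b * k)) :=
  .of_pre rfl (by
    have hbk : b ≤ b * k := Nat.le_mul_of_pos_right _ hk
    have ou := calls_opn (a := a) hk hb (g := gu) (ts := orient d us) (by simp; omega)
      (by simpa using hu)
    have ow := calls_opn (a := a) hk hb (g := gw) (ts := orient d ws) (by simp; omega)
      (by simpa using hw)
    have ou' := calls_orient (a := a) (b := b) d (opened gu (orient d us))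
    have ow' := calls_orient (a := a) (b := b) d (opened gw (orient d ws))
    simp only [nd_enc, opened_orient, orient_orient, length_orient, length_opened] at ou ow ou' ow'
    simp [nd_enc]
    refine .intro ou ?_
    refine .intro ou' ?_
    refine .intro ow ?_
    refine .intro ow' ?_
    refine .intro (calls_app _ _) ?_
    refine .intro (calls_len _) ?_
    have : ¬ (b : ℝ) < us.length + ws.length := by exact_mod_cast hlen.not_gt
    simp [this]
    refine .intro (calls_orient d _) ?_
    refine .intro (calls_rawNode _ _) ?_
    simp [Within, joined, nd_enc]; omega)

/-- More than `b ≥ 2 * a - 1` children suffice for two nodes. The second one gets at least `a` of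
them, and at most `b` because the first one gets `b` whenever more than `a` are left. -/
theorem calls_fuse_gt {k h : ℕ} (hk : 1 ≤ k) (ha : 1 ≤ a) (hb : 2 ≤ b) (hab : 2 * a ≤ b + 1)
    (d : Bool) {gu gw : Option Aug}
    {us ws : List Tree} (hu : ∀ t ∈ us, Shape b k h t) (hw : ∀ t ∈ ws, Shape b k h t)
    (lu : us.length ≤ b) (lw : ws.length ≤ b) (hlen : b < us.length + ws.length)
    (hg : Flag b k (h + 1) gu) (f : ℕ) (hf : f = min (us.length + ws.length - a) b)
    (H : ∀ t ∈ (joined gu gw us ws).drop f, W a b k a h t) :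
    ∃ g', Call a b Fn.fuse (.pair (.num k) (.pair (encDir d)
        (.pair (nd gu (orient d us)).enc (nd gw (orient d ws)).enc)))
      (.pair (nd (raw gu) (orient d ((joined gu gw us ws).take f))).enc
        (nd g' (orient d ((joined gu gw us ws).drop f))).enc) (60 * (b * k) + mkMax b k h) ∧
      W a b k a (h + 1) (nd g' (orient d ((joined gu gw us ws).drop f))) ∧ addOf g' = 0 := by
  have hbk : b ≤ b * k := Nat.le_mul_of_pos_right _ hk
  have ou := calls_opn (a := a) hk hb (g := gu) (ts := orient d us) (by simp; omega)
    (by simpa using hu)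
  have ow := calls_opn (a := a) hk hb (g := gw) (ts := orient d ws) (by simp; omega)
    (by simpa using hw)
  have ou' := calls_orient (a := a) (b := b) d (opened gu (orient d us))
  have ow' := calls_orient (a := a) (b := b) d (opened gw (orient d ws))
  have hl : (joined gu gw us ws).length = us.length + ws.length := by simp [joined]
  obtain ⟨g', hm, hW, h0⟩ := calls_mk' (lo := a) (ts := orient d ((joined gu gw us ws).drop f))
    hk ha hb (by simp [hl]; omega) (by simp [hl]; omega) (by simp [hl]; omega) hg (by simpa using H)
  refine ⟨g', .of_pre rfl ?_, hW, h0⟩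
  simp only [nd_enc, opened_orient, orient_orient, length_orient, length_opened] at ou ow ou' ow' hm
  simp [nd_enc]
  refine .intro ou ?_
  refine .intro ou' ?_
  refine .intro ow ?_
  refine .intro ow' ?_
  refine .intro (calls_app _ _) ?_
  refine .intro (calls_len _) ?_
  have h₁ : (b : ℝ) < us.length + ws.length := by exact_mod_cast hlen
  have hc := calls_chunk (b := b) (show a ≤ us.length + ws.length by omega)
  have ht := calls_take (a := a) (b := b) f (joined gu gw us ws) (by omega)
  have hd := calls_drop (a := a) (b := b) f (joined gu gw us ws) (by omega)
  rw [← hf] at hc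
  simp only [Nat.cast_add] at hc
  simp [h₁]
  refine .intro hc ?_
  refine .intro ht ?_
  refine .intro (calls_orient d _) ?_
  refine .intro (calls_rawNode _ _) ?_
  refine .intro hd ?_
  refine .intro (calls_orient d _) ?_
  refine .intro hm ?_
  simp [Within, nd_enc, hl]; omega

theorem cat_assoc {α : Type*} (d : Bool) (l m n : List α) :
    cat d (cat d l m) n = cat d l (cat d m n) := by
  cases d <;> simp [cat]

theorem ptsOf_orient_cons (d : Bool) (t : Tree) (ts : List Tree) :
    ptsOf (orient d (t :: ts)) = cat d t.points (ptsOf (orient d ts)) := by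
  cases d <;> simp [orient, cat]

theorem ptsOf_joined (d : Bool) (gu gw : Option Aug) (us ws : List Tree) :
    ptsOf (orient d (joined gu gw us ws)) =
      cat d (nd gu (orient d us)).points (nd gw (orient d ws)).points := by
  rw [joined, ptsOf_orient_append, ← opened_orient, ← opened_orient, ptsOf_opened, ptsOf_opened,
    nd_points, nd_points]

/-- Bound for the cost of repairing a list of children of height `h`. -/
def fixCost (b k h : ℕ) : ℕ :=
  h * (300 * (b * k)) + 200 * (b * k) + 4 * ∑ i ∈ Finset.range h, mkMax b k i

/-- The children of a spine node, repaired. -/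
def FixesKids (a b k : ℕ) (d : Bool) (h : ℕ) : Prop :=
  ∀ (u w : Tree) (rest : List Tree), rest.length + 2 ≤ b → Spine a b k d h u →
    (∀ s ∈ w :: rest, W a b k a h s) →
    ∃ cs, Call a b Fn.fixKids (.pair (.num k) (.pair (encDir d) (encTs (u :: w :: rest))))
        (encTs cs) (fixCost b k h) ∧
      (∀ s ∈ cs, W a b k a h s) ∧ rest.length + 1 ≤ cs.length ∧ cs.length ≤ rest.length + 2 ∧
      ptsOf (orient d cs) = ptsOf (orient d (u :: w :: rest))

/-- One level of the repair. The repair of the children reduces their number by at most one, and the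
node is then provided with its list `top`. -/
theorem calls_fix_of {k h : ℕ} {d : Bool} (hk : 1 ≤ k) (ha : 1 ≤ a) (hb : 2 ≤ b)
    (hfix : FixesKids a b k d h) {g : Option Aug} {us : List Tree} (h2 : 2 ≤ us.length)
    (hlen : us.length ≤ b) (hg : Flag b k (h + 1) g) (hu : ∀ u ∈ us.head?, Spine a b k d h u)
    (hus : ∀ s ∈ us.tail, W a b k a h s) :
    ∃ g' ts, Call a b Fn.fix (.pair (.num k) (.pair (encDir d) (nd g (orient d us)).enc))
        (nd g' ts).enc (fixCost b k h + 100 * (b * k) + mkMax b k h) ∧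
      W a b k ts.length (h + 1) (nd g' ts) ∧ us.length ≤ ts.length + 1 ∧ ts.length ≤ us.length ∧
      (∀ s ∈ ts, W a b k a h s) ∧ addOf g' = 0 ∧ ptsOf ts = (nd g (orient d us)).points := by
  have hbk : b ≤ b * k := Nat.le_mul_of_pos_right _ hk
  match us, h2 with
  | u :: w :: rest, _ =>
    have hu := hu u rfl
    simp only [List.tail_cons] at hus
    simp only [List.length_cons] at hlen ⊢
    obtain ⟨cs, hc, hW, hl, hl', hp⟩ := hfix (lower g u) (lower g w) (opened g rest) (by simpa)
      (hu.lower g) (by simpa using W.opened g hus)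
    simp only [length_opened] at hl hl'
    obtain ⟨g', hm, hW', h0⟩ := calls_mk' (lo := cs.length) (ts := orient d cs) hk ha hb (by simp)
      (by simp; omega) (by simp; omega) hg (by simpa using hW)
    have ho := calls_opn (a := a) hk hb (g := g) (ts := orient d (u :: w :: rest)) (by simpa) (by
      intro t ht
      rw [mem_orient, List.mem_cons] at ht
      rcases ht with rfl | ht
      · exact hu.shape ha
      · exact (hus t ht).shape ha ha)
    have ho' := calls_orient (a := a) (b := b) d (orient d (opened g (u :: w :: rest)))
    simp only [nd_enc, opened_orient, orient_orient, length_orient, length_opened,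
      List.length_cons] at ho ho' hm
    refine ⟨g', orient d cs, .of_pre rfl ?_, by simpa using hW', by simp; omega, by simp; omega,
      by simpa using hW, h0, ?_⟩
    · simp [nd_enc]
      refine .intro ho ?_
      refine .intro ho' ?_
      refine .intro hc ?_
      refine .intro (calls_orient d _) ?_
      refine .intro hm ?_
      simp [Within]; omega
    · rw [hp, ← opened_cons, ← opened_cons, ← opened_orient, ptsOf_opened, nd_points]

/-- The spine node is fused with its neighbour, which has at least `a` children, before its children
are repaired. Then the repair, which may cost one child, leaves at least `a` children or, in a
single case, `a - 1`. In this case there is a second node with exactly `a` children, and the two of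
them fit into one node since `2 * a - 1 ≤ b`. -/
theorem fixesKids {k : ℕ} (hk : 1 ≤ k) (ha : 2 ≤ a) (hab : 2 * a ≤ b + 1) (d : Bool) :
    ∀ h, FixesKids a b k d h := by
  have hb : 2 ≤ b := by omega
  have ha' : 1 ≤ a := by omega
  have hbk : b ≤ b * k := Nat.le_mul_of_pos_right _ hk
  intro h
  induction h with
  | zero =>
    rintro u w rest hr hu hw
    refine ⟨u :: w :: rest, .of_pre rfl ?_, ?_, by simp, by simp, rfl⟩
    · obtain ⟨g, p, rfl, -⟩ := hu
      simp [Within, fixCost]; omega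
    · intro s hs
      rcases List.mem_cons.1 hs with rfl | hs
      · exact hu
      · exact hw s hs
  | succ h ih =>
    rintro u w rest hr hu hw
    obtain ⟨gu, u₀, ur, rfl, lu, fu, hu₀, hur⟩ := hu
    obtain ⟨gw, ws, rfl, lw₁, lw₂, fw, hws⟩ := hw w (by simp)
    have hrest : ∀ s ∈ rest, W a b k a (h + 1) s := fun s hs => hw s (by simp [hs])
    obtain ⟨ws, rfl⟩ : ∃ ws', ws = orient d ws' := ⟨orient d ws, by simp⟩
    simp only [length_orient, mem_orient] at lw₁ lw₂ hws
    set us := u₀ :: ur with hus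
    have hl : us.length = ur.length + 1 := rfl
    have su : ∀ t ∈ us, Shape b k h t := by
      intro t ht
      rcases List.mem_cons.1 ht with rfl | ht
      · exact hu₀.shape ha'
      · exact (hur t ht).shape ha' ha'
    have sw : ∀ t ∈ ws, Shape b k h t := fun t ht => (hws t ht).shape ha' ha'
    set J := joined gu gw us ws with hJ
    have lJ : J.length = us.length + ws.length := by simp [J, joined]
    have J_cons : J = lower gu u₀ :: (opened gu ur ++ opened gw ws) := by simp [J, joined, us]
    have J_head : ∀ x ∈ J.head?, Spine a b k d h x := by
      rw [J_cons]; rintro _ ⟨⟩; exact hu₀.lower gu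
    have J_tail : ∀ x ∈ J.tail, W a b k a h x := by
      rw [J_cons]; intro x hx
      rcases List.mem_append.1 hx with hx | hx
      · exact W.opened _ hur x hx
      · exact W.opened _ hws x hx
    have pJ : ptsOf (orient d J) =
        cat d (nd gu (orient d us)).points (nd gw (orient d ws)).points :=
      ptsOf_joined ..
    by_cases hn : us.length + ws.length ≤ b
    · -- the two nodes fit into one, which has more than `a` children
      have hfuse := calls_fuse_le (a := a) hk hb d (gu := gu) (gw := gw) su sw hn
      obtain ⟨g₁, ts₁, hfx, W₁, l₁, -, -, h0, p₁⟩ := calls_fix_of hk ha' hb ih (us := J)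
        (by omega) (by omega) fu.raw J_head J_tail
      have W₁ := W₁.mono (show a ≤ ts₁.length by omega)
      have hcell := calls_cell (a := a) (W₁.shape ha' ha')
      simp only [nd_enc] at hfuse hfx hcell
      refine ⟨nd g₁ ts₁ :: rest, .of_pre rfl ?_, ?_, by simp, by simp, ?_⟩
      · simp [nd_enc]
        refine .intro hfuse ?_
        simp
        refine .intro hfx ?_
        refine .intro hcell ?_
        simp [Within, nd_enc, fixCost, add_mul, Finset.sum_range_succ]; omega
      · intro s hs
        rcases List.mem_cons.1 hs with rfl | hs
        · exact W₁
        · exact hrest s hs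
      · rw [ptsOf_orient_cons, ptsOf_orient_cons, ptsOf_orient_cons, ← cat_assoc, ← pJ, nd_points,
          h0, p₁]
        simp
    · push Not at hn
      have drop_sub : ∀ f, 1 ≤ f → ∀ t ∈ J.drop f, W a b k a h t := fun f hf t ht => by
        refine J_tail t ?_
        rw [← List.drop_one]
        exact List.drop_subset_drop_left J hf ht
      obtain ⟨f, hf⟩ : ∃ f, f = min (us.length + ws.length - a) b := ⟨_, rfl⟩
      obtain ⟨gv, hfuse, Wv, hv0⟩ := calls_fuse_gt hk ha' hb hab d su sw (by omega) lw₂ hn fu f hf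
        (drop_sub f (by omega))
      rw [← hJ] at hfuse Wv
      have lt : (J.take f).length = f := by simp; omega
      obtain ⟨g₁, ts₁, hfx, W₁, l₁, l₁', w₁, h0, p₁⟩ := calls_fix_of hk ha' hb ih (us := J.take f)
        (by omega) (by omega) fu.raw
        (by
          rw [J_cons] at J_head ⊢
          obtain ⟨f, rfl⟩ : ∃ f', f = f' + 1 := ⟨f - 1, by omega⟩
          simpa using J_head)
        (fun s hs => J_tail s (by
          rw [← List.drop_one] at hs ⊢
          rw [List.drop_take] at hs
          exact List.mem_of_mem_take hs))
      have pW : cat d (nd g₁ ts₁).points (nd gv (orient d (J.drop f))).points =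
          cat d (nd gu (orient d us)).points (nd gw (orient d ws)).points := by
        rw [← pJ]
        conv_rhs => rw [← List.take_append_drop f J]
        rw [ptsOf_orient_append, nd_points, nd_points, h0, hv0, p₁]
        simp
      by_cases hlt : ts₁.length < a
      · -- this happens only for `2 * a` children, so the two nodes fit into one
        have hfa : f = a := by omega
        have ln : us.length + ws.length = 2 * a := by omega
        have ld : (J.drop f).length = a := by simp; omega
        have sd : ∀ t ∈ J.drop f, Shape b k h t := fun t ht =>
          (drop_sub f (by omega) t ht).shape ha' ha'
        have s₁ : ∀ t ∈ orient d ts₁, Shape b k h t := fun t ht =>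
          (w₁ t ((mem_orient d).1 ht)).shape ha' ha'
        have hfuse₂ := calls_fuse_le (a := a) hk hb d (gu := g₁) (gw := gv) s₁ sd
          (by simp only [length_orient]; omega)
        have p₂ := ptsOf_joined d g₁ gv (orient d ts₁) (J.drop f)
        set K := joined g₁ gv (orient d ts₁) (J.drop f) with hK
        have lK : K.length = ts₁.length + a := by rw [hK, joined]; simp; omega
        have wK : ∀ t ∈ orient d K, W a b k a h t := by
          intro t ht
          rw [mem_orient, hK, joined] at ht
          rcases List.mem_append.1 ht with ht | ht
          · exact W.opened _ (fun s hs => w₁ s ((mem_orient d).1 hs)) t ht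
          · exact W.opened _ (drop_sub f (by omega)) t ht
        have f₁ : Flag b k (h + 1) g₁ := W₁.flag
        have ho := calls_opn (a := a) hk hb (g := raw g₁) (ts := orient d K) (by simp; omega)
          fun t ht => (wK t ht).shape ha' ha'
        obtain ⟨g₂, hm, W₂, h₂⟩ := calls_mk' (lo := a) (ts := opened (raw g₁) (orient d K)) hk ha'
          hb
          (by simp; omega) (by simp; omega) (by simp; omega) f₁.raw (W.opened _ wK)
        have hcell := calls_cell (a := a) (W₂.shape ha' ha')
        simp only [nd_enc, orient_orient] at hfuse hfx hcell hfuse₂ ho hm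
        refine ⟨nd g₂ (opened (raw g₁) (orient d K)) :: rest, .of_pre rfl ?_, ?_, by simp, by simp,
          ?_⟩
        · simp [nd_enc]
          refine .intro hfuse ?_
          simp
          refine .intro hfx ?_
          simp
          refine .intro (calls_len _) ?_
          simp [hlt]
          refine .intro hfuse₂ ?_
          simp
          refine .intro ho ?_
          refine .intro hm ?_
          refine .intro hcell ?_
          simp [Within, nd_enc, fixCost, add_mul, Finset.sum_range_succ]; omega
        · intro s hs
          rcases List.mem_cons.1 hs with rfl | hs
          · exact W₂
          · exact hrest s hs
        · rw [ptsOf_orient_cons, ptsOf_orient_cons, ptsOf_orient_cons, ← cat_assoc, ← pW, nd_points,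
            h₂, ptsOf_opened, p₂]
          simp
      · have W₁ := W₁.mono (show a ≤ ts₁.length by omega)
        have hcell := calls_cell (a := a) (W₁.shape ha' ha')
        have hcell₂ := calls_cell (a := a) (Wv.shape ha' ha')
        simp only [nd_enc] at hfuse hfx hcell hcell₂
        refine ⟨nd g₁ ts₁ :: nd gv (orient d (J.drop f)) :: rest, .of_pre rfl ?_, ?_, by simp,
          by simp, ?_⟩
        · simp [nd_enc]
          refine .intro hfuse ?_
          simp
          refine .intro hfx ?_
          simp
          refine .intro (calls_len _) ?_
          simp [hlt]
          refine .intro hcell ?_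
          refine .intro hcell₂ ?_
          simp [Within, nd_enc, fixCost, add_mul, Finset.sum_range_succ]; omega
        · intro s hs
          simp only [List.mem_cons] at hs
          rcases hs with rfl | rfl | hs
          · exact W₁
          · exact Wv
          · exact hrest s hs
        · rw [ptsOf_orient_cons, ptsOf_orient_cons, ptsOf_orient_cons, ptsOf_orient_cons,
            ← cat_assoc, ← cat_assoc, ← pW]

/-- The total cost of one node for each height below `h`. The sorting takes place at one height
only, where the nodes have at most `b * k` points. -/
theorem sum_mkMax_le {k : ℕ} (hk : 1 ≤ k) (hb : 2 ≤ b) : ∀ h : ℕ,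
    ∑ i ∈ Finset.range h, mkMax b k i ≤
      9 * (b * k) * h + if k ≤ b ^ h then 5 * b * (b * k) * (h + 1) else 0
  | 0 => by simp
  | h + 1 => by
    have hbk : b ≤ b * k := Nat.le_mul_of_pos_right _ hk
    have ih := sum_mkMax_le hk hb h
    have hm : b ^ h ≤ b ^ (h + 1) := Nat.pow_le_pow_right (by omega) (by omega)
    rw [Finset.sum_range_succ, show mkMax b k h = mkCost b k h (b ^ (h + 1)) from rfl]
    unfold mkCost
    by_cases h₁ : k ≤ b ^ h
    · rw [if_pos h₁] at ih
      rw [if_pos (h₁.trans hm), if_pos h₁, if_pos (h₁.trans hm)]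
      nlinarith
    · rw [if_neg h₁] at ih
      by_cases h₂ : k ≤ b ^ (h + 1)
      · rw [if_pos h₂, if_neg h₁, if_pos h₂]
        have : 5 * b * (h + 2) * b ^ (h + 1) ≤ 5 * b * (b * k) * (h + 1 + 1) := by
          rw [pow_succ']
          calc 5 * b * (h + 2) * (b * b ^ h) = 5 * b * (b * b ^ h) * (h + 1 + 1) := by ring
            _ ≤ _ := by gcongr; omega
        nlinarith
      · rw [if_neg h₂, if_neg h₂]
        nlinarith

theorem fixCost_le {k h : ℕ} (hk : 1 ≤ k) (hb : 2 ≤ b) :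
    fixCost b k h ≤ 360 * b * b * (k * (h + 1)) := by
  have h₁ := sum_mkMax_le hk hb h
  have h₂ : (if k ≤ b ^ h then 5 * b * (b * k) * (h + 1) else 0) ≤ 5 * b * (b * k) * (h + 1) := by
    split_ifs <;> simp
  have h₃ : 300 * (b * k) * (h + 1) ≤ 150 * b * (b * k) * (h + 1) := by
    gcongr ?_ * (b * k) * (h + 1); omega
  have h₄ : 36 * (b * k) * h ≤ 18 * b * (b * k) * (h + 1) := by
    gcongr ?_ * (b * k) * ?_ <;> omega
  have h₅ : 0 ≤ b * (b * k) * (h + 1) := Nat.zero_le _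
  unfold fixCost
  nlinarith

/-- A tree whose spine is repaired after nodes with a single child have been removed at the top. -/
theorem calls_finish {k : ℕ} (hk : 1 ≤ k) (ha : 2 ≤ a) (hab : 2 * a ≤ b + 1) (d : Bool) :
    ∀ {h : ℕ} {t : Tree}, Spine a b k d h t →
    ∃ h' t', Call a b Fn.finish (.pair (.num k) (.pair (encDir d) t.enc)) t'.enc (fixCost b k h) ∧
      W a b k 2 h' t' ∧ t'.points = t.points := by
  have hb : 2 ≤ b := by omega
  have hbk : b ≤ b * k := Nat.le_mul_of_pos_right _ hk
  intro h
  induction h with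
  | zero =>
    intro t ht
    refine ⟨0, t, .of_pre rfl ?_, ht, rfl⟩
    obtain ⟨g, p, rfl, -⟩ := ht
    simp [Within, fixCost]; omega
  | succ h ih =>
    rintro t ⟨g, u, us, rfl, hlen, hg, hu, hus⟩
    cases us with
    | nil =>
      have ho := calls_opn (a := a) hk hb (g := g) (ts := orient d [u]) (by simp; omega) (by
        intro t ht
        obtain rfl : t = u := by simpa using ht
        exact hu.shape (by omega))
      obtain ⟨h', t', hc, hW, hp⟩ := ih (hu.lower g)
      have e : orient d [u] = [u] := by cases d <;> rfl
      refine ⟨h', t', .of_pre rfl ?_, hW, by simp [hp, e]⟩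
      simp only [nd_enc, opened_cons, opened_nil, e] at ho
      simp [nd_enc, e]
      refine .intro ho ?_
      simp
      refine .intro hc ?_
      simp [Within, fixCost, add_mul, Finset.sum_range_succ]; omega
    | cons w rest =>
      obtain ⟨g', ts, hc, hW, l₁, l₂, hts, h0, hp⟩ := calls_fix_of hk (by omega) hb
        (fixesKids hk ha hab d h) (us := u :: w :: rest) (by simp) (by simpa using hlen) hg
        (by simpa using hu) (by simpa using hus)
      have two : ∃ x y l, orient d (u :: w :: rest) = x :: y :: l := by
        have : 2 ≤ (orient d (u :: w :: rest)).length := by simp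
        match orient d (u :: w :: rest), this with
        | x :: y :: l, _ => exact ⟨x, y, l, rfl⟩
      obtain ⟨x, y, l, e⟩ := two
      have hpt : (nd g' ts).points = (nd g (orient d (u :: w :: rest))).points := by
        rw [nd_points, h0, hp]; simp
      rw [e] at hc hpt ⊢
      simp only [nd_enc] at hc
      match ts, l₁ with
      | [z], _ =>
        have ho := calls_opn (a := a) hk hb (g := g') (ts := [z]) (by simp; omega) (by
          intro t ht
          exact (hts t ht).shape (by omega) (by omega))
        refine ⟨h, lower g' z, .of_pre rfl ?_, ((hts z (by simp)).mono ha).lower g', ?_⟩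
        · simp only [nd_enc] at ho
          simp [nd_enc]
          refine .intro hc ?_
          simp
          refine .intro ho ?_
          simp [Within, fixCost, add_mul, Finset.sum_range_succ]; omega
        · rw [← hpt]; simp
      | z :: z' :: ts, _ =>
        refine ⟨h + 1, _, .of_pre rfl ?_, hW.mono (by simp), hpt⟩
        simp [nd_enc]
        refine .intro hc ?_
        simp [Within, fixCost, add_mul, Finset.sum_range_succ]; omega

/-! ### Queries -/

/-- The points that are to the left of the position described by the query `m` with the value `z`;
on a layer this is an initial segment. The queries `2` and `3` describe the same position. -/
def Pref (m : ℕ) (z : ℝ) (p : Pt) : Prop :=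
  if m = 0 then p.x ≤ z else if m = 1 then z < p.y else p.x < z

noncomputable instance (m : ℕ) (z : ℝ) : DecidablePred (Pref m z) := Classical.decPred _

@[simp] theorem pref_shift {m : ℕ} {z d : ℝ} {p : Pt} : Pref m z (p.shift d) ↔ Pref m z p := Iff.rfl

theorem calls_test (m : ℕ) (z : ℝ) (p : Pt) (v : Val) :
    Call a b Fn.test (.pair (.pair (.num m) (.num z)) (.pair (.num p.x) (.pair (.num p.y) v)))
      (encDir (decide (Pref m z p))) 1 :=
  .of_pre rfl (by
    unfold Pref
    simp
    refine .intro (fun h => ?_) (fun h => ?_)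
    · subst h
      refine .intro (fun h => ?_) (fun h => ?_)
      · simp [Within, not_le.2 h]
      · simp [Within, not_lt.1 h]
    · by_cases h₁ : m = 1
      · subst h₁
        simp
        refine .intro (fun h => ?_) (fun h => ?_) <;> simp [Within, h]
      · have : ¬ m ≤ 1 := by omega
        simp [this, h, h₁]
        refine .intro (fun h => ?_) (fun h => ?_) <;> simp [Within, h])

/-- The points of the list that satisfy `Pref m z` form an initial segment. -/
def Mono (m : ℕ) (z : ℝ) (l : List Pt) : Prop := l.Pairwise fun p q => Pref m z q → Pref m z p

theorem Mono.map_shift {m : ℕ} {z d : ℝ} {l : List Pt} :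
    Mono m z (l.map (Pt.shift d)) ↔ Mono m z l := by
  simp [Mono, List.pairwise_map]

theorem Tree.points_key {t : Tree} (ht : t.points ≠ []) : t.points.getLast ht = t.key := by
  simp [Tree.key, List.getLast?_eq_getLast_of_ne_nil ht]

theorem Tree.key_mem {t : Tree} (ht : t.points ≠ []) : t.key ∈ t.points := by
  rw [← Tree.points_key ht]; exact List.getLast_mem ht

/-- The key of a tree, which belongs to its last point, tells whether all of its points are to the
left of the position. -/
theorem Mono.pref_of_key {m : ℕ} {z : ℝ} {t : Tree} (ht : t.points ≠ []) (hm : Mono m z t.points)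
    (h : Pref m z t.key) : ∀ p ∈ t.points, Pref m z p := by
  intro p hp
  rw [← List.dropLast_append_getLast ht, Tree.points_key ht] at hm hp
  rcases List.mem_append.1 hp with hp | hp
  · exact (List.pairwise_append.1 hm).2.2 p hp _ (by simp) h
  · obtain rfl : p = t.key := by simpa using hp
    exact h

/-- The point at which the search ends: the first one that is not to the left of the position, and
the last one if there is none. -/
noncomputable def locate (m : ℕ) (z : ℝ) (l : List Pt) : Option Pt :=
  (l.find? fun p => decide (¬ Pref m z p)).or l.getLast?

theorem locate_map_shift {m : ℕ} {z d : ℝ} {l : List Pt} :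
    locate m z (l.map (Pt.shift d)) = (locate m z l).map (Pt.shift d) := by
  simp only [locate, List.find?_map, List.getLast?_map, Option.map_or]
  rfl

theorem calls_searchKids {m : ℕ} {z : ℝ} (c : ℕ) : ∀ (ts : List Tree) (t : Tree),
    (∀ s ∈ t :: ts, s.points ≠ []) → Mono m z (ptsOf (t :: ts)) →
    (∀ s ∈ t :: ts, Mono m z s.points →
      ∃ p, Call a b Fn.search (.pair (.pair (.num m) (.num z)) s.enc) p.enc c ∧
        locate m z s.points = some p) →
    ∃ p, Call a b Fn.searchKids (.pair (.pair (.num m) (.num z)) (encTs (t :: ts))) p.enc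
        (2 * ts.length + c + 2) ∧
      locate m z (ptsOf (t :: ts)) = some p
  | [], t, hne, hm, H => by
    obtain ⟨p, hp, hl⟩ := H t (by simp) (by simpa using hm)
    refine ⟨p, .of_pre rfl ?_, by simpa using hl⟩
    simp
    refine .intro hp ?_
    simp [Within]; omega
  | u :: ts, t, hne, hm, H => by
    have hm' := List.pairwise_append.1 (by simpa [Mono] using hm)
    have ht := hne t (by simp)
    by_cases hk : Pref m z t.key
    · obtain ⟨p, hp, hl⟩ := calls_searchKids c ts u (fun s hs => hne s (by simp [hs]))
        (by simpa [Mono] using hm'.2.1) fun s hs => H s (by simp [hs])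
      refine ⟨p, .of_pre rfl ?_, ?_⟩
      · simp
        refine .intro (calls_test m z t.key _) ?_
        simp [hk]
        refine .intro hp ?_
        simp [Within]; omega
      · rw [← hl]
        have hall := Mono.pref_of_key ht hm'.1 hk
        have hne' : ptsOf (u :: ts) ≠ [] := by simp [hne u (by simp)]
        have hf : t.points.find? (fun p => decide (¬ Pref m z p)) = none :=
          List.find?_eq_none.2 fun p hp => by simpa using hall p hp
        rw [ptsOf_cons t, locate, List.find?_append, hf, Option.none_or, List.getLast?_append,
          List.getLast?_eq_getLast_of_ne_nil hne', Option.some_or, locate,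
          List.getLast?_eq_getLast_of_ne_nil hne']
    · obtain ⟨p, hp, hl⟩ := H t (by simp) hm'.1
      refine ⟨p, .of_pre rfl ?_, ?_⟩
      · simp
        refine .intro (calls_test m z t.key _) ?_
        simp [hk]
        refine .intro hp ?_
        simp [Within]; omega
      · obtain ⟨q, hq⟩ : ∃ q, t.points.find? (fun p => decide (¬ Pref m z p)) = some q :=
          Option.isSome_iff_exists.1 (List.find?_isSome.2 ⟨_, Tree.key_mem ht, by simpa using hk⟩)
        rw [locate, hq, Option.some_or] at hl
        rw [ptsOf_cons t, locate, List.find?_append, hq, Option.some_or, Option.some_or, hl]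

theorem calls_search {k m : ℕ} {z : ℝ} : ∀ {h : ℕ} {t : Tree},
    Shape b k h t → Mono m z t.points →
    ∃ p, Call a b Fn.search (.pair (.pair (.num m) (.num z)) t.enc) p.enc ((2 * b + 3) * (h + 1)) ∧
      locate m z t.points = some p
  | 0, _, ⟨g, p, rfl, hg⟩, hm => by
    refine ⟨p.shift (addOf g), .of_pre rfl ?_, ?_⟩
    · cases g <;> simp [Within, Pt.shift, addOf]
    · simp only [leaf_points, locate, List.find?_cons]
      split <;> simp
  | h + 1, _, ⟨g, ts, rfl, h₁, h₂, hg, h₄⟩, hm => by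
    obtain ⟨u, us, rfl⟩ := List.exists_cons_of_length_pos h₁
    rw [nd_points, Mono.map_shift] at hm
    obtain ⟨p, hp, hl⟩ := calls_searchKids (a := a) ((2 * b + 3) * (h + 1)) us u
      (fun s hs => (h₄ s hs).points_ne_nil) hm fun s hs hs' => calls_search (h₄ s hs) hs'
    refine ⟨p.shift (addOf g), .of_pre rfl ?_, by rw [nd_points, locate_map_shift, hl]; rfl⟩
    simp only [List.length_cons] at h₂
    simp [nd_enc]
    refine .intro hp ?_
    cases g <;> simp [Within, Pt.shift, addOf, mul_add] <;> omega

/-! ### Cutting along a search path -/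

/-- `l` is divided at the position of the query `m` with the value `z` into `L` and `R`. For
`m = 3` the first point after the position is left out. -/
def IsCut (m : ℕ) (z : ℝ) (l L R : List Pt) : Prop :=
  ∃ mid, l = L ++ mid ++ R ∧ (∀ p ∈ L, Pref m z p) ∧ (∀ p ∈ mid ++ R, ¬ Pref m z p) ∧
    (m ≠ 3 → mid = []) ∧ (m = 3 → (∃ q, mid = [q]) ∨ mid = [] ∧ R = [])

theorem IsCut.append_left {m : ℕ} {z : ℝ} {l L R l' : List Pt} (h : IsCut m z l L R)
    (h' : ∀ p ∈ l', Pref m z p) : IsCut m z (l' ++ l) (l' ++ L) R := by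
  obtain ⟨mid, rfl, h₁, h₂, h₃, h₄⟩ := h
  refine ⟨mid, by simp, fun p hp => ?_, h₂, h₃, h₄⟩
  rcases List.mem_append.1 hp with hp | hp
  · exact h' p hp
  · exact h₁ p hp

theorem IsCut.append_right {m : ℕ} {z : ℝ} {l L R l' : List Pt} (h : IsCut m z l L R)
    (h' : ∀ p ∈ l', ¬ Pref m z p) (hl : l' ≠ [] → ∃ p ∈ l, ¬ Pref m z p) :
    IsCut m z (l ++ l') L (R ++ l') := by
  obtain ⟨mid, rfl, h₁, h₂, h₃, h₄⟩ := h
  refine ⟨mid, by simp, h₁, fun p hp => ?_, h₃, fun hm => ?_⟩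
  · rw [← List.append_assoc] at hp
    rcases List.mem_append.1 hp with hp | hp
    · exact h₂ p hp
    · exact h' p hp
  · rcases h₄ hm with h | ⟨rfl, rfl⟩
    · exact .inl h
    · refine .inr ⟨rfl, ?_⟩
      by_contra hne
      obtain ⟨p, hp, hp'⟩ := hl (by simpa using hne)
      exact hp' (h₁ p (by simpa using hp))

/-- The children of a spine node; the list may be empty. -/
def SpineList (a b k : ℕ) (d : Bool) (h : ℕ) (ts : List Tree) : Prop :=
  ts = [] ∨ ∃ u us, ts = orient d (u :: us) ∧ Spine a b k d h u ∧ ∀ s ∈ us, W a b k a h s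

/-- Possibly missing trees in memory. -/
noncomputable def encTree? : Option Tree → Val
  | none => .nil
  | some t => t.enc

/-- The points of a possibly missing tree. -/
noncomputable def ptsOf? : Option Tree → List Pt
  | none => []
  | some t => t.points

@[simp] theorem encTree?_none : encTree? none = .nil := rfl
@[simp] theorem encTree?_some (t : Tree) : encTree? (some t) = t.enc := rfl
@[simp] theorem ptsOf?_none : ptsOf? none = [] := rfl
@[simp] theorem ptsOf?_some (t : Tree) : ptsOf? (some t) = t.points := rfl

theorem Tree.enc_eq_pair (t : Tree) : ∃ u v, t.enc = .pair u v := by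
  cases t <;> exact ⟨_, _, by rw [Tree.enc]⟩

/-- The specification of the function `cut` for trees of height `h`. -/
def CutsAt (a b k m : ℕ) (z : ℝ) (h c : ℕ) : Prop :=
  ∀ t, W a b k a h t → Mono m z t.points → ∃ L R : Option Tree,
    Call a b Fn.cut (.pair (.pair (.num m) (.num z)) t.enc) (.pair (encTree? L) (encTree? R)) c ∧
    (∀ u ∈ L, Spine a b k true h u) ∧ (∀ u ∈ R, Spine a b k false h u) ∧
    IsCut m z t.points (ptsOf? L) (ptsOf? R)

@[simp] theorem casePair_enc (t : Tree) (p q : Prop) : Src.CasePair t.enc p q = p := by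
  obtain ⟨u, v, e⟩ := t.enc_eq_pair
  rw [e, Src.casePair_pair]

theorem calls_cutAt {k h m c : ℕ} {z : ℝ} (ha : 1 ≤ a) (H : CutsAt a b k m z h c)
    {t : Tree} {ts : List Tree} (hW : ∀ s ∈ t :: ts, W a b k a h s) (hm : Mono m z t.points)
    (hp : ∀ p ∈ ptsOf ts, ¬ Pref m z p) (hne : ptsOf ts ≠ [] → ∃ p ∈ t.points, ¬ Pref m z p) :
    ∃ Ls Rs, Call a b Fn.cutAt (.pair (.pair (.num m) (.num z)) (encTs (t :: ts)))
        (.pair (encTs Ls) (encTs Rs)) (c + 2 * b + 3) ∧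
      SpineList a b k true h Ls ∧ SpineList a b k false h Rs ∧
      Ls.length ≤ ts.length + 1 ∧ Rs.length ≤ ts.length + 1 ∧
      IsCut m z (ptsOf (t :: ts)) (ptsOf Ls) (ptsOf Rs) := by
  obtain ⟨L, R, hc, hL, hR, hcut⟩ := H t (hW t (by simp)) hm
  refine ⟨L.toList, R.toList ++ ts, .of_pre rfl ?_, ?_, ?_, by cases L <;> simp,
    by cases R <;> simp, ?_⟩
  · simp
    refine .intro hc ?_
    cases L with
    | none =>
      cases R with
      | none => simp [Within]; omega
      | some R =>
        simp
        refine .intro (calls_cell ((hR R rfl).shape ha)) ?_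
        simp [Within]; omega
    | some L =>
      simp
      refine .intro (calls_cell ((hL L rfl).shape ha)) ?_
      cases R with
      | none => simp [Within]; omega
      | some R =>
        simp
        refine .intro (calls_cell ((hR R rfl).shape ha)) ?_
        simp [Within]; omega
  · cases L with
    | none => exact .inl rfl
    | some L => exact .inr ⟨L, [], rfl, hL L rfl, by simp⟩
  · cases R with
    | none =>
      cases ts with
      | nil => exact .inl rfl
      | cons u us => exact .inr ⟨u, us, rfl, (hW u (by simp)).spine ha ha, fun s hs =>
          hW s (by simp [hs])⟩
    | some R => exact .inr ⟨R, ts, rfl, hR R rfl, fun s hs => hW s (by simp [hs])⟩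
  · have := hcut.append_right hp hne
    cases L <;> cases R <;> simpa using this

theorem calls_cutKids {k h m c : ℕ} {z : ℝ} (ha : 1 ≤ a) (H : CutsAt a b k m z h c) :
    ∀ (ts : List Tree) (t : Tree), (∀ s ∈ t :: ts, W a b k a h s) → Mono m z (ptsOf (t :: ts)) →
    ∃ Ls Rs, Call a b Fn.cutKids (.pair (.pair (.num m) (.num z)) (encTs (t :: ts)))
        (.pair (encTs Ls) (encTs Rs)) (2 * ts.length + c + 2 * b + 5) ∧
      SpineList a b k true h Ls ∧ SpineList a b k false h Rs ∧
      Ls.length ≤ ts.length + 1 ∧ Rs.length ≤ ts.length + 1 ∧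
      IsCut m z (ptsOf (t :: ts)) (ptsOf Ls) (ptsOf Rs) := by
  intro ts
  induction ts with
  | nil =>
    intro t hW hm
    obtain ⟨Ls, Rs, hc, h⟩ := calls_cutAt ha H hW (by simpa using hm) (by simp) (by simp)
    refine ⟨Ls, Rs, .of_pre rfl ?_, h⟩
    simp
    refine .intro hc ?_
    simp [Within]; omega
  | cons u ts ih =>
    intro t hW hm
    have hm' := List.pairwise_append.1 (by simpa only [Mono, ptsOf_cons t] using hm)
    have ht := ((hW t (by simp)).shape ha ha).points_ne_nil
    by_cases hk : Pref m z t.key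
    · obtain ⟨Ls, Rs, hc, hL, hR, l₁, l₂, hcut⟩ := ih u (fun s hs => hW s (by simp [hs])) hm'.2.1
      refine ⟨t :: Ls, Rs, .of_pre rfl ?_, ?_, hR, by simpa using l₁, by simp; omega, ?_⟩
      · simp
        refine .intro (calls_test m z t.key _) ?_
        simp [hk]
        refine .intro hc ?_
        simp [Within]; omega
      · rcases hL with rfl | ⟨v, vs, rfl, hv, hvs⟩
        · exact .inr ⟨t, [], rfl, (hW t (by simp)).spine ha ha, by simp⟩
        · refine .inr ⟨v, vs ++ [t], by simp [orient], hv, fun s hs => ?_⟩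
          rcases List.mem_append.1 hs with hs | hs
          · exact hvs s hs
          · obtain rfl : s = t := by simpa using hs
            exact hW s (by simp)
      · rw [ptsOf_cons t, ptsOf_cons t]
        exact hcut.append_left (Mono.pref_of_key ht hm'.1 hk)
    · obtain ⟨Ls, Rs, hc, h⟩ := calls_cutAt ha H hW hm'.1
        (fun p hp hp' => hk (hm'.2.2 _ (Tree.key_mem ht) p hp hp'))
        fun _ => ⟨_, Tree.key_mem ht, hk⟩
      refine ⟨Ls, Rs, .of_pre rfl ?_, h⟩
      simp
      refine .intro (calls_test m z t.key _) ?_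
      simp [hk]
      refine .intro hc ?_
      simp [Within]; omega

theorem SpineList.calls_spineNode {k h : ℕ} {d : Bool} {g : Option Aug} {ts : List Tree}
    (hg : Flag b k (h + 1) g) (hlen : ts.length ≤ b) (hts : SpineList a b k d h ts) :
    ∃ t : Option Tree, Call a b Fn.spineNode (.pair (encAug g) (encTs ts)) (encTree? t) 2 ∧
      (∀ u ∈ t, Spine a b k d (h + 1) u) ∧ ptsOf? t = ptsOf ts := by
  rcases hts with rfl | ⟨u, us, rfl, hu, hus⟩
  · exact ⟨none, .of_pre rfl (by simp [Within]), by simp, rfl⟩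
  · refine ⟨some (nd (raw g) (orient d (u :: us))), .of_pre rfl ?_, ?_, by simp⟩
    · obtain ⟨x, xs, e⟩ : ∃ x xs, orient d (u :: us) = x :: xs :=
        List.exists_cons_of_length_pos (by simp)
      have := calls_rawNode (a := a) (b := b) g (orient d (u :: us))
      rw [e] at this ⊢
      simp
      exact .intro this (by simp [Within])
    · rintro _ ⟨⟩
      exact ⟨_, u, us, rfl, by simpa using hlen, hg.raw, hu, hus⟩

/-- Each level costs `O(b * k)`: the field `add` of the node is pushed down, and the children are
divided among the two parts. -/
theorem calls_cut {k m : ℕ} {z : ℝ} (hk : 1 ≤ k) (ha : 1 ≤ a) (hb : 2 ≤ b) (hm3 : m ≤ 3) :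
    ∀ {h lo : ℕ} {t : Tree}, 1 ≤ lo → W a b k lo h t → Mono m z t.points → ∃ L R : Option Tree,
    Call a b Fn.cut (.pair (.pair (.num m) (.num z)) t.enc) (.pair (encTree? L) (encTree? R))
      (20 * (b * k) * (h + 1)) ∧
    (∀ u ∈ L, Spine a b k true h u) ∧ (∀ u ∈ R, Spine a b k false h u) ∧
    IsCut m z t.points (ptsOf? L) (ptsOf? R) := by
  have hbk : b ≤ b * k := Nat.le_mul_of_pos_right _ hk
  intro h
  induction h with
  | zero =>
    rintro lo t - ht -
    obtain ⟨g, p, rfl, hg⟩ := id ht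
    have htest := calls_test (a := a) (b := b) m z p (.num p.s)
    by_cases hp : Pref m z p
    · refine ⟨some (.leaf g p), none, .of_pre rfl ?_, by rintro _ ⟨⟩; exact ht, by simp, ?_⟩
      · simp
        refine .intro htest ?_
        simp [hp, Within]; omega
      · exact ⟨[], by simp, by simpa using hp, by simp, by simp, by simp⟩
    · by_cases hm : m = 3
      · refine ⟨none, none, .of_pre rfl ?_, by simp, by simp, ?_⟩
        · simp
          refine .intro htest ?_
          subst hm
          simp [hp, Within]; omega
        · exact ⟨(Tree.leaf g p).points, by simp, by simp, by simpa using hp, fun h => absurd hm h,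
            by simp⟩
      · refine ⟨none, some (.leaf g p), .of_pre rfl ?_, by simp, by rintro _ ⟨⟩; exact ht, ?_⟩
        · simp
          refine .intro htest ?_
          have : ¬ 2 < m := by omega
          simp [hp, Within, this]; omega
        · exact ⟨[], by simp, by simp, by simpa using hp, by simp, fun h => absurd h hm⟩
  | succ h ih =>
    rintro lo t hlo ⟨g, ts, rfl, h₁, h₂, hg, hts⟩ hm
    have hf := (augOK_iff.1 hg).1
    have ho := calls_opn (a := a) hk hb (g := g) (ts := ts) h₂ fun t ht => (hts t ht).shape ha ha
    obtain ⟨u, us, e⟩ := List.exists_cons_of_length_pos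
      (hlo.trans (h₁.trans (length_opened g ts).ge))
    have hl : us.length + 1 ≤ b := by
      have := congrArg List.length e
      simp at this; omega
    obtain ⟨Ls, Rs, hc, hL, hR, l₁, l₂, hcut⟩ := calls_cutKids ha
      (fun t ht hm => ih ha ht hm) us u (e ▸ W.opened g hts)
      (by rwa [← e, ptsOf_opened, ← nd_points])
    obtain ⟨L, hL₁, hL₂, hL₃⟩ := hL.calls_spineNode hf (by omega)
    obtain ⟨R, hR₁, hR₂, hR₃⟩ := hR.calls_spineNode hf (by omega)
    refine ⟨L, R, .of_pre rfl ?_, hL₂, hR₂, ?_⟩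
    · simp only [nd_enc, e] at ho
      simp [nd_enc]
      refine .intro ho ?_
      refine .intro hc ?_
      simp
      refine .intro hL₁ ?_
      refine .intro hR₁ ?_
      simp [Within]
      nlinarith
    · rw [hL₃, hR₃, nd_points, ← ptsOf_opened, e]
      exact hcut

/-! ### Splitting and concatenating -/

/-- `AugTree.IsAug` without the conditions on the points. -/
def AugTree.IsAB (a b k : ℕ) : AugTree → Prop
  | .empty => True
  | .root t => ∃ h, W a b k 2 h t

@[simp] theorem AugTree.points_empty : AugTree.empty.points = [] := rfl
@[simp] theorem AugTree.points_root (t : Tree) : (AugTree.root t).points = t.points := rfl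
@[simp] theorem AugTree.enc_empty : AugTree.empty.enc = .nil := rfl
@[simp] theorem AugTree.enc_root (t : Tree) : (AugTree.root t).enc = t.enc := rfl

/-- Bound for the cost of repairing the spine of a tree with `n` points. -/
def opCost (b k n : ℕ) : ℕ := 400 * b * b * (k * lg n)

theorem opCost_mono {k m n : ℕ} (h : m ≤ n) : opCost b k m ≤ opCost b k n := by
  unfold opCost lg
  gcongr

theorem le_opCost {k n : ℕ} (hk : 1 ≤ k) : b * b ≤ opCost b k n := by
  unfold opCost lg
  calc b * b ≤ b * b * (400 * (k * (Nat.log 2 n + 1))) := Nat.le_mul_of_pos_right _ (by positivity)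
    _ = _ := by ring

/-- The trees that result from `cut`, made into correct trees. -/
theorem calls_finish? {k h : ℕ} (hk : 1 ≤ k) (ha : 2 ≤ a) (hab : 2 * a ≤ b + 1) (d : Bool)
    (t : Option Tree) (ht : ∀ u ∈ t, Spine a b k d h u) :
    ∃ T : AugTree, Call a b Fn.finish (.pair (.num k) (.pair (encDir d) (encTree? t))) T.enc
      (fixCost b k h + 1) ∧ T.IsAB a b k ∧ T.points = ptsOf? t := by
  cases t with
  | none => exact ⟨.empty, .of_pre rfl (by simp [Within]), trivial, rfl⟩
  | some t =>
    obtain ⟨h', t', hc, hW, hp⟩ := calls_finish hk ha hab d (ht t rfl)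
    exact ⟨.root t', hc.mono (by omega), ⟨h', hW⟩, hp⟩

theorem calls_split {k m : ℕ} {z : ℝ} (hk : 1 ≤ k) (ha : 2 ≤ a) (hab : 2 * a ≤ b + 1)
    (hm3 : m ≤ 3) {T : AugTree} (hT : T.IsAB a b k) (hm : Mono m z T.points) :
    ∃ T₁ T₂ : AugTree, Call a b Fn.split
        (.pair (.pair (.num m) (.num z)) (.pair (.num k) T.enc)) (.pair T₁.enc T₂.enc)
        (3 * opCost b k T.points.length) ∧
      T₁.IsAB a b k ∧ T₂.IsAB a b k ∧ IsCut m z T.points T₁.points T₂.points := by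
  have hb : 2 ≤ b := by omega
  cases T with
  | empty =>
    refine ⟨.empty, .empty, .of_pre rfl ?_, trivial, trivial, [], by simp, by simp, by simp,
      by simp, by simp⟩
    have : b * b ≤ opCost b k 0 := le_opCost hk
    have : 1 ≤ b * b := by nlinarith
    simp [Within]; omega
  | root t =>
    obtain ⟨h, hW⟩ := hT
    obtain ⟨L, R, hc, hL, hR, hcut⟩ := calls_cut hk (by omega) hb hm3 (by omega) hW hm
    obtain ⟨T₁, h₁, W₁, p₁⟩ := calls_finish? hk ha hab true L hL
    obtain ⟨T₂, h₂, W₂, p₂⟩ := calls_finish? hk ha hab false R hR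
    refine ⟨T₁, T₂, .of_pre rfl ?_, W₁, W₂, by rw [p₁, p₂]; exact hcut⟩
    simp
    refine .intro hc ?_
    simp
    refine .intro h₁ ?_
    refine .intro h₂ ?_
    simp only [Within, true_and]
    have hlg : h + 1 ≤ lg t.points.length := hW.height_lt ha
    have hf := fixCost_le (h := h) hk hb
    have hl : 400 * b * b * (k * (h + 1)) ≤ opCost b k t.points.length := by
      unfold opCost; gcongr
    have : b * k * (h + 1) ≤ b * b * (k * (h + 1)) := by
      calc b * k * (h + 1) ≤ b * (b * k * (h + 1)) := Nat.le_mul_of_pos_left _ (by omega)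
        _ = _ := by ring
    have : 4 ≤ b * b * (k * (h + 1)) :=
      le_trans (show 4 ≤ b * b by nlinarith) (Nat.le_mul_of_pos_right _ (by positivity))
    nlinarith

theorem calls_mulB_pow (h : ℕ) :
    Call a b Fn.mulB (.num ((b : ℝ) ^ h)) (.num ((b : ℝ) ^ (h + 1))) 1 := by
  simpa only [← pow_succ'] using calls_mulB (a := a) (b := b) ((b : ℝ) ^ h)

theorem calls_pow {k : ℕ} : ∀ {h : ℕ} {t : Tree}, Shape b k h t →
    Call a b Fn.pow t.enc (.num ((b : ℝ) ^ h)) (2 * h + 1)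
  | 0, _, ⟨g, p, e, _⟩ => .of_pre rfl (by subst e; simp [Within])
  | h + 1, _, ⟨g, ts, e, h₁, _, _, h₄⟩ => .of_pre rfl (by
      subst e
      obtain ⟨u, us, rfl⟩ := List.exists_cons_of_length_pos h₁
      simp [nd_enc]
      refine .intro (calls_pow (h₄ u (by simp))) ?_
      refine .intro (calls_mulB_pow h) ?_
      simp [Within]; omega)

/-- The augmentation of a node of height `h` with vanishing `add` and empty `top`, if it has
one. -/
noncomputable def flagAug (b k h : ℕ) : Option Aug := if k ≤ b ^ h then some ⟨0, []⟩ else none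

theorem flag_flagAug {k h : ℕ} : Flag b k h (flagAug b k h) := by
  unfold Flag flagAug; split_ifs with h <;> simp [h]

theorem calls_flag {k h : ℕ} :
    Call a b Fn.flag (.pair (.num k) (.num ((b : ℝ) ^ h))) (encAug (flagAug b k h)) 1 :=
  .of_pre rfl (by
    have : ((b : ℝ) ^ h < k) ↔ ¬ k ≤ b ^ h := by rw [not_le]; exact_mod_cast Iff.rfl
    simp [this, flagAug]
    refine .intro (fun h => ?_) (fun h => ?_)
    · simp [if_neg h.not_ge, Within]
    · simp [if_pos (not_lt.1 h), Within])

/-- A tree below nodes with a single child is a tree whose spine needs a repair. -/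
theorem calls_wrap {k : ℕ} (hb : 2 ≤ b) (ha : 1 ≤ a) (d : Bool) : ∀ (n h : ℕ) (t : Tree),
    Spine a b k d h t →
    ∃ t', Call a b Fn.wrap (.pair (.num k) (.pair (.num ((b : ℝ) ^ h))
        (.pair (.num ((b : ℝ) ^ (h + n))) t.enc))) t'.enc ((b + 6) * n + 1) ∧
      Spine a b k d (h + n) t' ∧ t'.points = t.points := by
  intro n
  induction n with
  | zero =>
    intro h t ht
    exact ⟨t, .of_pre rfl (by simp [Within]), ht, rfl⟩
  | succ n ih =>
    intro h t ht
    have e : orient d [t] = [t] := by cases d <;> rfl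
    obtain ⟨t', hc, hS, hp⟩ := ih (h + 1) (nd (raw (flagAug b k (h + 1))) [t])
      ⟨_, t, [], by rw [e], by simp; omega, flag_flagAug.raw, ht, by simp⟩
    refine ⟨t', .of_pre rfl ?_, by rwa [add_assoc, add_comm 1] at hS, by simp [hp]⟩
    have hlt : (b : ℝ) ^ h < (b : ℝ) ^ (h + (n + 1)) := by
      exact_mod_cast Nat.pow_lt_pow_right (by omega) (by omega)
    have hr := calls_rawNode (a := a) (b := b) (flagAug b k (h + 1)) [t]
    rw [show h + 1 + n = h + (n + 1) by omega] at hc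
    simp [hlt]
    refine .intro (calls_mulB_pow h) ?_
    refine .intro (calls_cell (ht.shape ha)) ?_
    refine .intro calls_flag ?_
    refine .intro hr ?_
    refine .intro hc ?_
    simp [Within]; ring_nf; omega

/-- A new root over two trees, the first of which may need a repair of its spine. -/
theorem calls_root {k h : ℕ} (hk : 1 ≤ k) (ha : 2 ≤ a) (hab : 2 * a ≤ b + 1) (d : Bool)
    {u w : Tree} (hu : Spine a b k d h u) (hw : W a b k a h w) :
    ∃ h' t, Call a b Fn.root (.pair (.num k) (.pair (.num ((b : ℝ) ^ h)) (.pair (encDir d)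
        (.pair u.enc w.enc)))) t.enc (fixCost b k (h + 1) + 20 * (b * k)) ∧
      W a b k 2 h' t ∧ t.points = cat d u.points w.points := by
  have hbk : b ≤ b * k := Nat.le_mul_of_pos_right _ hk
  obtain ⟨h', t, hc, hW, hp⟩ := calls_finish (h := h + 1) hk ha hab d
    (t := nd (raw (flagAug b k (h + 1))) (orient d [u, w]))
    ⟨_, u, [w], rfl, by simp; omega, flag_flagAug.raw, hu, by simpa using hw⟩
  refine ⟨h', t, .of_pre rfl ?_, hW, by
    rw [hp, nd_points, ptsOf_orient_cons]; cases d <;> simp [orient]⟩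
  simp
  refine .intro (calls_cell (hu.shape (by omega))) ?_
  refine .intro (calls_cell (hw.shape (by omega) (by omega))) ?_
  refine .intro (calls_orient d [u, w]) ?_
  refine .intro (calls_mulB_pow h) ?_
  refine .intro calls_flag ?_
  refine .intro (calls_rawNode _ _) ?_
  refine .intro hc ?_
  simp [Within]; omega

/-- The concatenation of two trees of the same height, the first of which may need a repair of its
spine. -/
theorem calls_join {k h : ℕ} (hk : 1 ≤ k) (ha : 2 ≤ a) (hab : 2 * a ≤ b + 1) (d : Bool)
    {u w : Tree} (hu : Spine a b k d h u) (hw : W a b k 2 h w) :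
    ∃ h' t, Call a b Fn.join (.pair (.num k) (.pair (.num ((b : ℝ) ^ h)) (.pair (encDir d)
        (.pair u.enc w.enc)))) t.enc (2 * fixCost b k (h + 1)) ∧
      W a b k 2 h' t ∧ t.points = cat d u.points w.points := by
  have hb : 2 ≤ b := by omega
  have ha' : 1 ≤ a := by omega
  have hbk : b ≤ b * k := Nat.le_mul_of_pos_right _ hk
  cases h with
  | zero =>
    obtain ⟨h', t, hc, hW, hp⟩ := calls_root hk ha hab d hu hw
    refine ⟨h', t, .of_pre rfl ?_, hW, hp⟩
    obtain ⟨g, p, rfl, -⟩ := hu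
    simp at hc ⊢
    refine .intro hc ?_
    simp [Within, fixCost]; omega
  | succ h =>
    obtain ⟨gu, u₀, ur, rfl, lu, fu, hu₀, hur⟩ := hu
    obtain ⟨gw, ws, rfl, lw₁, lw₂, fw, hws⟩ := hw
    obtain ⟨ws, rfl⟩ : ∃ ws', ws = orient d ws' := ⟨orient d ws, by simp⟩
    simp only [length_orient, mem_orient] at lw₁ lw₂ hws
    set us := u₀ :: ur with hus
    have hl : us.length = ur.length + 1 := rfl
    have su : ∀ t ∈ us, Shape b k h t := by
      intro t ht
      rcases List.mem_cons.1 ht with rfl | ht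
      · exact hu₀.shape ha'
      · exact (hur t ht).shape ha' ha'
    have sw : ∀ t ∈ ws, Shape b k h t := fun t ht => (hws t ht).shape ha' ha'
    have pJ := ptsOf_joined d gu gw us ws
    have J_cons : joined gu gw us ws = lower gu u₀ :: (opened gu ur ++ opened gw ws) := by
      simp [joined, us]
    have J_tail : ∀ x ∈ opened gu ur ++ opened gw ws, W a b k a h x := by
      intro x hx
      rcases List.mem_append.1 hx with hx | hx
      · exact W.opened _ hur x hx
      · exact W.opened _ hws x hx
    by_cases hn : us.length + ws.length ≤ b
    · have hfuse := calls_fuse_le (a := a) hk hb d (gu := gu) (gw := gw) su sw hn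
      obtain ⟨h', t, hc, hW, hp⟩ := calls_finish (h := h + 1) hk ha hab d
        (t := nd (raw gu) (orient d (joined gu gw us ws)))
        ⟨_, lower gu u₀, opened gu ur ++ opened gw ws, by rw [J_cons], by simp; omega, fu.raw,
          hu₀.lower _, J_tail⟩
      refine ⟨h', t, .of_pre rfl ?_, hW, by rw [hp, nd_points, ← pJ]; simp⟩
      simp only [nd_enc] at hfuse hc
      simp [nd_enc]
      refine .intro hfuse ?_
      simp
      refine .intro hc ?_
      simp [Within, fixCost, add_mul, Finset.sum_range_succ]; omega
    · push Not at hn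
      obtain ⟨f, hf⟩ : ∃ f, f = min (us.length + ws.length - a) b := ⟨_, rfl⟩
      obtain ⟨f, rfl⟩ : ∃ f', f = f' + 1 := ⟨f - 1, by omega⟩
      have J_take : (joined gu gw us ws).take (f + 1) =
          lower gu u₀ :: (opened gu ur ++ opened gw ws).take f := by rw [J_cons]; rfl
      have J_drop : (joined gu gw us ws).drop (f + 1) =
          (opened gu ur ++ opened gw ws).drop f := by rw [J_cons]; rfl
      obtain ⟨gv, hfuse, Wv, hv0⟩ := calls_fuse_gt hk ha' hb hab d su sw (by omega) lw₂ hn fu _ hf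
        (fun t ht => J_tail t (List.mem_of_mem_drop (J_drop ▸ ht)))
      obtain ⟨h', t, hc, hW, hp⟩ := calls_root (h := h + 1) hk ha hab d
        (u := nd (raw gu) (orient d ((joined gu gw us ws).take (f + 1))))
        ⟨_, _, _, by rw [J_take], by simp; omega, fu.raw, hu₀.lower _, fun t ht =>
          J_tail t (List.mem_of_mem_take ht)⟩ Wv
      refine ⟨h', t, .of_pre rfl ?_, hW, ?_⟩
      · simp only [nd_enc] at hfuse hc
        simp [nd_enc]
        refine .intro hfuse ?_
        simp
        refine .intro hc ?_
        simp [Within, fixCost, add_mul, Finset.sum_range_succ]; omega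
      · rw [hp, ← pJ]
        conv_rhs => rw [← List.take_append_drop (f + 1) (joined gu gw us ws)]
        rw [ptsOf_orient_append, nd_points, nd_points, hv0]
        simp

/-- The lower tree is lifted to the height of the higher one by nodes with a single child, which are
removed by the repair of the spine. -/
theorem calls_concat {k : ℕ} (hk : 1 ≤ k) (ha : 2 ≤ a) (hab : 2 * a ≤ b + 1) {T₁ T₂ : AugTree}
    (h₁ : T₁.IsAB a b k) (h₂ : T₂.IsAB a b k) :
    ∃ T : AugTree, Call a b Fn.concat (.pair (.num k) (.pair T₁.enc T₂.enc)) T.enc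
        (5 * opCost b k (max T₁.points.length T₂.points.length)) ∧
      T.IsAB a b k ∧ T.points = T₁.points ++ T₂.points := by
  have hb : 2 ≤ b := by omega
  have ha' : 1 ≤ a := by omega
  cases T₁ with
  | empty =>
    refine ⟨T₂, .of_pre rfl ?_, h₂, rfl⟩
    have : b * b ≤ opCost b k T₂.points.length := le_opCost hk
    have : 1 ≤ b * b := by nlinarith
    simp [Within]; omega
  | root t₁ =>
  cases T₂ with
  | empty =>
    refine ⟨.root t₁, .of_pre rfl ?_, h₁, by simp⟩
    have : b * b ≤ opCost b k t₁.points.length := le_opCost hk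
    have : 1 ≤ b * b := by nlinarith
    simp [Within]; omega
  | root t₂ =>
  obtain ⟨m, hm⟩ := h₁
  obtain ⟨n, hn⟩ := h₂
  have p₁ := calls_pow (a := a) (hm.shape ha' (by omega))
  have p₂ := calls_pow (a := a) (hn.shape ha' (by omega))
  have lm := hm.height_lt ha
  have ln := hn.height_lt ha
  have cost : ∀ N, N + 1 ≤ lg (max t₁.points.length t₂.points.length) →
      2 * fixCost b k (N + 1) + (b + 6) * N + 4 * N + 10 ≤
        5 * opCost b k (max t₁.points.length t₂.points.length) := fun N hN => by
    have h₀ := fixCost_le (h := N + 1) hk hb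
    have h₁ : 400 * b * b * (k * (N + 1)) ≤
        opCost b k (max t₁.points.length t₂.points.length) := by
      unfold opCost; gcongr
    have h₂ : (b * b) * (N + 1) ≤ b * b * (k * (N + 1)) :=
      Nat.mul_le_mul_left _ (Nat.le_mul_of_pos_left _ hk)
    have h₃ : b * (N + 1) ≤ b * b * (N + 1) :=
      Nat.mul_le_mul_right _ (Nat.le_mul_of_pos_left _ (by omega))
    have h₄ : 2 * (N + 1) ≤ b * (N + 1) := Nat.mul_le_mul_right _ hb
    have h₅ : b * b * k ≤ b * b * (k * (N + 1)) :=
      Nat.mul_le_mul_left _ (Nat.le_mul_of_pos_right _ (by omega))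
    nlinarith
  by_cases hlt : m < n
  · obtain ⟨u, hw, hu, pu⟩ := calls_wrap (k := k) hb ha' false (n - m) m t₁
      (hm.spine ha' (by omega))
    rw [Nat.add_sub_cancel' hlt.le] at hw hu
    obtain ⟨h', t, hc, hW, hp⟩ := calls_join hk ha hab false hu hn
    refine ⟨.root t, .of_pre rfl ?_, ⟨h', hW⟩, by simp [hp, pu, cat]⟩
    have : (b : ℝ) ^ m < (b : ℝ) ^ n := by exact_mod_cast Nat.pow_lt_pow_right (by omega) hlt
    simp
    refine .intro p₁ ?_
    refine .intro p₂ ?_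
    simp [this]
    refine .intro hw ?_
    refine .intro hc ?_
    have := cost n (ln.trans (by unfold lg; gcongr; exact le_max_right _ _))
    have : (b + 6) * (n - m) ≤ (b + 6) * n := by gcongr; omega
    simp only [Within, true_and]; omega
  · obtain ⟨u, hw, hu, pu⟩ := calls_wrap (k := k) hb ha' true (m - n) n t₂
      (hn.spine ha' (by omega))
    rw [Nat.add_sub_cancel' (not_lt.1 hlt)] at hw hu
    obtain ⟨h', t, hc, hW, hp⟩ := calls_join hk ha hab true hu hm
    refine ⟨.root t, .of_pre rfl ?_, ⟨h', hW⟩, by simp [hp, pu, cat]⟩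
    have : ¬ (b : ℝ) ^ m < (b : ℝ) ^ n := by
      exact_mod_cast (Nat.pow_le_pow_right (by omega) (not_lt.1 hlt)).not_gt
    simp
    refine .intro p₁ ?_
    refine .intro p₂ ?_
    simp [this]
    refine .intro hw ?_
    refine .intro hc ?_
    have := cost m (lm.trans (by unfold lg; gcongr; exact le_max_left _ _))
    have : (b + 6) * (m - n) ≤ (b + 6) * m := by gcongr; omega
    simp only [Within, true_and]; omega

/-! ### Construction -/

theorem kidsOf_injective : Function.Injective kidsOf
  | [], [], _ => rfl
  | [], _ :: _, h => by simp [kidsOf] at h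
  | _ :: _, [], h => by simp [kidsOf] at h
  | t :: ts, u :: us, h => by
    simp only [kidsOf, Kids.cons.injEq] at h
    rw [h.2.2.1, kidsOf_injective h.2.2.2]

theorem encPts_size : ∀ l : List Pt, (encPts l).size = 6 * l.length + 1
  | [] => rfl
  | p :: l => by simp [encPts, Pt.enc, Val.size, encPts_size l]; ring

theorem encTs_size_append (us : List Tree) : ∀ ts : List Tree,
    (encTs (ts ++ us)).size + 1 = (encTs ts).size + (encTs us).size
  | [] => by simp [Val.size, add_comm]
  | t :: ts => by
    have := encTs_size_append us ts
    simp [Val.size]; omega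

theorem nd_size {k lo h : ℕ} {g : Option Aug} {ts : List Tree} (H : W a b k lo (h + 1) (nd g ts)) :
    (nd g ts).enc.size ≤ (encTs ts).size + 6 +
      6 * (if k ≤ b ^ (h + 1) then min k (ptsOf ts).length else 0) := by
  obtain ⟨g', ts', e, -, -, hg, -⟩ := H
  simp only [nd, Tree.node.injEq] at e
  obtain ⟨rfl, e⟩ := e
  obtain rfl := kidsOf_injective e
  obtain ⟨hf, ht⟩ := augOK_iff.1 hg
  cases g with
  | none => simp [nd_enc, Val.size, encAug]; omega
  | some x =>
    rw [if_pos (hf.1 rfl)]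
    simp [nd_enc, Val.size, encAug, encPts_size, (ht x rfl).1]; omega

/-- Bound for the cost of building `n` nodes of height `h + 1` over `m` points, and for the memory
that they occupy. The factor `B` accounts for the sorting of the points below the lowest nodes that
have an augmentation. -/
def levelCost (b k B h n m : ℕ) : ℕ :=
  20 * b * n + if k ≤ b ^ (h + 1) then if k ≤ b ^ h then 20 * b * (k * n) else 20 * b * (B * m)
    else 0

theorem levelCost_add (k B h n n' m m' : ℕ) :
    levelCost b k B h (n + n') (m + m') = levelCost b k B h n m + levelCost b k B h n' m' := by
  unfold levelCost; split_ifs <;> ring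

theorem mkCost_le_levelCost {k h m : ℕ} (hb : 2 ≤ b) (hk : 1 ≤ k) :
    mkCost b k h m + 3 * b + 10 ≤ levelCost b k (2 * lg k) h 1 m := by
  unfold mkCost levelCost
  split_ifs with h₁ h₂
  · nlinarith [Nat.le_mul_of_pos_right b hk]
  · have : 2 ^ h ≤ k := (Nat.pow_le_pow_left hb h).trans (not_le.1 h₂).le
    have : h + 2 ≤ 2 * lg k := by
      have := Nat.le_log_of_pow_le (by norm_num) this
      unfold lg; omega
    have : 20 * b * ((h + 2) * m) ≤ 20 * b * (2 * lg k * m) := by gcongr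
    nlinarith [Nat.zero_le (b * ((h + 2) * m))]
  · omega

theorem size_le_levelCost {k h m : ℕ} (hb : 2 ≤ b) :
    12 + 6 * (if k ≤ b ^ (h + 1) then min k m else 0) ≤ levelCost b k 1 h 1 m := by
  unfold levelCost
  split_ifs with h₁ h₂
  · have : 20 * b * (k * 1) ≥ 6 * k := by nlinarith
    omega
  · have : 20 * b * (1 * m) ≥ 6 * m := by nlinarith
    omega
  · omega

/-- At most `b` trees get a single node, which has at least `lo` children; otherwise all nodes have
at least `a` children. All nodes but the last two have `b` children, which bounds their number. -/
theorem calls_group {k h lo : ℕ} (hk : 1 ≤ k) (ha : 2 ≤ a) (hab : 2 * a ≤ b + 1)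
    (hlo : lo ≤ a) (hlo' : 1 ≤ lo) {g : Option Aug} (hg : Flag b k (h + 1) g) :
    ∀ (n : ℕ) (ts : List Tree), ts.length = n → 1 ≤ n → lo ≤ n → (∀ t ∈ ts, W a b k a h t) →
    ∃ us, Call a b Fn.group (.pair (.num k) (.pair (encAug g) (.pair (.num n) (encTs ts))))
        (encTs us) (levelCost b k (2 * lg k) h us.length (ptsOf ts).length) ∧
      (∀ u ∈ us, W a b k lo (h + 1) u) ∧ ptsOf us = ptsOf ts ∧ us ≠ [] ∧
      (us.length - 1) * b < n ∧
      (encTs us).size ≤ (encTs ts).size +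
        levelCost b k 1 h us.length (ptsOf ts).length := by
  have hb : 2 ≤ b := by omega
  have ha' : 1 ≤ a := by omega
  intro n
  induction n using Nat.strong_induction_on with
  | _ n ih =>
  intro ts hl hn hlon H
  by_cases hnb : b < n
  · obtain ⟨f, hf⟩ : ∃ f, f = min (n - a) b := ⟨_, rfl⟩
    obtain ⟨g', hc, hW, h0⟩ := calls_mk (lo := lo) (ts := ts.take f) hk ha' hb (by simp; omega)
      (by simp; omega) (by simp; omega) hg (fun t ht => H t (List.mem_of_mem_take ht))
    obtain ⟨us, hu, Wu, pu, nu, lu, su⟩ := ih (n - f) (by omega) (ts.drop f) (by simp; omega)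
      (by omega) (by omega) (fun t ht => H t (List.mem_of_mem_drop ht))
    have hcell := calls_cell (a := a) (hW.shape ha' (by omega))
    have hs := nd_size hW
    have e := List.take_append_drop f ts
    have hp : (ptsOf ts).length = (ptsOf (ts.take f)).length + (ptsOf (ts.drop f)).length := by
      rw [← List.length_append, ← ptsOf_append, e]
    have hsz := encTs_size_append (ts.drop f) (ts.take f)
    rw [e] at hsz
    refine ⟨nd g' (ts.take f) :: us, .of_pre rfl ?_, ?_, ?_, by simp, ?_, ?_⟩
    · have hm := mkCost_le_levelCost (h := h) (m := (ptsOf (ts.take f)).length) hb hk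
      have hc' := calls_chunk (b := b) (show a ≤ n by omega)
      rw [← hf] at hc'
      have hlt : (b : ℝ) < n := by exact_mod_cast hnb
      rw [Nat.cast_sub (by omega)] at hu
      simp [hlt]
      refine .intro hc' ?_
      refine .intro (calls_take _ _ (by omega)) ?_
      refine .intro hc ?_
      refine .intro hcell ?_
      simp
      refine .intro (calls_drop _ _ (by omega)) ?_
      refine .intro hu ?_
      rw [hp, add_comm us.length, levelCost_add]
      simp [Within]; omega
    · intro u hu
      rcases List.mem_cons.1 hu with rfl | hu
      · exact hW
      · exact Wu u hu
    · rw [ptsOf_cons, nd_points, h0, pu, ← e, ptsOf_append]; simp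
    · obtain ⟨v, vs, rfl⟩ := List.exists_cons_of_ne_nil nu
      simp only [List.length_cons, Nat.add_sub_cancel] at lu ⊢
      rcases le_total b (n - a) with h | h
      · rw [add_mul]; omega
      · have : vs.length = 0 := by
          by_contra h'
          have := Nat.le_mul_of_pos_left b (Nat.pos_of_ne_zero h')
          omega
        rw [this]; omega
    · have := size_le_levelCost (k := k) (h := h) (m := (ptsOf (ts.take f)).length) hb
      rw [hp, List.length_cons, add_comm us.length, levelCost_add]
      simp [Val.size]; omega
  · obtain ⟨g', hc, hW, h0⟩ := calls_mk (lo := lo) hk ha' hb (by omega) (by omega)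
      (by omega) hg H
    have hs := nd_size hW
    refine ⟨[nd g' ts], .of_pre rfl ?_, by simpa using hW, by simp [h0], by simp,
      by simp; omega, ?_⟩
    · have hm := mkCost_le_levelCost (h := h) (m := (ptsOf ts).length) hb hk
      have hlt : ¬ (b : ℝ) < n := by exact_mod_cast hnb
      simp [hlt]
      refine .intro hc ?_
      refine .intro (calls_cell (hW.shape ha' (by omega))) ?_
      simp [Within]; omega
    · have := size_le_levelCost (k := k) (h := h) (m := (ptsOf ts).length) hb
      simp [Val.size]; omega

/-- Bound for the cost of building a tree over `m` points from `n` trees of height `h`, and for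
the memory that its new nodes occupy. -/
def totalCost (b k B h n m : ℕ) : ℕ :=
  if k ≤ b ^ h then 48 * b * (k * (n - 1)) + 1 else 48 * b * (n + m) + 20 * b * (B * m) + 1

/-- The number of nodes decreases at least by a factor of two from one height to the next. Since
there are `O(m / k)` nodes of the lowest height with an augmentation (or only one node), the nodes
above cost `O(m)`. -/
theorem levelCost_add_totalCost_le {k B h n n' m : ℕ} (hk : 1 ≤ k) (hb : 3 ≤ b) (hn : 2 ≤ n)
    (hn' : 1 ≤ n') (h₁ : (n' - 1) * b < n) (h₂ : (n' - 1) * b ^ (h + 1) < m) :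
    levelCost b k B h n' m + totalCost b k B (h + 1) n' m + n + 5 ≤ totalCost b k B h n m := by
  obtain ⟨n', rfl⟩ : ∃ c, n' = c + 1 := ⟨n' - 1, by omega⟩
  obtain ⟨n, rfl⟩ : ∃ c, n = c + 2 := ⟨n - 2, by omega⟩
  simp only [Nat.add_sub_cancel] at h₁ h₂
  have h₃ : n' * 3 ≤ n' * b := by gcongr
  -- the shifted variables turn this into `2 * n' ≤ n` for the original numbers of nodes
  have h₄ : 2 * n' ≤ n := by omega
  unfold levelCost totalCost
  have hm : b ^ h ≤ b ^ (h + 1) := Nat.pow_le_pow_right (by omega) (by omega)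
  have h₅ : b * (2 * n') ≤ b * n := by gcongr
  by_cases hk₁ : k ≤ b ^ h
  · rw [if_pos hk₁, if_pos (hk₁.trans hm), if_pos (hk₁.trans hm), if_pos hk₁]
    simp only [Nat.add_sub_cancel, show n + 2 - 1 = n + 1 by omega]
    have h₆ : b * n ≤ b * (k * n) := by gcongr; exact Nat.le_mul_of_pos_left _ hk
    have h₇ : b * (k * (2 * n')) ≤ b * (k * n) := by gcongr
    have h₈ : b ≤ b * k := Nat.le_mul_of_pos_right _ hk
    have h₉ : 3 * n ≤ b * n := by gcongr
    nlinarith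
  · rw [if_neg hk₁, if_neg hk₁]
    have h₉ : 3 * n ≤ b * n := by gcongr
    split_ifs with hk₂
    · simp only [Nat.add_sub_cancel]
      -- each of the new nodes but one accounts for `b ^ (h + 1) ≥ k` points
      have h₆ : k * n' ≤ m := by
        rw [mul_comm]; exact (Nat.mul_le_mul_left _ hk₂).trans h₂.le
      have h₇ : b * (k * n') ≤ b * m := by gcongr
      nlinarith
    · nlinarith

/-- Both the number of calls and the memory are estimated by `totalCost`, with `B = 2 * lg k` and
`B = 1`. The last hypothesis bounds the number of trees in terms of the number of points. -/
theorem calls_buildUp {k : ℕ} (hk : 1 ≤ k) (ha : 2 ≤ a) (hab : 2 * a ≤ b + 1) :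
    ∀ (n h : ℕ) (ts : List Tree), ts.length = n → 1 ≤ n →
    (∀ t ∈ ts, W a b k (if n = 1 then 2 else a) h t) →
    (n - 1) * b ^ h < (ptsOf ts).length →
    ∃ h' T, Call a b Fn.buildUp (.pair (.num k) (.pair (.num ((b : ℝ) ^ h)) (encTs ts))) T.enc
        (totalCost b k (2 * lg k) h n (ptsOf ts).length) ∧
      W a b k 2 h' T ∧ T.points = ptsOf ts ∧
      T.enc.size ≤ (encTs ts).size + totalCost b k 1 h n (ptsOf ts).length := by
  intro n
  induction n using Nat.strong_induction_on with
  | _ n ih =>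
  intro h ts hl hn H hm
  by_cases h1 : n = 1
  · subst h1
    obtain ⟨t, rfl⟩ := List.length_eq_one_iff.1 hl
    refine ⟨h, t, .of_pre rfl ?_, by simpa using H, by simp, ?_⟩
    · simp [Within, totalCost]; split_ifs <;> omega
    · simp [Val.size]; omega
  · obtain ⟨us, hc, Wu, pu, nu, lu, su⟩ := calls_group (lo := min a n) hk ha hab (by omega)
      (by omega) flag_flagAug n ts hl hn (by omega) (fun t ht => by simpa [h1] using H t ht)
    have hus : 1 ≤ us.length := List.length_pos_iff.2 nu
    have hlu : (us.length - 1) * 3 ≤ (us.length - 1) * b := by gcongr; omega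
    have hm' : (us.length - 1) * b ^ (h + 1) < (ptsOf ts).length := by
      refine lt_of_le_of_lt ?_ hm
      rw [pow_succ', ← mul_assoc]
      gcongr; omega
    have cost := fun B => levelCost_add_totalCost_le (B := B) hk (by omega) (show 2 ≤ n by omega)
      hus lu hm'
    obtain ⟨h', T, hT, WT, pT, sT⟩ := ih us.length (by omega) (h + 1) us rfl hus (fun u hu => by
        refine (Wu u hu).mono ?_
        split_ifs with h2
        · omega
        · have := Nat.le_mul_of_pos_left b (show 0 < us.length - 1 by omega)
          omega) (by rwa [pu])
    rw [pu] at hT pT sT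
    refine ⟨h', T, .of_pre rfl ?_, WT, pT, ?_⟩
    · obtain ⟨t, u, ts', rfl⟩ : ∃ t u ts', ts = t :: u :: ts' := by
        match ts, hl with
        | [], hl => simp at hl; omega
        | [_], hl => simp at hl; omega
        | t :: u :: ts', _ => exact ⟨t, u, ts', rfl⟩
      have hlen := calls_len (a := a) (b := b) (t :: u :: ts')
      rw [hl] at hlen
      have := cost (2 * lg k)
      simp only [encTs, encCell] at hc hlen
      simp
      refine .intro (calls_mulB_pow h) ?_
      refine .intro calls_flag ?_
      refine .intro hlen ?_
      refine .intro hc ?_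
      refine .intro hT ?_
      simp [Within] at this ⊢; omega
    · have := cost 1
      omega

theorem calls_leaf {k : ℕ} (hk₁ : 1 ≤ k) (p : Pt) :
    ∃ t, Call a b Fn.leaf (.pair (.num k) p.enc) t.enc 1 ∧ W a b k 2 0 t ∧ t.points = [p] ∧
      t.enc.size ≤ 17 := by
  by_cases hk : 1 < k
  · have hk' : (1 : ℝ) < k := by exact_mod_cast hk
    refine ⟨.leaf none p, .of_pre rfl (by simp [hk', Within]), ⟨none, p, rfl, ?_⟩, by simp [addOf],
      by simp [Tree.enc, encAug, Pt.enc, Val.size]⟩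
    exact augOK_iff.2 ⟨by simp [Flag]; omega, by simp⟩
  · have hk' : ¬ (1 : ℝ) < k := by exact_mod_cast hk
    refine ⟨.leaf (some ⟨0, [p]⟩) p, .of_pre rfl (by simp [hk', Within]), ⟨_, p, rfl, ?_⟩,
      by simp [addOf], by simp [Tree.enc, encAug, encPts, Pt.enc, Val.size]⟩
    exact augOK_iff.2 ⟨by simp [Flag]; omega, by
      rintro _ ⟨⟩; exact isTop_singleton hk₁ p⟩

theorem calls_leaves {k : ℕ} (hk : 1 ≤ k) (ha : 1 ≤ a) : ∀ l : List Pt,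
    ∃ ts, Call a b Fn.leaves (.pair (.num k) (encPts l)) (encTs ts) ((b + 3) * l.length + 1) ∧
      (∀ t ∈ ts, W a b k 2 0 t) ∧ ptsOf ts = l ∧ ts.length = l.length ∧
      (encTs ts).size ≤ 22 * l.length + 1
  | [] => ⟨[], .of_pre rfl (by simp [encPts, Within]), by simp, rfl, rfl, by simp [Val.size]⟩
  | p :: l => by
    obtain ⟨t, ht, Wt, pt, st⟩ := calls_leaf (a := a) (b := b) hk p
    obtain ⟨ts, hts, Wts, pts, lts, sts⟩ := calls_leaves hk ha l
    refine ⟨t :: ts, .of_pre rfl ?_, by simp; exact ⟨Wt, Wts⟩, by simp [pt, pts], by simp [lts], ?_⟩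
    · simp [encPts]
      refine .intro ht ?_
      refine .intro (calls_cell (Wt.shape ha (by omega))) ?_
      refine .intro hts ?_
      simp [Within, add_mul, mul_add]; omega
    · simp [Val.size]; omega

/-- Construction takes time `O(m log k)` and memory `O(m)`. -/
theorem calls_build {k : ℕ} (hk : 1 ≤ k) (ha : 2 ≤ a) (hab : 2 * a ≤ b + 1) (l : List Pt) :
    ∃ T : AugTree, Call a b Fn.build (.pair (.num k) (encPts l)) T.enc
        (400 * b * ((l.length + 1) * lg k)) ∧ T.IsAB a b k ∧ T.points = l ∧
      T.enc.size ≤ 400 * b * (l.length + 1) := by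
  have hlg : 1 ≤ lg k := by unfold lg; omega
  cases l with
  | nil =>
    refine ⟨.empty, .of_pre rfl ?_, trivial, rfl, ?_⟩
    · have : 1 * 1 ≤ 400 * b * lg k := Nat.mul_le_mul (by omega) hlg
      simp [encPts, Within]; omega
    · simp [Val.size]; omega
  | cons p l =>
    obtain ⟨ts, hts, Wts, pts, lts, sts⟩ := calls_leaves (a := a) (b := b) hk (by omega) (p :: l)
    set m := (p :: l).length with hm
    have hm1 : m = l.length + 1 := rfl
    have total : ∀ B, 1 ≤ B → totalCost b k B 0 m m ≤ 120 * b * (m * B) + 1 := fun B hB => by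
      have h₁ : m ≤ m * B := Nat.le_mul_of_pos_right _ hB
      have h₂ : b * m ≤ b * (m * B) := by gcongr
      unfold totalCost
      split_ifs with h
      · obtain rfl : k = 1 := by simp at h; omega
        have : 48 * b * (1 * (m - 1)) ≤ 48 * b * m := by gcongr; omega
        nlinarith
      · nlinarith
    obtain ⟨h', T, hT, WT, pT, sT⟩ := calls_buildUp hk ha hab m 0 ts lts (by omega)
      (fun t ht => Wts t ht) (by rw [pts, pow_zero]; omega)
    rw [pts] at hT pT sT
    rw [← hm] at hT sT
    have hbm : 2 * m ≤ b * m := by gcongr; omega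
    refine ⟨.root T, .of_pre rfl ?_, ⟨h', WT⟩, pT, ?_⟩
    · have h₁ := total (2 * lg k) (by omega)
      have h₂ : b * m ≤ b * (m * lg k) := by gcongr; exact Nat.le_mul_of_pos_right _ hlg
      rw [pow_zero] at hT
      simp only [encPts] at hts
      simp [encPts]
      refine .intro hts ?_
      refine .intro hT ?_
      simp only [Within, true_and]
      have h₃ : 2 ≤ b * m := by nlinarith
      have h₄ : b ≤ b * lg k := Nat.le_mul_of_pos_right _ hlg
      nlinarith
    · have h₁ := total 1 le_rfl
      simp only [AugTree.enc_root]
      nlinarith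

/-! ### Augmented trees over layers -/

theorem Kids.WF.eq_kidsOf {k h : ℕ} (H : ∀ t : Tree, t.WF a b k a h → W a b k a h t) :
    ∀ cs : Kids, cs.WF a b k h → ∃ ts, cs = kidsOf ts ∧ ∀ t ∈ ts, W a b k a h t
  | .nil, _ => ⟨[], rfl, by simp⟩
  | .cons xk yk t cs, hcs => by
    obtain ⟨⟨q, hq, rfl, rfl⟩, ht, hcs⟩ := by simpa only [Kids.WF] using hcs
    obtain ⟨ts, rfl, hts⟩ := Kids.WF.eq_kidsOf H cs hcs
    exact ⟨t :: ts, by simp [kidsOf, Tree.key, hq], by simpa using ⟨H t ht, hts⟩⟩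

/-- The representative keys of well-formed children are those that `kidsOf` provides. -/
theorem Tree.WF.w {k : ℕ} : ∀ {h lo : ℕ} {t : Tree}, t.WF a b k lo h → W a b k lo h t
  | 0, lo, .leaf g p, ht => by
    simp only [Tree.WF, true_and] at ht
    exact ⟨g, p, rfl, ht⟩
  | h + 1, lo, .leaf g p, ht => by simp [Tree.WF] at ht
  | 0, lo, .node g cs, ht => by simp [Tree.WF] at ht
  | h + 1, lo, .node g cs, ht => by
    obtain ⟨h', e, h₁, h₂, h₃, h₄⟩ := by simpa only [Tree.WF] using ht
    obtain rfl : h = h' := by omega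
    obtain ⟨ts, rfl, hts⟩ := Kids.WF.eq_kidsOf (fun t ht => Tree.WF.w ht) cs h₄
    rw [kidsOf_length] at h₁ h₂
    rw [kidsOf_points] at h₃
    exact ⟨g, ts, rfl, h₁, h₂, h₃, hts⟩

theorem kidsOf_wf {k h : ℕ} : ∀ ts : List Tree, (∀ t ∈ ts, t.points ≠ [] ∧ t.WF a b k a h) →
    (kidsOf ts).WF a b k h
  | [], _ => by simp [kidsOf, Kids.WF]
  | t :: ts, H => by
    obtain ⟨hne, ht⟩ := H t (by simp)
    simp only [kidsOf, Kids.WF]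
    refine ⟨⟨t.key, ?_, rfl, rfl⟩, ht, kidsOf_wf ts fun u hu => H u (by simp [hu])⟩
    rw [← Tree.points_key hne, List.getLast?_eq_getLast_of_ne_nil]

theorem W.wf {k : ℕ} (ha : 1 ≤ a) : ∀ {h lo : ℕ} {t : Tree}, W a b k lo h t → t.WF a b k lo h
  | 0, _, _, ⟨g, p, e, hg⟩ => by subst e; simpa [Tree.WF] using hg
  | h + 1, lo, _, ⟨g, ts, e, h₁, h₂, h₃, h₄⟩ => by
    subst e
    simp only [nd, Tree.WF]
    exact ⟨h, rfl, by rwa [kidsOf_length], by rwa [kidsOf_length], by rwa [kidsOf_points],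
      kidsOf_wf ts fun t ht => ⟨((h₄ t ht).shape ha ha).points_ne_nil, (h₄ t ht).wf ha⟩⟩

theorem AugTree.isAug_iff {k : ℕ} (ha : 1 ≤ a) {T : AugTree} :
    T.IsAug a b k ↔ SortedX T.points ∧ IsLayer T.points ∧ T.IsAB a b k := by
  cases T with
  | empty => rfl
  | root t =>
    exact and_congr_right' (and_congr_right' (exists_congr fun h =>
      ⟨Tree.WF.w, W.wf ha⟩))

/-- On a layer, every query describes an initial segment. -/
theorem mono_of_layer {l : List Pt} (h₁ : SortedX l) (h₂ : IsLayer l) (m : ℕ) (z : ℝ) :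
    Mono m z l := by
  refine (h₁.and h₂).imp fun {p q} ⟨hx, hd, _⟩ => ?_
  have hy : q.y ≤ p.y := not_lt.1 fun h => hd (.inl ⟨hx, h⟩)
  unfold Pref
  split_ifs
  · exact hx.trans
  · exact fun h => h.trans_le hy
  · exact hx.trans_lt

theorem IsCut.append_eq {m : ℕ} {z : ℝ} {l L R : List Pt} (h : IsCut m z l L R) (hm : m ≠ 3) :
    l = L ++ R := by
  obtain ⟨mid, rfl, -, -, h, -⟩ := h
  simp [h hm]

theorem IsCut.filter_eq {m : ℕ} {z : ℝ} {l L R : List Pt} (h : IsCut m z l L R) (hm : m ≠ 3)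
    (f g : Pt → Bool) (hf : ∀ p, f p = true ↔ Pref m z p) (hg : ∀ p, g p = true ↔ ¬ Pref m z p) :
    l.filter f = L ∧ l.filter g = R := by
  obtain ⟨mid, rfl, h₁, h₂, h, -⟩ := h
  obtain rfl := h hm
  simp only [List.append_nil, List.nil_append, List.filter_append] at h₂ ⊢
  rw [List.filter_eq_self.2 fun p hp => (hf p).2 (h₁ p hp),
    List.filter_eq_self.2 fun p hp => (hg p).2 (h₂ p hp),
    List.filter_eq_nil_iff.2 fun p hp => by rw [hf]; exact h₂ p hp,
    List.filter_eq_nil_iff.2 fun p hp => by rw [hg]; exact not_not.2 (h₁ p hp)]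
  simp

theorem lg_succ_le (n : ℕ) : lg (n + 1) ≤ 2 * lg n := by
  unfold lg
  rcases Nat.eq_zero_or_pos n with rfl | hn
  · simp
  · have : Nat.log 2 (n + 1) ≤ Nat.log 2 (n * 2) := Nat.log_mono_right (by omega)
    rw [Nat.log_mul_base (by norm_num) (by omega)] at this
    omega

theorem opCost_succ_le (k n : ℕ) : opCost b k (n + 1) ≤ 2 * opCost b k n := by
  have := lg_succ_le n
  unfold opCost
  calc 400 * b * b * (k * lg (n + 1)) ≤ 400 * b * b * (k * (2 * lg n)) := by gcongr
    _ = _ := by ring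

/-! ### The operations -/

theorem calls_searchX {k : ℕ} (ha : 2 ≤ a) (v : Val) {T : AugTree} (hT : T.IsAug a b k) (p : Pt) :
    Call a b Fn.searchX (.pair v (.pair T.enc p.enc)) (encOptPt (locateX T.points p.x))
      ((2 * b + 3) * lg T.points.length + 1) := by
  obtain ⟨h₁, h₂, h₃⟩ := (AugTree.isAug_iff (by omega)).1 hT
  cases T with
  | empty => exact .of_pre rfl (by simp [Within, locateX, encOptPt])
  | root t =>
    obtain ⟨h, hW⟩ := h₃
    obtain ⟨q, hc, hq⟩ := calls_search (a := a) (hW.shape (by omega) (by omega))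
      (mono_of_layer h₁ h₂ 2 p.x)
    have e : locateX t.points p.x = some q := by
      rw [← hq]; simp [locateX, locate, Pref]
    have : (2 * b + 3) * (h + 1) ≤ (2 * b + 3) * lg t.points.length :=
      Nat.mul_le_mul_left _ (hW.height_lt ha)
    simp only [Nat.cast_ofNat] at hc
    exact .of_pre rfl (by
      simp
      refine .intro hc ?_
      simp [Within, e, encOptPt]; omega)

theorem calls_searchY {k : ℕ} (ha : 2 ≤ a) (v : Val) {T : AugTree} (hT : T.IsAug a b k) (p : Pt) :
    Call a b Fn.searchY (.pair v (.pair T.enc p.enc)) (encOptPt (locateY T.points p.y))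
      ((2 * b + 3) * lg T.points.length + 1) := by
  obtain ⟨h₁, h₂, h₃⟩ := (AugTree.isAug_iff (by omega)).1 hT
  cases T with
  | empty => exact .of_pre rfl (by simp [Within, locateY, encOptPt])
  | root t =>
    obtain ⟨h, hW⟩ := h₃
    obtain ⟨q, hc, hq⟩ := calls_search (a := a) (hW.shape (by omega) (by omega))
      (mono_of_layer h₁ h₂ 1 p.y)
    have e : locateY t.points p.y = some q := by
      rw [← hq]; simp [locateY, locate, Pref]
    have : (2 * b + 3) * (h + 1) ≤ (2 * b + 3) * lg t.points.length :=
      Nat.mul_le_mul_left _ (hW.height_lt ha)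
    simp only [Nat.cast_one] at hc
    exact .of_pre rfl (by
      simp
      refine .intro hc ?_
      simp [Within, e, encOptPt]; omega)

theorem calls_splitX {k : ℕ} (hk : 1 ≤ k) (ha : 2 ≤ a) (hab : 2 * a ≤ b + 1) {T : AugTree}
    (hT : T.IsAug a b k) (z : ℝ) :
    ∃ T₂ T₃ : AugTree, Call a b Fn.splitX (.pair (.num k) (.pair T.enc (.num z)))
        (.pair T₂.enc T₃.enc) (3 * opCost b k T.points.length + 1) ∧
      T₂.IsAug a b k ∧ T₃.IsAug a b k ∧
      T₂.points = T.points.filter (fun q => decide (q.x ≤ z)) ∧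
      T₃.points = T.points.filter (fun q => decide (z < q.x)) := by
  have ha' : 1 ≤ a := by omega
  obtain ⟨h₁, h₂, h₃⟩ := (AugTree.isAug_iff ha').1 hT
  obtain ⟨T₂, T₃, hc, W₂, W₃, hcut⟩ := calls_split hk ha hab (by omega) h₃
    (mono_of_layer h₁ h₂ 0 z)
  obtain ⟨e₂, e₃⟩ := hcut.filter_eq (by omega) (fun q => decide (q.x ≤ z))
    (fun q => decide (z < q.x)) (by simp [Pref]) (by simp [Pref])
  simp only [Nat.cast_zero] at hc
  refine ⟨T₂, T₃, .of_pre rfl ?_, (AugTree.isAug_iff ha').2 ⟨?_, ?_, W₂⟩,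
    (AugTree.isAug_iff ha').2 ⟨?_, ?_, W₃⟩, e₂.symm, e₃.symm⟩
  · simp
    refine .intro hc ?_
    simp [Within]; omega
  · exact e₂ ▸ h₁.filter _
  · exact e₂ ▸ h₂.filter _
  · exact e₃ ▸ h₁.filter _
  · exact e₃ ▸ h₂.filter _

theorem calls_splitY {k : ℕ} (hk : 1 ≤ k) (ha : 2 ≤ a) (hab : 2 * a ≤ b + 1) {T : AugTree}
    (hT : T.IsAug a b k) (z : ℝ) :
    ∃ T₂ T₃ : AugTree, Call a b Fn.splitY (.pair (.num k) (.pair T.enc (.num z)))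
        (.pair T₂.enc T₃.enc) (3 * opCost b k T.points.length + 1) ∧
      T₂.IsAug a b k ∧ T₃.IsAug a b k ∧
      T₂.points = T.points.filter (fun q => decide (q.y ≤ z)) ∧
      T₃.points = T.points.filter (fun q => decide (z < q.y)) := by
  have ha' : 1 ≤ a := by omega
  obtain ⟨h₁, h₂, h₃⟩ := (AugTree.isAug_iff ha').1 hT
  -- the points with large second coordinate come first
  obtain ⟨T₃, T₂, hc, W₃, W₂, hcut⟩ := calls_split hk ha hab (by omega) h₃
    (mono_of_layer h₁ h₂ 1 z)
  obtain ⟨e₃, e₂⟩ := hcut.filter_eq (by omega) (fun q => decide (z < q.y))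
    (fun q => decide (q.y ≤ z)) (by simp [Pref]) (by simp [Pref])
  simp only [Nat.cast_one] at hc
  refine ⟨T₂, T₃, .of_pre rfl ?_, (AugTree.isAug_iff ha').2 ⟨?_, ?_, W₂⟩,
    (AugTree.isAug_iff ha').2 ⟨?_, ?_, W₃⟩, e₂.symm, e₃.symm⟩
  · simp
    refine .intro hc ?_
    simp [Within]; omega
  · exact e₂ ▸ h₁.filter _
  · exact e₂ ▸ h₂.filter _
  · exact e₃ ▸ h₁.filter _
  · exact e₃ ▸ h₂.filter _

theorem IsLayer.perm {l l' : List Pt} (h : l.Perm l') (hl : IsLayer l) : IsLayer l' :=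
  (h.pairwise_iff fun {_ _} h => And.symm h).1 hl

theorem calls_insert {k : ℕ} (hk : 1 ≤ k) (ha : 2 ≤ a) (hab : 2 * a ≤ b + 1) {T : AugTree}
    (hT : T.IsAug a b k) (p : Pt) (hp : IsLayer (p :: T.points)) :
    ∃ T' : AugTree, Call a b Fn.insert (.pair (.num k) (.pair T.enc p.enc)) T'.enc
        (25 * opCost b k T.points.length) ∧
      T'.IsAug a b k ∧ T'.points.Perm (p :: T.points) := by
  have ha' : 1 ≤ a := by omega
  obtain ⟨h₁, h₂, h₃⟩ := (AugTree.isAug_iff ha').1 hT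
  obtain ⟨L, R, hc, WL, WR, hcut⟩ := calls_split hk ha hab (by omega) h₃
    (mono_of_layer h₁ h₂ 0 p.x)
  obtain ⟨t, ht, Wt, pt, -⟩ := calls_leaf (a := a) (b := b) hk p
  obtain ⟨U, hU, WU, pU⟩ := calls_concat hk ha hab WL (T₂ := .root t) ⟨0, Wt⟩
  obtain ⟨V, hV, WV, pV⟩ := calls_concat hk ha hab WU WR
  rw [AugTree.points_root, pt] at pU hU
  rw [pU] at pV hV
  have e := hcut.append_eq (by omega)
  have hl : T.points.length = L.points.length + R.points.length := by
    rw [e, List.length_append]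
  have perm : V.points.Perm (p :: T.points) := by
    rw [pV, e, List.append_assoc]; exact List.perm_middle
  refine ⟨V, .of_pre rfl ?_, (AugTree.isAug_iff ha').2 ⟨?_, hp.perm perm.symm, WV⟩, perm⟩
  · have c₁ : opCost b k (max L.points.length [p].length) ≤ opCost b k (T.points.length + 1) :=
      opCost_mono (by simp; omega)
    have c₂ : opCost b k (max (L.points ++ [p]).length R.points.length) ≤
        opCost b k (T.points.length + 1) := opCost_mono (by simp; omega)
    have c₃ := opCost_succ_le (b := b) k T.points.length
    have c₄ := le_opCost (b := b) (n := T.points.length) hk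
    have c₅ : 2 ≤ b * b := by nlinarith
    simp only [Nat.cast_zero] at hc
    simp only [Pt.enc] at ht
    simp
    refine .intro hc ?_
    simp
    refine .intro ht ?_
    refine .intro hU ?_
    refine .intro hV ?_
    simp only [Within, true_and]; omega
  · obtain ⟨mid, -, hL, hR, -, -⟩ := hcut
    rw [e] at h₁
    obtain ⟨s₁, s₂, s₃⟩ := List.pairwise_append.1 h₁
    rw [pV, List.append_assoc]
    refine List.pairwise_append.2 ⟨s₁, List.pairwise_cons.2 ⟨fun q hq => ?_, s₂⟩,
      fun q hq r hr => ?_⟩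
    · have := hR q (List.mem_append_right _ hq)
      exact (not_le.1 (by simpa [Pref] using this)).le
    · rcases List.mem_cons.1 hr with rfl | hr
      · simpa [Pref] using hL q hq
      · exact s₃ q hq r hr

theorem calls_delete {k : ℕ} (hk : 1 ≤ k) (ha : 2 ≤ a) (hab : 2 * a ≤ b + 1) {T : AugTree}
    (hT : T.IsAug a b k) (p : Pt) (hp : ∃ q ∈ T.points, q.x = p.x ∧ q.y = p.y) :
    ∃ T' : AugTree, Call a b Fn.delete (.pair (.num k) (.pair T.enc p.enc)) T'.enc
        (9 * opCost b k T.points.length) ∧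
      T'.IsAug a b k ∧ ∃ q, q.x = p.x ∧ q.y = p.y ∧ T.points.Perm (q :: T'.points) := by
  have ha' : 1 ≤ a := by omega
  obtain ⟨h₁, h₂, h₃⟩ := (AugTree.isAug_iff ha').1 hT
  obtain ⟨L, R, hc, WL, WR, mid, e, hL, hR, -, hmid⟩ := calls_split hk ha hab le_rfl h₃
    (mono_of_layer h₁ h₂ 3 p.x)
  obtain ⟨V, hV, WV, pV⟩ := calls_concat hk ha hab WL WR
  obtain ⟨q, hq, hqx, hqy⟩ := hp
  have hqL : q ∉ L.points := fun h => by simpa [Pref, hqx] using hL q h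
  obtain ⟨r, rfl⟩ : ∃ r, mid = [r] := by
    rcases hmid rfl with h | ⟨rfl, hnil⟩
    · exact h
    · rw [e, hnil] at hq; simp [hqL] at hq
  have hqr : q ∈ r :: R.points := by
    rw [e] at hq; simpa [hqL] using hq
  have perm : T.points.Perm (r :: V.points) := by
    rw [e, pV, List.append_assoc]; exact List.perm_middle
  have hsub : V.points.Sublist T.points := by
    rw [e, pV, List.append_assoc]
    exact (List.sublist_cons_self r R.points).append_left L.points
  have hrx : p.x ≤ r.x := by simpa [Pref] using hR r (by simp)
  -- `r` is the first point that is not to the left of `q`, hence it has the coordinates of `q`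
  have hr : r.x = q.x ∧ r.y = q.y := by
    rcases List.mem_cons.1 hqr with rfl | hq'
    · exact ⟨rfl, rfl⟩
    · have hrest : (r :: R.points).Sublist T.points := by
        rw [e, List.append_assoc]; exact List.sublist_append_right _ _
      have hx := List.rel_of_pairwise_cons (h₁.sublist hrest) hq'
      obtain ⟨d₁, d₂⟩ := List.rel_of_pairwise_cons (h₂.sublist hrest) hq'
      have hx' : r.x = q.x := le_antisymm hx (hqx ▸ hrx)
      exact ⟨hx', le_antisymm (not_lt.1 fun h => d₂ (.inl ⟨hx'.ge, h⟩))
        (not_lt.1 fun h => d₁ (.inl ⟨hx, h⟩))⟩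
  refine ⟨V, .of_pre rfl ?_, (AugTree.isAug_iff ha').2 ⟨h₁.sublist hsub, h₂.sublist hsub, WV⟩, r,
    hr.1.trans hqx, hr.2.trans hqy, perm⟩
  have hl := congrArg List.length e
  simp only [List.length_append] at hl
  have c₁ : opCost b k (max L.points.length R.points.length) ≤ opCost b k T.points.length :=
    opCost_mono (by omega)
  have c₄ := le_opCost (b := b) (n := T.points.length) hk
  have c₅ : 1 ≤ b * b := by nlinarith
  simp only [Nat.cast_ofNat] at hc
  simp
  refine .intro hc ?_
  simp
  refine .intro hV ?_
  simp only [Within, true_and]; omega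

end AugAB

theorem mainTheorem3 (a b : ℕ) (ha : 2 ≤ a) (hb : 2 * a ≤ b + 1) :
    ∃ (P : Program) (build searchX searchY insert delete splitX splitY concat C : ℕ),
      ∀ k : ℕ, 1 ≤ k →
        -- construction: time `O(m log k)`, and the tree occupies `O(m)` memory
        (∀ pts : List Pt, SortedX pts → IsLayer pts →
          ∃ (T : AugTree) (t : ℕ),
            Runs P build (.pair (.num k) (encPts pts)) T.enc t ∧
            T.IsAug a b k ∧ T.points = pts ∧
            t ≤ C * ((pts.length + 1) * lg k) ∧
            T.enc.size ≤ C * (pts.length + 1)) ∧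
        -- search in either dimension: time `O(log m)`
        (∀ (T : AugTree) (p : Pt), T.IsAug a b k →
          (∃ t, Runs P searchX (.pair (.num k) (.pair T.enc p.enc))
              (encOptPt (locateX T.points p.x)) t ∧ t ≤ C * lg T.points.length) ∧
          (∃ t, Runs P searchY (.pair (.num k) (.pair T.enc p.enc))
              (encOptPt (locateY T.points p.y)) t ∧ t ≤ C * lg T.points.length)) ∧
        -- insertion of a point: time `O(k log m)`
        (∀ (T : AugTree) (p : Pt), T.IsAug a b k → IsLayer (p :: T.points) →
          ∃ (T' : AugTree) (t : ℕ),
            Runs P insert (.pair (.num k) (.pair T.enc p.enc)) T'.enc t ∧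
            T'.IsAug a b k ∧ T'.points.Perm (p :: T.points) ∧
            t ≤ C * (k * lg T.points.length)) ∧
        -- deletion of a point of the tree: time `O(k log m)`
        (∀ (T : AugTree) (p : Pt), T.IsAug a b k →
          (∃ q ∈ T.points, q.x = p.x ∧ q.y = p.y) →
          ∃ (T' : AugTree) (t : ℕ),
            Runs P delete (.pair (.num k) (.pair T.enc p.enc)) T'.enc t ∧
            T'.IsAug a b k ∧
            (∃ q, q.x = p.x ∧ q.y = p.y ∧ T.points.Perm (q :: T'.points)) ∧
            t ≤ C * (k * lg T.points.length)) ∧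
        -- split at a value of either dimension: time `O(k log m)`
        (∀ (T : AugTree) (val : ℝ), T.IsAug a b k →
          (∃ (T₂ T₃ : AugTree) (t : ℕ),
            Runs P splitX (.pair (.num k) (.pair T.enc (.num val))) (.pair T₂.enc T₃.enc) t ∧
            T₂.IsAug a b k ∧ T₃.IsAug a b k ∧
            T₂.points = T.points.filter (fun q => decide (q.x ≤ val)) ∧
            T₃.points = T.points.filter (fun q => decide (val < q.x)) ∧
            t ≤ C * (k * lg T.points.length)) ∧
          (∃ (T₂ T₃ : AugTree) (t : ℕ),
            Runs P splitY (.pair (.num k) (.pair T.enc (.num val))) (.pair T₂.enc T₃.enc) t ∧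
            T₂.IsAug a b k ∧ T₃.IsAug a b k ∧
            T₂.points = T.points.filter (fun q => decide (q.y ≤ val)) ∧
            T₃.points = T.points.filter (fun q => decide (val < q.y)) ∧
            t ≤ C * (k * lg T.points.length))) ∧
        -- concatenation: time `O(k log max(|T₁|, |T₄|))`
        (∀ T₁ T₄ : AugTree, T₁.IsAug a b k → T₄.IsAug a b k →
          (∀ p ∈ T₁.points, ∀ q ∈ T₄.points, p.x ≤ q.x) → IsLayer (T₁.points ++ T₄.points) →
          ∃ (T₅ : AugTree) (t : ℕ),
            Runs P concat (.pair (.num k) (.pair T₁.enc T₄.enc)) T₅.enc t ∧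
            T₅.IsAug a b k ∧ T₅.points = T₁.points ++ T₄.points ∧
            t ≤ C * (k * lg (max T₁.points.length T₄.points.length))) := by
  -- a common bound for the constants of all operations
  set D := 20000 * b * b with hD
  have hb2 : 2 ≤ b := by omega
  have hbb : 2 * b ≤ b * b := Nat.mul_le_mul_right _ hb2
  -- every bound `n` on the number of function activations becomes one on the number of steps
  have steps : ∀ {f n N : ℕ} {x y : Val}, Call a b f x y n → n ≤ D * N →
      ∃ t, Runs (prog a b) f x y t ∧ t ≤ ((prog a b).nodes + 1) * D * N := by
    rintro f n N x y ⟨t, hr, ht⟩ hn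
    refine ⟨t, hr, ht.trans ?_⟩
    rw [mul_assoc]
    exact Nat.mul_le_mul (Nat.le_succ _) hn
  have op : ∀ k n : ℕ, 1 ≤ k → 25 * opCost b k n + 25 ≤ D * (k * lg n) := fun k n hk => by
    have : 1 ≤ k * lg n := Nat.mul_pos hk (by unfold lg; omega)
    have : b * b ≤ b * b * (k * lg n) := Nat.le_mul_of_pos_right _ this
    unfold opCost
    nlinarith
  refine ⟨prog a b, Fn.build, Fn.searchX, Fn.searchY, Fn.insert, Fn.delete, Fn.splitX, Fn.splitY,
    Fn.concat, ((prog a b).nodes + 1) * D, fun k hk => ⟨fun pts h₁ h₂ => ?_, fun T p hT => ⟨?_, ?_⟩,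
    fun T p hT hp => ?_, fun T p hT hp => ?_, fun T z hT => ⟨?_, ?_⟩, fun T₁ T₄ h₁ h₄ hx hl => ?_⟩⟩
  · obtain ⟨T, hc, hW, hp, hs⟩ := calls_build hk ha hb pts
    obtain ⟨t, hr, ht⟩ := steps (N := (pts.length + 1) * lg k) hc (by
      gcongr; nlinarith)
    refine ⟨T, t, hr, (AugTree.isAug_iff (by omega)).2 ⟨by rwa [hp], by rwa [hp], hW⟩, hp, ht,
      hs.trans (Nat.mul_le_mul_right _ ?_)⟩
    nlinarith [Nat.zero_le ((prog a b).nodes * D)]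
  · have h1 : 1 ≤ lg T.points.length := by unfold lg; omega
    refine steps (calls_searchX ha _ hT p) ?_
    nlinarith
  · have h1 : 1 ≤ lg T.points.length := by unfold lg; omega
    refine steps (calls_searchY ha _ hT p) ?_
    nlinarith
  · obtain ⟨T', hc, hT', perm⟩ := calls_insert hk ha hb hT p hp
    obtain ⟨t, hr, ht⟩ := steps hc (le_trans (by omega) (op k T.points.length hk))
    exact ⟨T', t, hr, hT', perm, ht⟩
  · obtain ⟨T', hc, hT', perm⟩ := calls_delete hk ha hb hT p hp
    obtain ⟨t, hr, ht⟩ := steps hc (le_trans (by omega) (op k T.points.length hk))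
    exact ⟨T', t, hr, hT', perm, ht⟩
  · obtain ⟨T₂, T₃, hc, h₂, h₃, e₂, e₃⟩ := calls_splitX hk ha hb hT z
    obtain ⟨t, hr, ht⟩ := steps hc (le_trans (by omega) (op k T.points.length hk))
    exact ⟨T₂, T₃, t, hr, h₂, h₃, e₂, e₃, ht⟩
  · obtain ⟨T₂, T₃, hc, h₂, h₃, e₂, e₃⟩ := calls_splitY hk ha hb hT z
    obtain ⟨t, hr, ht⟩ := steps hc (le_trans (by omega) (op k T.points.length hk))
    exact ⟨T₂, T₃, t, hr, h₂, h₃, e₂, e₃, ht⟩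
  · have ha' : 1 ≤ a := by omega
    obtain ⟨s₁, -, W₁⟩ := (AugTree.isAug_iff ha').1 h₁
    obtain ⟨s₄, -, W₄⟩ := (AugTree.isAug_iff ha').1 h₄
    obtain ⟨T₅, hc, W₅, hp⟩ := calls_concat hk ha hb W₁ W₄
    obtain ⟨t, hr, ht⟩ := steps hc (le_trans (by omega)
      (op k (max T₁.points.length T₄.points.length) hk))
    refine ⟨T₅, t, hr, (AugTree.isAug_iff ha').2 ⟨?_, by rwa [hp], W₅⟩, hp, ht⟩
    rw [hp]
    exact List.pairwise_append.2 ⟨s₁, s₄, hx⟩
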